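/- Let $1\le n<M$ be integers, $r>0$ and $c\in\mathbb C\setminus\{0\}$. Put $m:=\lfloor M/n\rfloor$ and $p:=n-M+nm$. **The map $g$.** (a) *The map $\psi_q$ ($q\ge1$).* Let $A:=1+i\frac{q-1}{q}$. If $q\ge 2$, let $\psi_q$ be the piecewise linear map of the closed unit square that is affine on the following triangles and sends their vertices, in the given order, as indicated: $(A,0,1)\mapsto(A,0,1)$; $(A,0,i)\mapsto(A,0,\frac iq)$; $\left(A,\,i+\frac{j}{2q-2},\,i+\frac{j+1}{2q-2}\right)\mapsto\left(A,\frac{(j+1)i}{q},\frac{(j+2)i}{q}\right)$ for $0\le j\le q-2$; $(A,i+\frac12,i+1)\mapsto(A,i,i+1)$. Let $\psi_1:=\mathrm{id}$. Extend $\psi_q$ to $\{0\le \mathrm{Re}\,w\le 1\}$ by reflection in the lines $\mathrm{Im}\,w\in\mathbb Z$; for $q\ge2$ it is two-valued on the slits $\{0\le\mathrm{Re}\,w\le\frac12,\ \mathrm{Im}\,w\in2\mathbb Z+1\}$. (b) *The map $\zeta$.* For $1\le|z|\le e^{\pi/n}$ let $w=\frac n\pi\log z$ with $0\le \mathrm{Im}\,w<2n$.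 Let $u+iv:=\psi_m(w)$ if $\mathrm{Im}\, w<2p$ and $u+iv:=\psi_{m+1}(w)$ if $\mathrm{Im}\,w\ge 2p$. Let $T(v):=\frac{nm}{M}v$ for $0\le v\le 2p$ and $T(v):=2n+\frac{n(m+1)}{M}(v-2n)$ for $2p\le v\le 2n$, and put $\zeta(z):=\exp\left(\frac\pi n\left(u+i\left((1-u)T(v)+uv\right)\right)\right)$. (c) *The map $\sigma$.* Let $\mu(z)=\frac{z+1}{z-1}$ and let $\nu$ be the map of the right half-plane that preserves moduli, is the identity on $|\arg z|\le\frac\pi4$, and sends the argument $\pm\left(\frac\pi4+t\right)$ to $\pm\left(\frac\pi4+3t\right)$ for $0\le t\le \frac\pi4$. Let $\sigma:=\mu\circ\nu\circ\mu$ on $|z|>1$, extended continuously to $|z|=1$, and let $X$ be the closed set of those $z$ with $|z|\ge 1$ and $|z|^2\le 1+2|\mathrm{Im}\,z|$; off $X$, $\sigma$ is the identity. The set $\{\zeta : |\zeta|\ge 1,\ \zeta^M\in X\}$ consists of $2M$ lunes, one over each arc $\left\{e^{i\theta}:\frac{k\pi}{M}\le\theta\le\frac{(k+1)\pi}{M}\right\}$.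 (d) *The interpolation.* For $1\le|z|\le e^{\pi/n}$ let $\tilde g(z):=\sigma(\zeta(z)^M)$ if $\zeta(z)$ lies in one of those $2(M-n)$ lunes whose arc comes, under $z\mapsto\zeta(z)$, from a side of one of the radial slits of (a), and $\tilde g(z):=\zeta(z)^M$ otherwise. (On the slits the two values of $\zeta^M$ are complex conjugate points of the unit circle, which $\sigma$ identifies, so that $\tilde g$ is single-valued.) Finally let $$g(z):=\begin{cases} c\,z^n & |z|<r,\\ c\,r^n\,\tilde g(z/r) & r\le|z|\le re^{\pi/n},\\ c\,z^M/r^{M-n} & |z|>re^{\pi/n}.\end{cases}$$ **Multiplicity.** Say that a map $g$ has *multiplicity $k$ at $z$* if there are arbitrarily small open neighbourhoods $U$ of $z$ in which $z$ is the only preimage of $g(z)$ and every value in $g(U)\setminus\{g(z)\}$ is taken exactly $k$ times. The point $z$ is a *branched point* if this holds for some $k>1$, and a *simple* branched point if it holds for $k=2$. A *branched value* is the image of a branched point. A zero is *simple* if the multiplicity there is $1$. **Claim.** 1. The non-zero branched points of $g$ are exactly the points $$r\exp\left(\frac\pi n\cdot\frac{l}{2m-2}+i\,\frac{\pi(2k-1)}{n}\right),\qquad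 0\le l\le m-2,\ 1\le k\le p,$$ $$r\exp\left(\frac\pi n\cdot\frac{l}{2m}+i\,\frac{\pi(2k-1)}{n}\right),\qquad 0\le l\le m-1,\ p+1\le k\le n.$$ All of them are simple, and at every other non-zero point $g$ has multiplicity $1$. 2. Every non-zero branched value of $g$ is $c r^n$ or $-c r^n$. The value $-cr^n$ is always a branched value, and $cr^n$ is one if and only if $M>2n$. 3. The zeros of $g$ are $0$, at which $g$ has multiplicity $n$, and the points obtained from the two lists in 1 by replacing $l$ with $l+\frac12$, which are simple zeros. -/

import Mathlib

noncomputable section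

/-! ### Local multiplicity and branched points -/

/-- `g` is `k : 1` at `z`: there are arbitrarily small open neighbourhoods `U` of `z` in which `z`
is the only preimage of `g z` and every other value taken by `g` on `U` is taken exactly `k` times
on `U`. -/
def HasLocalMultiplicity (g : ℂ → ℂ) (z : ℂ) (k : ℕ) : Prop :=
  ∀ V ∈ nhds z, ∃ U ⊆ V, IsOpen U ∧ z ∈ U ∧ (∀ x ∈ U, g x = g z → x = z) ∧
    ∀ w ∈ g '' U, w ≠ g z → {x ∈ U | g x = w}.ncard = k

/-- A branched point: a point at which `g` is `k : 1` for some `k > 1`. -/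
def IsBranchedPoint (g : ℂ → ℂ) (z : ℂ) : Prop :=
  ∃ k : ℕ, 1 < k ∧ HasLocalMultiplicity g z k

/-- A simple branched point: a point at which `g` is `2 : 1`. -/
def IsSimpleBranchedPoint (g : ℂ → ℂ) (z : ℂ) : Prop :=
  HasLocalMultiplicity g z 2

/-- A branched value: the image of a branched point. -/
def IsBranchedValue (g : ℂ → ℂ) (w : ℂ) : Prop :=
  ∃ z, IsBranchedPoint g z ∧ g z = w

/-! ### The piecewise linear map in logarithmic coordinates -/

/-- The piecewise linear map `ψ_m` on the closed unit square.  Put `A = 1 + i (m - 1) / m`.  For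
`m ≥ 2` it is affine on each of the following triangles with apex `A`, and the vertices are sent to
the vertices in the order given:
* `(A, 0, 1) ↦ (A, 0, 1)`,
* `(A, 0, i) ↦ (A, 0, i / m)`,
* `(A, i, i + 1 / 2) ↦ (A, i / m, i)`; this is the union of the `m - 1` triangles
  `(A, i + j / (2 m - 2), i + (j + 1) / (2 m - 2)) ↦ (A, i (j + 1) / m, i (j + 2) / m)`
  with `0 ≤ j ≤ m - 2`, on which the affine maps coincide,
* `(A, i + 1 / 2, i + 1) ↦ (A, i, i + 1)`.
For `m = 1` the only vertices are the four corners, which are fixed, and `ψ_1` is the identity. -/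
def psiSquare (m : ℕ) (w : ℂ) : ℂ :=
  if m ≤ 1 then w
  else if w.im ≤ (1 - 1 / (m : ℝ)) * w.re then w
  else if w.im ≤ 1 - w.re / m then
    ⟨w.re, w.im / m + (1 - 1 / (m : ℝ)) ^ 2 * w.re⟩
  else if w.im ≤ 1 - 2 / (m : ℝ) * (w.re - 1 / 2) then
    ⟨m * (1 - w.im), 1 / m + 2 * (1 - 1 / (m : ℝ)) * w.re - m * (1 - w.im)⟩
  else ⟨2 * w.re - 1, w.im⟩

/-- The extension of `ψ_m` to the strip `0 ≤ Re w ≤ 1` by reflection in the lines `Im w = k`,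
`k ∈ ℤ`.  On the slits `0 ≤ Re w ≤ 1 / 2`, `Im w` odd, where the extension is two-valued, the
boundary value from below is taken. -/
def psiStrip (m : ℕ) (w : ℂ) : ℂ :=
  let k : ℤ := ⌊w.im / 2⌋
  let y : ℝ := w.im - 2 * k
  if y ≤ 1 then psiSquare m ⟨w.re, y⟩ + 2 * k * Complex.I
  else (starRingEnd ℂ) (psiSquare m ⟨w.re, 2 - y⟩) + 2 * (k + 1) * Complex.I

/-- The number `p = n - M + n m`, where `m = ⌊M / n⌋` (so that `M < n (m + 1)`). -/
def lowCount (n M : ℕ) : ℕ := n * (M / n + 1) - M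

/-- The logarithmic coordinate `(n / π) log z`, with the argument of `z` taken in `[0, 2 π)`.
It maps `1 ≤ |z| ≤ exp (π / n)` to `0 ≤ Re w ≤ 1`, `0 ≤ Im w < 2 n`, and the sector
`2 (j - 1) π / n ≤ arg z < 2 j π / n` to `2 (j - 1) ≤ Im w < 2 j`. -/
def logCoord (n : ℕ) (z : ℂ) : ℂ :=
  (n / Real.pi : ℝ) *
    (⟨Real.log ‖z‖, if 0 ≤ z.arg then z.arg else z.arg + 2 * Real.pi⟩ : ℂ)

/-- The map `η` in the logarithmic coordinate: `ψ_m` on the first `p` sectors and `ψ_{m+1}` on the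
other `n - p` sectors. -/
def etaLog (n M : ℕ) (w : ℂ) : ℂ :=
  if w.im < 2 * lowCount n M then psiStrip (M / n) w else psiStrip (M / n + 1) w

/-- The circle homeomorphism `τ`, as a map of the rescaled angle `v = n θ / π ∈ [0, 2 n]`: it
multiplies `θ ∈ [0, 2 π p / n]` by `n m / M`, and `θ - 2 π ∈ [- 2 π (n - p) / n, 0]` by
`n (m + 1) / M`. -/
def tauCircle (n M : ℕ) (v : ℝ) : ℝ :=
  if v ≤ 2 * lowCount n M then (n * (M / n : ℕ) / M : ℝ) * v
  else 2 * n + (n * ((M / n : ℕ) + 1) / M : ℝ) * (v - 2 * n)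

/-- The extension of `τ` to the annulus `1 ≤ |z| ≤ exp (π / n)` in the logarithmic coordinate: the
linear interpolation between `τ` on the circle `Re w = 0` and the identity on `Re w = 1`. -/
def tauLog (n M : ℕ) (w : ℂ) : ℂ :=
  ⟨w.re, (1 - w.re) * tauCircle n M w.im + w.re * w.im⟩

/-! ### The map `σ` -/

/-- The Möbius involution `μ(z) = (z + 1) / (z - 1)`, which exchanges `|z| > 1` and the right
half-plane. -/
def moebius (z : ℂ) : ℂ := (z + 1) / (z - 1)

/-- The map `ν` of the closed right half-plane: the identity on `|arg z| ≤ π / 4`, while the angles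
in the two remaining sectors, measured from the rays `|arg z| = π / 4`, are tripled. -/
def angleTriple (z : ℂ) : ℂ :=
  if |z.arg| ≤ Real.pi / 4 then z
  else if 0 < z.arg then
    ‖z‖ * Complex.exp (((Real.pi / 4 + 3 * (z.arg - Real.pi / 4) : ℝ) : ℂ) * Complex.I)
  else
    ‖z‖ * Complex.exp (((-(Real.pi / 4) + 3 * (z.arg + Real.pi / 4) : ℝ) : ℂ) * Complex.I)

/-- The map `σ = μ ∘ ν ∘ μ` from `|z| > 1` onto `ℂ ∖ [-1, 1]`, extended continuously to `|z| = 1`,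
which is folded onto `[-1, 1]`.  The value at `z = 1`, where `μ` has its pole, is the limit. -/
def sigma (z : ℂ) : ℂ :=
  if z = 1 then 1 else moebius (angleTriple (moebius z))

/-- The support of the dilatation of `σ`: the points of `|z| ≥ 1` with `|arg (μ z)| ≥ π / 4`,
together with `± 1`.  It consists of two lunes, which meet at `± 1`. -/
def lunes : Set ℂ := {z | 1 ≤ ‖z‖ ∧ ‖z‖ ^ 2 ≤ 1 + 2 * |z.im|}

/-! ### The interpolating map -/

/-- On the circle `|z| = 1` the map `τ` sends the end `2 j π / n` of the `j`-th sector to the angle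
`sectorEnd n M j * π / M`, where `sectorEnd n M j` is `2 j m` for `j ≤ p` and
`2 p m + 2 (j - p) (m + 1)` for `p ≤ j ≤ n`. -/
def sectorEnd (n M j : ℕ) : ℕ :=
  2 * j * (M / n) + 2 * (j - lowCount n M)

/-- Let `ζ = τ (η z)`, given by its logarithmic coordinate `w`.  The preimage of the two lunes under
`ζ ↦ ζ ^ M` consists of one lune over each of the `2 M` arcs `[k π / M, (k + 1) π / M]`.  The
boundary of the `j + 1`-st sector is sent by `τ ∘ η` to the arcs with
`sectorEnd j ≤ k < sectorEnd (j + 1)`; the first and the last of these come from `|z| = 1`, and the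
others from the two sides of the radial slit.  This is the union of those lunes
that neighbour a slit. -/
def slitLunes (n M : ℕ) : Set ℂ :=
  {w | Complex.exp ((M * Real.pi / n : ℝ) * w) ∈ lunes ∧
    ∃ j < n, (sectorEnd n M j : ℝ) + 1 ≤ w.im * M / n ∧
      w.im * M / n ≤ (sectorEnd n M (j + 1) : ℝ) - 1}

open Classical in
/-- The interpolation on `1 ≤ |z| ≤ exp (π / n)` between `z ^ n` and `z ^ M`:
with `ζ = τ (η z)`, it is `σ (ζ ^ M)` on the lunes that neighbour a slit, and `ζ ^ M` elsewhere. -/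
def unitInterpolation (n M : ℕ) (z : ℂ) : ℂ :=
  let w : ℂ := tauLog n M (etaLog n M (logCoord n z))
  let P : ℂ := Complex.exp ((M * Real.pi / n : ℝ) * w)
  if w ∈ slitLunes n M then sigma P else P

/-- The interpolating map on `r ≤ |z| ≤ r exp (π / n)`, extended by `c z ^ n` inside and by
`c z ^ M / r ^ (M - n)` outside. -/
def interpolatingMap (n M : ℕ) (r : ℝ) (c : ℂ) (z : ℂ) : ℂ :=
  if ‖z‖ < r then c * z ^ n
  else if ‖z‖ ≤ r * Real.exp (Real.pi / n) then c * r ^ n * unitInterpolation n M (z / r)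
  else c * z ^ M / r ^ (M - n)

/-- With `m = ⌊M / n⌋` and `p = n - M + n m`, the points
`r exp ((π / n) (l + s) / (2 m - 2) + i π (2 k - 1) / n)`, `0 ≤ l ≤ m - 2`, `1 ≤ k ≤ p`, and
`r exp ((π / n) (l + s) / (2 m) + i π (2 k - 1) / n)`, `0 ≤ l ≤ m - 1`, `p + 1 ≤ k ≤ n`. -/
def listedPoints (n M : ℕ) (r s : ℝ) : Set ℂ :=
  {z | ∃ l k : ℕ, l + 2 ≤ M / n ∧ 1 ≤ k ∧ k ≤ lowCount n M ∧
    z = r * Complex.exp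
      (((Real.pi / n * ((l + s) / (2 * (M / n : ℕ) - 2)) : ℝ) : ℂ) +
        ((Real.pi * (2 * k - 1) / n : ℝ) : ℂ) * Complex.I)} ∪
  {z | ∃ l k : ℕ, l + 1 ≤ M / n ∧ lowCount n M + 1 ≤ k ∧ k ≤ n ∧
    z = r * Complex.exp
      (((Real.pi / n * ((l + s) / (2 * (M / n : ℕ))) : ℝ) : ℂ) +
        ((Real.pi * (2 * k - 1) / n : ℝ) : ℂ) * Complex.I)}

end

open Filter Topology

/-! In the coordinate w = (n/π) log z, with r = c = 1, the map becomes `logMap`, which is exp (π w)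
for Re w < 0 and exp (π (M/n) w) for Re w > 1. In between it is exp (π L) or σ (exp (π L)), where L
= `annulusLog` is one-to-one from the period strip into Re L ≥ 0 (`annulusLog_injOn`). L opens the
slits 0 ≤ Re w ≤ 1/2, Im w = 2 j + 1 of the sectors with multiplier q = `sectorMult` ≥ 2. With e =
`sectorEnd`, an even integer, the lower side of such a slit goes to the points i (e + 1 + 2 (q - 1)
x), and the upper side to their reflections in the line Im L = e + q. So the two sides carry
conjugate values of P = exp (π L) on the unit circle. On |P| ≥ 1 the map σ identifies conjugate
points of |P| = 1 and nothing else (`sigma_eq_sigma`); it closes the slits again.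

Off the slits, L, the exponential and σ are locally one-to-one, and so is `logMap`. At a point of a
slit where P is not real, the two sides of the slit are mapped to the two sides of the segment (-1,
1), and again the map is locally one-to-one. Where P = ±1, each side of the slit gives a
half-neighbourhood of ±1 in |P| ≥ 1, which σ folds onto a full neighbourhood; the two sides make the
map 2 : 1 (`hasLocalMultiplicity_fold`). This happens when l = 2 (q - 1) x is an integer. For l = q
- 1, the end of the slit inside the annulus, there is a single half-neighbourhood and the map is
one-to-one (`exists_injOn_tip`). For l = 0 the slit meets |z| = 1, and σ is applied to only one half
of each side: these two halves cover a neighbourhood of -1 once, and the two others, together with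
exp (π w) on Re w < 0, cover it a second time (`hasLocalMultiplicity_foldCorner`).

The value at the point with index l is (-1) ^ (l + 1). Thus -1 is attained at the inner end of any
slit, while +1 needs l ≥ 1, that is a multiplier q ≥ 3, which exists if and only if M > 2 n. Zeros
arise only from σ (P) = 0, where P = ±i; these are the half-integral values of 2 (q - 1) x. -/

/-! ### The angle-tripling map of the closed right half-plane and its inverse. -/

/-- The real angle function of `angleTriple`. -/
noncomputable def tripleAngle (t : ℝ) : ℝ :=
  t + 2 * max (t - Real.pi / 4) 0 + 2 * min (t + Real.pi / 4) 0

/-- The inverse of `tripleAngle`. -/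
noncomputable def thirdAngle (t : ℝ) : ℝ :=
  t - 2 / 3 * max (t - Real.pi / 4) 0 - 2 / 3 * min (t + Real.pi / 4) 0

/-- One formula for the three branches: the maximum and the minimum switch on beyond ±π/4, which
makes continuity and monotonicity immediate. -/
theorem angleTriple_eq (z : ℂ) :
    angleTriple z = ‖z‖ * Complex.exp ((tripleAngle z.arg : ℝ) * Complex.I) := by
  have hpi := Real.pi_pos
  unfold angleTriple tripleAngle
  split_ifs with h1 h2
  · rw [abs_le] at h1
    rw [max_eq_right (by linarith), min_eq_right (by linarith)]
    simp [Complex.norm_mul_exp_arg_mul_I]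
  · have h3 : Real.pi / 4 < z.arg := by
      rw [abs_of_pos h2] at h1
      exact not_le.1 h1
    rw [max_eq_left (by linarith), min_eq_right (by linarith)]
    congr 4
    ring
  · have h3 : z.arg < -(Real.pi / 4) := by
      rw [abs_of_nonpos (not_lt.1 h2)] at h1
      linarith
    rw [max_eq_right (by linarith), min_eq_left (by linarith)]
    congr 4
    ring

theorem tripleAngle_strictMono : StrictMono tripleAngle := by
  intro a b hab
  unfold tripleAngle
  have h1 : max (a - Real.pi / 4) 0 ≤ max (b - Real.pi / 4) 0 :=
    max_le_max (by linarith) le_rfl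
  have h2 : min (a + Real.pi / 4) 0 ≤ min (b + Real.pi / 4) 0 :=
    min_le_min (by linarith) le_rfl
  linarith

theorem tripleAngle_neg (t : ℝ) : tripleAngle (-t) = -tripleAngle t := by
  have h1 : max (-t - Real.pi / 4) 0 = -min (t + Real.pi / 4) 0 := by
    rw [← max_neg_neg]; congr 1 <;> ring
  have h2 : min (-t + Real.pi / 4) 0 = -max (t - Real.pi / 4) 0 := by
    rw [← min_neg_neg]; congr 1 <;> ring
  unfold tripleAngle
  rw [h1, h2]; ring

theorem tripleAngle_pi_div_two : tripleAngle (Real.pi / 2) = Real.pi := by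
  have hpi := Real.pi_pos
  unfold tripleAngle
  rw [max_eq_left (by linarith), min_eq_right (by linarith)]
  ring

theorem tripleAngle_zero : tripleAngle 0 = 0 := by
  have h := tripleAngle_neg 0
  rw [neg_zero] at h
  linarith

theorem continuous_tripleAngle : Continuous tripleAngle := by
  unfold tripleAngle; fun_prop

theorem tripleAngle_thirdAngle (t : ℝ) : tripleAngle (thirdAngle t) = t := by
  have hpi := Real.pi_pos
  unfold tripleAngle thirdAngle
  rcases le_total t (-(Real.pi / 4)) with h | h
  · rw [max_eq_right (a := t - Real.pi / 4) (by linarith), min_eq_left (a := t + Real.pi / 4) (by linarith)]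
    rw [max_eq_right (by linarith), min_eq_left (by linarith)]
    ring
  · rw [min_eq_right (a := t + Real.pi / 4) (by linarith)]
    rcases le_total t (Real.pi / 4) with h' | h'
    · rw [max_eq_right (a := t - Real.pi / 4) (by linarith)]
      rw [max_eq_right (by linarith), min_eq_right (by linarith)]
      ring
    · rw [max_eq_left (a := t - Real.pi / 4) (by linarith)]
      rw [max_eq_left (by linarith), min_eq_right (by linarith)]
      ring

theorem thirdAngle_mem {t : ℝ} (ht : t ∈ Set.Icc (-Real.pi) Real.pi) :
    thirdAngle t ∈ Set.Icc (-(Real.pi / 2)) (Real.pi / 2) := by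
  constructor
  · rw [← tripleAngle_strictMono.le_iff_le, tripleAngle_neg, tripleAngle_pi_div_two,
      tripleAngle_thirdAngle]
    exact ht.1
  · rw [← tripleAngle_strictMono.le_iff_le, tripleAngle_pi_div_two, tripleAngle_thirdAngle]
    exact ht.2

theorem norm_angleTriple (z : ℂ) : ‖angleTriple z‖ = ‖z‖ := by
  rw [angleTriple_eq, norm_mul, Complex.norm_exp_ofReal_mul_I]
  simp

theorem tripleAngle_arg_mem {z : ℂ} (hz : 0 ≤ z.re) :
    tripleAngle z.arg ∈ Set.Icc (-Real.pi) Real.pi := by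
  have h := abs_le.1 (Complex.abs_arg_le_pi_div_two_iff.2 hz)
  constructor
  · rw [← tripleAngle_pi_div_two, ← tripleAngle_neg]
    exact tripleAngle_strictMono.monotone h.1
  · rw [← tripleAngle_pi_div_two]
    exact tripleAngle_strictMono.monotone h.2

/-- The closed right half-plane without 0 lies in the slit plane, where the argument is continuous;
at 0 preservation of the modulus suffices. -/
theorem continuousAt_angleTriple {z : ℂ} (hz : 0 ≤ z.re) : ContinuousAt angleTriple z := by
  rw [show angleTriple = _ from funext angleTriple_eq]
  by_cases h0 : z = 0
  · subst h0
    unfold ContinuousAt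
    beta_reduce
    rw [norm_zero, Complex.ofReal_zero, zero_mul, tendsto_zero_iff_norm_tendsto_zero]
    simp only [norm_mul, Complex.norm_exp_ofReal_mul_I, Complex.norm_real, norm_norm, mul_one]
    simpa using (continuous_norm (E := ℂ)).tendsto 0
  · have : z ∈ Complex.slitPlane := by
      rw [Complex.mem_slitPlane_iff]
      by_contra hh
      push Not at hh
      exact h0 (Complex.ext (le_antisymm hh.1 hz) hh.2)
    have ha := Complex.continuousAt_arg this
    have hb : ContinuousAt (fun z : ℂ => tripleAngle z.arg) z :=
      continuous_tripleAngle.continuousAt.comp ha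
    fun_prop

/-- The inverse of `angleTriple`. -/
noncomputable def angleThird (z : ℂ) : ℂ :=
  ‖z‖ * Complex.exp ((thirdAngle z.arg : ℝ) * Complex.I)

theorem norm_angleThird (z : ℂ) : ‖angleThird z‖ = ‖z‖ := by
  rw [angleThird, norm_mul, Complex.norm_exp_ofReal_mul_I]
  simp

theorem thirdAngle_arg_mem (z : ℂ) :
    thirdAngle z.arg ∈ Set.Icc (-(Real.pi / 2)) (Real.pi / 2) :=
  thirdAngle_mem ⟨(Complex.neg_pi_lt_arg z).le, Complex.arg_le_pi z⟩

theorem angleThird_re (z : ℂ) : (angleThird z).re = ‖z‖ * Real.cos (thirdAngle z.arg) := by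
  rw [angleThird, Complex.re_ofReal_mul, Complex.exp_ofReal_mul_I_re]

theorem angleThird_im (z : ℂ) : (angleThird z).im = ‖z‖ * Real.sin (thirdAngle z.arg) := by
  rw [angleThird, Complex.im_ofReal_mul, Complex.exp_ofReal_mul_I_im]

theorem angleThird_re_nonneg (z : ℂ) : 0 ≤ (angleThird z).re := by
  rw [angleThird_re]
  exact mul_nonneg (norm_nonneg _) (Real.cos_nonneg_of_mem_Icc (thirdAngle_arg_mem z))

theorem angleTriple_angleThird (z : ℂ) : angleTriple (angleThird z) = z := by
  by_cases h0 : z = 0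
  · subst h0
    have : ‖angleTriple (angleThird 0)‖ = 0 := by rw [norm_angleTriple, norm_angleThird, norm_zero]
    exact norm_eq_zero.1 this
  · rw [angleTriple_eq, norm_angleThird]
    have h1 : (angleThird z).arg = thirdAngle z.arg := by
      have hm := thirdAngle_arg_mem z
      have hpi := Real.pi_pos
      unfold angleThird
      rw [Complex.exp_mul_I]
      exact Complex.arg_mul_cos_add_sin_mul_I (norm_pos_iff.2 h0)
        ⟨by linarith [hm.1], by linarith [hm.2]⟩
    rw [h1, tripleAngle_thirdAngle, Complex.norm_mul_exp_arg_mul_I]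

/-- The tripled arguments lie in [-π, π], so they differ by a non-zero multiple of 2 π only as π and
-π. This folds the two halves of the imaginary axis together. -/
theorem angleTriple_eq_angleTriple {a b : ℂ} (ha : 0 ≤ a.re) (hb : 0 ≤ b.re)
    (h : angleTriple a = angleTriple b) : a = b ∨ (a.re = 0 ∧ b = (starRingEnd ℂ) a) := by
  have hpi := Real.pi_pos
  have hn : ‖a‖ = ‖b‖ := by rw [← norm_angleTriple a, h, norm_angleTriple]
  by_cases h0 : a = 0
  · left
    rw [h0, norm_zero] at hn
    rw [h0, norm_eq_zero.1 hn.symm]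
  have hn0 : (‖b‖ : ℂ) ≠ 0 := by
    rw [← hn]
    simpa using h0
  rw [angleTriple_eq, angleTriple_eq, hn, mul_right_inj' hn0, Complex.exp_eq_exp_iff_exists_int] at h
  obtain ⟨k, hk⟩ := h
  have hk' : tripleAngle a.arg = tripleAngle b.arg + k * (2 * Real.pi) := by
    have := congrArg Complex.im hk
    simpa using this
  have hma := tripleAngle_arg_mem ha
  have hmb := tripleAngle_arg_mem hb
  have polar : ∀ z : ℂ, z = ‖z‖ * Complex.exp (z.arg * Complex.I) := fun z =>
    (Complex.norm_mul_exp_arg_mul_I z).symm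
  have key : ∀ x y : ℂ, ‖x‖ = ‖y‖ → tripleAngle x.arg = Real.pi → tripleAngle y.arg = -Real.pi →
      x.re = 0 ∧ y = (starRingEnd ℂ) x := by
    intro x y hxy hx hy
    have hx' : x.arg = Real.pi / 2 :=
      tripleAngle_strictMono.injective (hx.trans tripleAngle_pi_div_two.symm)
    have hy' : y.arg = -(Real.pi / 2) :=
      tripleAngle_strictMono.injective (by rw [hy, tripleAngle_neg, tripleAngle_pi_div_two])
    have ex : x = ‖x‖ * Complex.I := by
      have := polar x
      rw [hx'] at this
      push_cast at this
      rwa [Complex.exp_pi_div_two_mul_I] at this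
    have ey : y = -(‖x‖ * Complex.I) := by
      have := polar y
      rw [hy', ← hxy] at this
      push_cast at this
      rw [← neg_div, Complex.exp_neg_pi_div_two_mul_I] at this
      rw [this]; ring
    constructor
    · rw [ex]; simp
    · rw [ey, ex]; simp
  have hkr : (k : ℝ) < 2 ∧ (-2 : ℝ) < k := by
    constructor <;> nlinarith [hma.1, hma.2, hmb.1, hmb.2]
  have hk1 : k < 2 := by exact_mod_cast hkr.1
  have hk2 : -2 < k := by exact_mod_cast hkr.2
  obtain rfl | rfl | rfl : k = -1 ∨ k = 0 ∨ k = 1 := by lia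
  · right
    push_cast at hk'
    have := key b a hn.symm (by linarith [hma.1, hmb.2]) (by linarith [hma.1, hmb.2])
    exact ⟨by rw [this.2]; simpa using this.1, by rw [this.2]; simp⟩
  · left
    have h3 : a.arg = b.arg := tripleAngle_strictMono.injective (by simpa using hk')
    rw [polar a, polar b, hn, h3]
  · right
    push_cast at hk'
    exact key a b hn (by linarith [hma.2, hmb.1]) (by linarith [hma.2, hmb.1])

/-! ### The Möbius involution, σ, and a section of σ. -/

theorem moebius_ne_one (z : ℂ) : moebius z ≠ 1 := by
  unfold moebius
  by_cases h : z - 1 = 0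
  -- Division by zero gives `moebius 1 = 0`, so the pole needs no exception.
  · simp [h]
  · rw [Ne, div_eq_one_iff_eq h]
    intro h2
    have : (2 : ℂ) = 0 := by linear_combination h2
    norm_num at this

theorem moebius_moebius {z : ℂ} (hz : z ≠ 1) : moebius (moebius z) = z := by
  have h : z - 1 ≠ 0 := sub_ne_zero.2 hz
  unfold moebius
  have h2 : (z + 1) / (z - 1) - 1 = 2 / (z - 1) := by field_simp; ring
  have h3 : (z + 1) / (z - 1) + 1 = 2 * z / (z - 1) := by field_simp; ring
  rw [h2, h3]
  field_simp

theorem moebius_re (z : ℂ) : (moebius z).re = (‖z‖ ^ 2 - 1) / Complex.normSq (z - 1) := by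
  rw [← Complex.normSq_eq_norm_sq, moebius, Complex.div_re, Complex.normSq_apply z]
  simp
  ring

theorem moebius_im (z : ℂ) : (moebius z).im = -2 * z.im / Complex.normSq (z - 1) := by
  rw [moebius, Complex.div_im]
  simp
  ring

theorem moebius_conj (z : ℂ) : moebius ((starRingEnd ℂ) z) = (starRingEnd ℂ) (moebius z) := by
  simp [moebius]

theorem moebius_re_nonneg {z : ℂ} (hz : 1 ≤ ‖z‖) : 0 ≤ (moebius z).re := by
  rw [moebius_re]
  exact div_nonneg (by nlinarith) (Complex.normSq_nonneg _)

theorem one_le_norm_moebius {a : ℂ} (ha : 0 ≤ a.re) (h1 : a ≠ 1) : 1 ≤ ‖moebius a‖ := by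
  have h : 0 < ‖a - 1‖ := norm_pos_iff.2 (sub_ne_zero.2 h1)
  rw [moebius, norm_div, one_le_div h]
  rw [← sq_le_sq₀ (norm_nonneg _) (norm_nonneg _), ← Complex.normSq_eq_norm_sq,
    ← Complex.normSq_eq_norm_sq, Complex.normSq_apply, Complex.normSq_apply]
  simp
  nlinarith

/-- Keeps the values of ν away from the pole of the second μ in σ. -/
theorem angleTriple_ne_one {a : ℂ} (ha : 0 ≤ a.re) (h1 : a ≠ 1) : angleTriple a ≠ 1 := by
  intro h
  have h2 : angleTriple 1 = 1 := by
    simp [angleTriple_eq, tripleAngle_zero]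
  rcases angleTriple_eq_angleTriple ha (by simp) (h.trans h2.symm) with h3 | h3
  · exact h1 h3
  · have := h3.2
    apply h1
    rw [← Complex.conj_conj a, ← this, map_one]

theorem moebius_injOn {a b : ℂ} (ha : a ≠ 1) (hb : b ≠ 1) (h : moebius a = moebius b) : a = b := by
  rw [← moebius_moebius ha, h, moebius_moebius hb]

theorem sigma_one : sigma 1 = 1 := if_pos rfl

theorem sigma_of_ne {z : ℂ} (hz : z ≠ 1) : sigma z = moebius (angleTriple (moebius z)) := if_neg hz

/-- All identifications come from ν on the imaginary axis, which corresponds under μ to the unit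
circle; μ commutes with conjugation. -/
theorem sigma_eq_sigma {z w : ℂ} (hz : 1 ≤ ‖z‖) (hw : 1 ≤ ‖w‖) (h : sigma z = sigma w) :
    z = w ∨ (‖z‖ = 1 ∧ w = (starRingEnd ℂ) z) := by
  by_cases hz1 : z = 1
  · left
    by_contra hw1
    rw [hz1, sigma_one, sigma_of_ne (fun h' => hw1 (hz1.trans h'.symm))] at h
    exact moebius_ne_one _ h.symm
  by_cases hw1 : w = 1
  · rw [hw1, sigma_one, sigma_of_ne hz1] at h
    exact absurd h (moebius_ne_one _)
  rw [sigma_of_ne hz1, sigma_of_ne hw1] at h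
  have ha := moebius_re_nonneg hz
  have hb := moebius_re_nonneg hw
  have h2 := moebius_injOn (angleTriple_ne_one ha (moebius_ne_one z))
    (angleTriple_ne_one hb (moebius_ne_one w)) h
  rcases angleTriple_eq_angleTriple ha hb h2 with h3 | ⟨h3, h4⟩
  · exact Or.inl (moebius_injOn hz1 hw1 h3)
  · right
    constructor
    · rw [moebius_re, div_eq_zero_iff] at h3
      rcases h3 with h3 | h3
      · nlinarith
      · exact absurd (sub_eq_zero.1 (Complex.normSq_eq_zero.1 h3)) hz1
    · rw [← moebius_conj] at h4
      refine moebius_injOn hw1 ?_ h4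
      intro h5
      apply hz1
      rw [← Complex.conj_conj z, h5, map_one]

/-- If the argument exceeded π/4 in absolute value, the sine of the excess would be positive; times
‖a‖ it is a positive multiple of |Im a| - Re a. -/
theorem abs_arg_le_pi_div_four {a : ℂ} (h : |a.im| ≤ a.re) : |a.arg| ≤ Real.pi / 4 := by
  have hpi := Real.pi_pos
  have hre : 0 ≤ a.re := (abs_nonneg _).trans h
  by_cases h0 : a = 0
  · rw [h0, Complex.arg_zero, abs_zero]
    positivity
  have hn : 0 < ‖a‖ := norm_pos_iff.2 h0
  have harg := abs_le.1 (Complex.abs_arg_le_pi_div_two_iff.2 hre)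
  have hc := Complex.norm_mul_cos_arg a
  have hs := Complex.norm_mul_sin_arg a
  have hr : 0 < √2 / 2 := by positivity
  rw [abs_le] at h ⊢
  constructor
  · by_contra hlt
    have : 0 < Real.sin (-Real.pi / 4 - a.arg) :=
      Real.sin_pos_of_pos_of_lt_pi (by linarith) (by linarith)
    rw [Real.sin_sub, neg_div, Real.sin_neg, Real.cos_neg, Real.sin_pi_div_four,
      Real.cos_pi_div_four] at this
    have := mul_pos hn this
    have e : ‖a‖ * (-(√2 / 2) * Real.cos a.arg - √2 / 2 * Real.sin a.arg) =
      -(√2 / 2) * (a.re + a.im) := by rw [← hc, ← hs]; ring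
    nlinarith
  · by_contra hlt
    have : 0 < Real.sin (a.arg - Real.pi / 4) :=
      Real.sin_pos_of_pos_of_lt_pi (by linarith) (by linarith)
    rw [Real.sin_sub, Real.sin_pi_div_four, Real.cos_pi_div_four] at this
    have := mul_pos hn this
    have e : ‖a‖ * (Real.sin a.arg * (√2 / 2) - Real.cos a.arg * (√2 / 2)) =
      (√2 / 2) * (a.im - a.re) := by rw [← hc, ← hs]; ring
    nlinarith

/-- For z ≠ 1 the hypothesis amounts to |Im μ(z)| ≤ Re μ(z), so ν fixes μ(z), and μ is an
involution. -/
theorem sigma_eq_self {z : ℂ} (h : 1 + 2 * |z.im| ≤ ‖z‖ ^ 2) : sigma z = z := by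
  by_cases hz1 : z = 1
  · rw [hz1, sigma_one]
  have hpos : 0 < Complex.normSq (z - 1) := Complex.normSq_pos.2 (sub_ne_zero.2 hz1)
  have him : |(moebius z).im| ≤ (moebius z).re := by
    rw [moebius_re, moebius_im, abs_div, abs_mul, abs_of_pos hpos, abs_neg, abs_two]
    gcongr
    linarith
  rw [sigma_of_ne hz1, angleTriple, if_pos (abs_arg_le_pi_div_four him), moebius_moebius hz1]

theorem sigma_eq_self_of_im_eq_zero {z : ℂ} (hz : 1 ≤ ‖z‖) (h : z.im = 0) : sigma z = z := by
  apply sigma_eq_self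
  rw [h, abs_zero]
  nlinarith

theorem arg_ne_pi_of_re_nonneg {a : ℂ} (ha : 0 ≤ a.re) : a.arg ≠ Real.pi := by
  have hpi := Real.pi_pos
  have harg := abs_le.1 (Complex.abs_arg_le_pi_div_two_iff.2 ha)
  intro h
  linarith

theorem angleTriple_conj {a : ℂ} (ha : 0 ≤ a.re) :
    angleTriple ((starRingEnd ℂ) a) = (starRingEnd ℂ) (angleTriple a) := by
  rw [angleTriple_eq, angleTriple_eq, Complex.arg_conj, if_neg (arg_ne_pi_of_re_nonneg ha),
    tripleAngle_neg, map_mul, ← Complex.exp_conj]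
  simp

theorem angleTriple_inv {a : ℂ} (ha : 0 ≤ a.re) : angleTriple a⁻¹ = (angleTriple a)⁻¹ := by
  rw [angleTriple_eq, angleTriple_eq, Complex.arg_inv, if_neg (arg_ne_pi_of_re_nonneg ha),
    tripleAngle_neg, mul_inv, ← Complex.exp_neg]
  simp

theorem angleTriple_of_re_eq_zero {a : ℂ} (ha : a.re = 0) : angleTriple a = -‖a‖ := by
  rcases eq_or_ne a.im 0 with h | h
  · have : a = 0 := Complex.ext ha h
    rw [this]
    simp [angleTriple_eq]
  rw [angleTriple_eq]
  rcases h.lt_or_gt with h | h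
  · rw [Complex.arg_eq_neg_pi_div_two_iff.2 ⟨ha, h⟩, tripleAngle_neg, tripleAngle_pi_div_two]
    simp [Complex.exp_neg]
  · rw [Complex.arg_eq_pi_div_two_iff.2 ⟨ha, h⟩, tripleAngle_pi_div_two]
    simp

theorem sigma_conj {z : ℂ} (hz : 1 ≤ ‖z‖) :
    sigma ((starRingEnd ℂ) z) = (starRingEnd ℂ) (sigma z) := by
  by_cases h1 : z = 1
  · rw [h1, map_one, sigma_one, map_one]
  rw [sigma_of_ne h1, sigma_of_ne (fun h => h1 ((map_eq_one_iff _ (starRingEnd ℂ).injective).1 h)), moebius_conj,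
    angleTriple_conj (moebius_re_nonneg hz), moebius_conj]

/-- Here μ(z) is purely imaginary, and on the imaginary axis ν depends on the modulus only. -/
theorem sigma_conj_of_norm_eq_one {z : ℂ} (hz : ‖z‖ = 1) :
    sigma ((starRingEnd ℂ) z) = sigma z := by
  by_cases h1 : z = 1
  · rw [h1, map_one]
  have hre : (moebius z).re = 0 := by rw [moebius_re, hz]; simp
  rw [sigma_of_ne h1, sigma_of_ne (fun h => h1 ((map_eq_one_iff _ (starRingEnd ℂ).injective).1 h)), moebius_conj,
    angleTriple_of_re_eq_zero hre, angleTriple_of_re_eq_zero (by simpa using hre)]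
  simp

theorem moebius_im_nonneg_iff {z : ℂ} (hz : z ≠ 1) : 0 ≤ (moebius z).im ↔ z.im ≤ 0 := by
  have hpos : 0 < Complex.normSq (z - 1) := Complex.normSq_pos.2 (sub_ne_zero.2 hz)
  rw [moebius_im, le_div_iff₀ hpos]
  constructor <;> intro h <;> linarith

theorem moebius_im_nonpos_iff {z : ℂ} (hz : z ≠ 1) : (moebius z).im ≤ 0 ↔ 0 ≤ z.im := by
  have hpos : 0 < Complex.normSq (z - 1) := Complex.normSq_pos.2 (sub_ne_zero.2 hz)
  rw [moebius_im, div_le_iff₀ hpos]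
  constructor <;> intro h <;> linarith

/-- μ exchanges the upper and the lower half-plane and is applied twice; ν respects the sign of the
argument. -/
theorem sigma_im_nonpos {z : ℂ} (hz : 1 ≤ ‖z‖) (h : z.im ≤ 0) : (sigma z).im ≤ 0 := by
  by_cases h1 : z = 1
  · rw [h1, sigma_one]; simp
  have ha := moebius_re_nonneg hz
  rw [sigma_of_ne h1, moebius_im_nonpos_iff (angleTriple_ne_one ha (moebius_ne_one z)),
    angleTriple_eq, Complex.im_ofReal_mul, Complex.exp_ofReal_mul_I_im]
  refine mul_nonneg (norm_nonneg _) (Real.sin_nonneg_of_nonneg_of_le_pi ?_ (tripleAngle_arg_mem ha).2)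
  rw [← tripleAngle_zero]
  exact tripleAngle_strictMono.monotone
    (Complex.arg_nonneg_iff.2 ((moebius_im_nonneg_iff h1).2 h))

theorem moebius_neg (z : ℂ) : moebius (-z) = (moebius z)⁻¹ := by
  rw [moebius, moebius, inv_div, ← neg_div_neg_eq]
  congr 1 <;> ring

theorem moebius_inv {b : ℂ} (hb : b ≠ 0) : moebius b⁻¹ = -moebius b := by
  by_cases h1 : b = 1
  · rw [h1]; simp [moebius]
  have h2 : b - 1 ≠ 0 := sub_ne_zero.2 h1
  have h3 : 1 - b ≠ 0 := sub_ne_zero.2 (Ne.symm h1)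
  have e1 : b⁻¹ + 1 = (1 + b) / b := by field_simp
  have e2 : b⁻¹ - 1 = (1 - b) / b := by field_simp
  rw [moebius, moebius, e1, e2]
  field_simp
  ring

/-- μ turns negation into inversion and inversion back into negation, and ν commutes with inversion.
Real points, which σ fixes, are treated apart to avoid μ and its reciprocal at ±1. -/
theorem sigma_neg {z : ℂ} (hz : 1 ≤ ‖z‖) : sigma (-z) = -sigma z := by
  by_cases h1 : z.im = 0
  · rw [sigma_eq_self_of_im_eq_zero hz h1, sigma_eq_self_of_im_eq_zero (by simpa using hz) (by simpa using h1)]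
  have h2 : z ≠ 1 := by rintro rfl; simp at h1
  have h3 : -z ≠ 1 := by intro h; apply h1; rw [← neg_neg z, h]; simp
  have h4 : moebius z ≠ 0 := by
    rw [moebius, Ne, div_eq_zero_iff, not_or]
    refine ⟨fun h => h3 (by linear_combination -h), sub_ne_zero.2 h2⟩
  rw [sigma_of_ne h2, sigma_of_ne h3, moebius_neg, angleTriple_inv (moebius_re_nonneg hz), moebius_inv]
  rw [← norm_ne_zero_iff, norm_angleTriple]
  exact norm_ne_zero_iff.2 h4

theorem continuousAt_moebius {z : ℂ} (hz : z ≠ 1) : ContinuousAt moebius z := by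
  have := sub_ne_zero.2 hz
  unfold moebius
  fun_prop (disch := assumption)

/-- Continuity in the full plane even at points of the unit circle: the formula for σ makes sense on
both sides of it. -/
theorem continuousAt_sigma {z : ℂ} (hz : 1 ≤ ‖z‖) (h1 : z ≠ 1) : ContinuousAt sigma z := by
  have ha := moebius_re_nonneg hz
  have h2 : ContinuousAt (fun z => moebius (angleTriple (moebius z))) z :=
    ContinuousAt.comp (f := fun z => angleTriple (moebius z))
      (continuousAt_moebius (angleTriple_ne_one ha (moebius_ne_one z)))
      (ContinuousAt.comp (continuousAt_angleTriple ha) (continuousAt_moebius h1))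
  refine h2.congr ?_
  filter_upwards [isOpen_ne.mem_nhds h1] with w hw
  exact (sigma_of_ne hw).symm

/-- The right inverse of `sigma` with values in `1 ≤ ‖z‖`. -/
noncomputable def sigmaInv (s : ℂ) : ℂ := moebius (angleThird (moebius s))

theorem angleThird_ne_one {a : ℂ} (ha : a ≠ 1) : angleThird a ≠ 1 := by
  intro h
  apply ha
  rw [← angleTriple_angleThird a, h]
  simp [angleTriple_eq, tripleAngle_zero]

theorem one_le_norm_sigmaInv (s : ℂ) : 1 ≤ ‖sigmaInv s‖ :=
  one_le_norm_moebius (angleThird_re_nonneg _) (angleThird_ne_one (moebius_ne_one s))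

theorem sigma_sigmaInv {s : ℂ} (hs : s ≠ 1) : sigma (sigmaInv s) = s := by
  unfold sigmaInv
  rw [sigma_of_ne (moebius_ne_one _), moebius_moebius (angleThird_ne_one (moebius_ne_one s)),
    angleTriple_angleThird, moebius_moebius hs]

/-- Principal arguments lie in (-π, π], so over the cut [-1, 1] the section selects the preimage in
the closed lower half-plane. -/
theorem sigmaInv_im_nonpos {s : ℂ} (hs : s ≠ 1) (h : s.im ≤ 0) : (sigmaInv s).im ≤ 0 := by
  have h2 : angleThird (moebius s) ≠ 1 := angleThird_ne_one (moebius_ne_one s)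
  have h3 := (moebius_im_nonneg_iff hs).2 h
  have hm := thirdAngle_arg_mem (moebius s)
  have hpi := Real.pi_pos
  rw [sigmaInv, ← moebius_im_nonneg_iff (moebius_ne_one _), moebius_moebius h2, angleThird_im]
  refine mul_nonneg (norm_nonneg _) (Real.sin_nonneg_of_nonneg_of_le_pi ?_ (by linarith [hm.2]))
  rw [← tripleAngle_strictMono.le_iff_le, tripleAngle_zero, tripleAngle_thirdAngle]
  exact Complex.arg_nonneg_iff.2 h3

theorem sigmaInv_neg_one : sigmaInv (-1) = -1 := by
  simp [sigmaInv, moebius, angleThird]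

/-- The section jumps across the cut, but -1 is an end of the cut: μ(-1) = 0, and `angleThird`
preserves moduli. -/
theorem continuousAt_sigmaInv_neg_one : ContinuousAt sigmaInv (-1) := by
  have h0 : moebius (-1) = 0 := by simp [moebius]
  have h1 : ContinuousAt angleThird (moebius (-1)) := by
    rw [h0]
    have : angleThird 0 = 0 := by simp [angleThird]
    unfold ContinuousAt
    rw [this, tendsto_zero_iff_norm_tendsto_zero]
    simp only [norm_angleThird]
    simpa using (continuous_norm (E := ℂ)).tendsto 0
  have h2 : angleThird (moebius (-1)) ≠ 1 := angleThird_ne_one (moebius_ne_one _)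
  exact ContinuousAt.comp (f := fun z => angleThird (moebius z)) (continuousAt_moebius h2)
    (ContinuousAt.comp h1 (continuousAt_moebius (by norm_num)))

theorem sigma_I : sigma Complex.I = 0 := by
  have h : moebius Complex.I = -Complex.I := by
    have h2 : Complex.I - 1 ≠ 0 := fun h => by simpa using congrArg Complex.re h
    rw [moebius, div_eq_iff h2]
    linear_combination Complex.I_sq
  have h1 : Complex.I ≠ 1 := fun h => by simpa using congrArg Complex.re h
  rw [sigma_of_ne h1, h, angleTriple_of_re_eq_zero (by simp)]
  simp [moebius]

theorem sigma_eq_zero {P : ℂ} (hP : 1 ≤ ‖P‖) (h : sigma P = 0) :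
    P = Complex.I ∨ P = -Complex.I := by
  rcases sigma_eq_sigma (z := Complex.I) (by simp) hP (sigma_I.trans h.symm) with h1 | ⟨-, h1⟩
  · exact Or.inl h1.symm
  · exact Or.inr (by simpa using h1)

/-- The only other candidate is the conjugate of P; as the section takes its value in Im ≤ 0 as
well, P would then be real. -/
theorem sigmaInv_sigma_of_im_nonpos {P : ℂ} (hP : 1 ≤ ‖P‖) (h : P.im ≤ 0) (h1 : sigma P ≠ 1) :
    sigmaInv (sigma P) = P := by
  have h2 := sigmaInv_im_nonpos h1 (sigma_im_nonpos hP h)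
  rcases sigma_eq_sigma (one_le_norm_sigmaInv _) hP (sigma_sigmaInv h1) with h3 | ⟨-, h3⟩
  · exact h3
  · have him : (sigmaInv (sigma P)).im = 0 := by
      refine le_antisymm h2 ?_
      rw [h3, Complex.conj_im] at h
      linarith
    exact (h3.trans (Complex.conj_eq_iff_im.2 him)).symm

/-! ### Criteria for local multiplicity. -/

theorem hasLocalMultiplicity_one_of_injOn {g : ℂ → ℂ} {z : ℂ} {N : Set ℂ} (hN : N ∈ 𝓝 z)
    (h : Set.InjOn g N) : HasLocalMultiplicity g z 1 := by
  intro V hV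
  obtain ⟨U, hU, hUo, hzU⟩ := mem_nhds_iff.1 (inter_mem hN hV)
  refine ⟨U, fun x hx => (hU hx).2, hUo, hzU, fun x hx hxz => h (hU hx).1 (hU hzU).1 hxz, ?_⟩
  rintro _ ⟨u, hu, rfl⟩ -
  rw [Set.ncard_eq_one]
  refine ⟨u, Set.ext fun x => ⟨fun hx => h (hU hx.1).1 (hU hu).1 hx.2, ?_⟩⟩
  rintro rfl
  exact ⟨hu, rfl⟩

/-- A neighbourhood W ⊆ U contains no more preimages than U, so counts k > 1 on W and 1 on U are
incompatible. W has a point besides z because singletons are not open. -/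
theorem HasLocalMultiplicity.not_isBranchedPoint {g : ℂ → ℂ} {z : ℂ}
    (h : HasLocalMultiplicity g z 1) : ¬ IsBranchedPoint g z := by
  rintro ⟨k, hk, hb⟩
  obtain ⟨U, -, hUo, hzU, hU1, hU2⟩ := h Set.univ univ_mem
  obtain ⟨W, hWU, hWo, hzW, hW1, hW2⟩ := hb U (hUo.mem_nhds hzU)
  obtain ⟨y, hyW, hyz⟩ : ∃ y ∈ W, y ≠ z := by
    by_contra hcon
    push Not at hcon
    have : W = {z} := Set.eq_singleton_iff_unique_mem.2 ⟨hzW, hcon⟩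
    rw [this] at hWo
    exact not_isOpen_singleton z hWo
  have hgy : g y ≠ g z := fun h => hyz (hW1 y hyW h)
  have h1 := hU2 (g y) ⟨y, hWU hyW, rfl⟩ hgy
  have h2 := hW2 (g y) ⟨y, hyW, rfl⟩ hgy
  -- An infinite set has `ncard` 0, so the count 1 yields finiteness.
  have hfin : {x ∈ U | g x = g y}.Finite := Set.finite_of_ncard_ne_zero (by rw [h1]; norm_num)
  have h3 : {x ∈ W | g x = g y}.ncard ≤ {x ∈ U | g x = g y}.ncard :=
    Set.ncard_le_ncard (fun x hx => ⟨hWU hx.1, hx.2⟩) hfin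
  lia

/-- Transfers multiplicities through a chart that is only locally injective; no inverse is needed,
since images of open sets under the chart are open. -/
theorem HasLocalMultiplicity.of_comp {f g h : ℂ → ℂ} {w : ℂ} {k : ℕ} {C : ℂ} (hC : C ≠ 0)
    (hgf : ∀ x, g (h x) = C * f x) (hc : ContinuousAt h w) (ho : IsOpenMap h) {N : Set ℂ}
    (hN : N ∈ 𝓝 w) (hinj : Set.InjOn h N) (hf : HasLocalMultiplicity f w k) :
    HasLocalMultiplicity g (h w) k := by
  intro V hV
  obtain ⟨U, hUN, hUo, hwU, h1, h2⟩ := hf _ (inter_mem hN (hc hV))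
  have hinjU : Set.InjOn h U := hinj.mono fun x hx => (hUN hx).1
  have hiff : ∀ x y, g (h x) = g (h y) ↔ f x = f y := fun x y => by
    rw [hgf, hgf, mul_right_inj' hC]
  refine ⟨h '' U, ?_, ho U hUo, ⟨w, hwU, rfl⟩, ?_, ?_⟩
  · rintro _ ⟨x, hx, rfl⟩
    exact (hUN hx).2
  · rintro _ ⟨x, hx, rfl⟩ hxw
    rw [h1 x hx ((hiff x w).1 hxw)]
  · rintro _ ⟨_, ⟨x, hx, rfl⟩, rfl⟩ hne
    rw [← h2 (f x) ⟨x, hx, rfl⟩ fun h' => hne ((hiff x w).2 h')]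
    rw [← (hinjU.mono (Set.sep_subset U _)).ncard_image]
    congr 1
    ext y
    constructor
    · rintro ⟨⟨u, hu, rfl⟩, hy⟩
      exact ⟨u, ⟨hu, (hiff u x).1 hy⟩, rfl⟩
    · rintro ⟨u, ⟨hu, hux⟩, rfl⟩
      exact ⟨⟨u, hu, rfl⟩, (hiff u x).2 hux⟩

/-- Two local sections that differ off s₀ and together exhaust the points near w₀. They have to be
continuous at s₀ only, so they may be patched together from pieces that do not fit elsewhere. -/
theorem hasLocalMultiplicity_two {f h₁ h₂ : ℂ → ℂ} {w₀ s₀ : ℂ} (hf0 : f w₀ = s₀)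
    (e₁ : h₁ s₀ = w₀) (e₂ : h₂ s₀ = w₀) (c₁ : ContinuousAt h₁ s₀) (c₂ : ContinuousAt h₂ s₀)
    (r₁ : ∀ᶠ s in 𝓝 s₀, f (h₁ s) = s) (r₂ : ∀ᶠ s in 𝓝 s₀, f (h₂ s) = s)
    (hne : ∀ᶠ s in 𝓝 s₀, s ≠ s₀ → h₁ s ≠ h₂ s)
    (hcov : ∀ᶠ w in 𝓝 w₀, w = h₁ (f w) ∨ w = h₂ (f w))
    (hf : ∀ᶠ w in 𝓝 w₀, ContinuousAt f w) : HasLocalMultiplicity f w₀ 2 := by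
  intro V hV
  obtain ⟨W, hW, hWo, hwW⟩ := mem_nhds_iff.1 (inter_mem hV (inter_mem hcov hf))
  have hW1 : ∀ᶠ s in 𝓝 s₀, h₁ s ∈ W := c₁ (by rw [e₁]; exact hWo.mem_nhds hwW)
  have hW2 : ∀ᶠ s in 𝓝 s₀, h₂ s ∈ W := c₂ (by rw [e₂]; exact hWo.mem_nhds hwW)
  obtain ⟨B, hB, hBo, hsB⟩ := mem_nhds_iff.1 (hW1.and (hW2.and (r₁.and (r₂.and hne))))
  -- Restricting to f ⁻¹' B keeps both sections inside the neighbourhood over every value attained.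
  refine ⟨W ∩ f ⁻¹' B, fun x hx => (hW hx.1).1, ?_, ⟨hwW, by rwa [Set.mem_preimage, hf0]⟩, ?_, ?_⟩
  · exact ContinuousOn.isOpen_inter_preimage
      (fun x hx => ContinuousAt.continuousWithinAt (hW hx).2.2) hWo hBo
  · rintro x ⟨hx, -⟩ hxw
    rw [hf0] at hxw
    rcases (hW hx).2.1 with h | h
    · rw [h, hxw, e₁]
    · rw [h, hxw, e₂]
  · rintro _ ⟨x, ⟨hx, hxB⟩, rfl⟩ hxw
    obtain ⟨b1, b2, b3, b4, b5⟩ := hB hxB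
    rw [Set.ncard_eq_two]
    refine ⟨h₁ (f x), h₂ (f x), b5 (by rwa [← hf0]), Set.ext fun y => ⟨?_, ?_⟩⟩
    · rintro ⟨⟨hy, -⟩, hyx⟩
      rw [← hyx]
      exact (hW hy).2.1
    · rintro (rfl | rfl)
      · exact ⟨⟨b1, by rw [Set.mem_preimage, b3]; exact hxB⟩, b3⟩
      · exact ⟨⟨b2, by rw [Set.mem_preimage, b4]; exact hxB⟩, b4⟩

/-- A ball about 0 contains, together with x, all n-th roots of x ^ n. -/
theorem hasLocalMultiplicity_pow {g : ℂ → ℂ} {n : ℕ} (hn : 1 ≤ n) {c : ℂ} (hc : c ≠ 0)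
    (hg : ∀ᶠ z in 𝓝 0, g z = c * z ^ n) : HasLocalMultiplicity g 0 n := by
  have hn0 : n ≠ 0 := by lia
  intro V hV
  obtain ⟨ε, hε, hball⟩ := Metric.mem_nhds_iff.1 (inter_mem hV hg)
  have hg' : ∀ z ∈ Metric.ball (0 : ℂ) ε, g z = c * z ^ n := fun z hz => (hball hz).2
  have h0 := hg' 0 (Metric.mem_ball_self hε)
  rw [zero_pow hn0, mul_zero] at h0
  refine ⟨Metric.ball 0 ε, fun x hx => (hball hx).1, Metric.isOpen_ball, Metric.mem_ball_self hε,
    ?_, ?_⟩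
  · intro x hx hx0
    rw [h0, hg' x hx] at hx0
    simpa [hc, hn0] using hx0
  · rintro _ ⟨x, hx, rfl⟩ hxne
    rw [h0, hg' x hx] at hxne
    have hx0 : x ≠ 0 := by
      rintro rfl
      simp [hn0] at hxne
    have hprim := Complex.isPrimitiveRoot_exp n hn0
    have hset : {y ∈ Metric.ball (0 : ℂ) ε | g y = g x} =
        ((Polynomial.nthRoots n (x ^ n)).toFinset : Set ℂ) := by
      ext y
      simp only [Set.mem_ofPred_eq, Finset.mem_coe, Multiset.mem_toFinset,
        Polynomial.mem_nthRoots (Nat.pos_of_ne_zero hn0)]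
      constructor
      · rintro ⟨hy, hyx⟩
        rw [hg' y hy, hg' x hx] at hyx
        exact mul_left_cancel₀ hc hyx
      · intro hyx
        have hy : y ∈ Metric.ball (0 : ℂ) ε := by
          have := congrArg norm hyx
          rw [norm_pow, norm_pow] at this
          have := (pow_left_inj₀ (norm_nonneg _) (norm_nonneg _) hn0).1 this
          rw [mem_ball_zero_iff] at hx ⊢
          rwa [this]
        exact ⟨hy, by rw [hg' y hy, hg' x hx, hyx]⟩
    rw [hset, Set.ncard_coe_finset, Multiset.toFinset_card_of_nodup
      (hprim.nthRoots_nodup (pow_ne_zero n hx0)), hprim.card_nthRoots, if_pos ⟨x, rfl⟩]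

/-! ### Pasting lemmas, and sheets glued along the unit circle. -/

theorem continuousAt_of_closed_cover {f : ℂ → ℂ} {w : ℂ} {ι : Type*} [Finite ι] {A : ι → Set ℂ}
    (hA : ∀ i, IsClosed (A i)) (hcov : ∀ᶠ x in 𝓝 w, ∃ i, x ∈ A i) {g : ι → ℂ → ℂ}
    (hg : ∀ i, w ∈ A i → ContinuousAt (g i) w)
    (hfg : ∀ i, ∀ᶠ x in 𝓝 w, x ∈ A i → f x = g i x) : ContinuousAt f w := by
  intro V hV
  have h : ∀ i, ∀ᶠ x in 𝓝 w, x ∈ A i → f x ∈ V := by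
    intro i
    by_cases hi : w ∈ A i
    · have hfw : f w = g i w := (hfg i).self_of_nhds hi
      have h2 : ∀ᶠ x in 𝓝 w, g i x ∈ V := hg i hi (by rwa [← hfw])
      filter_upwards [hfg i, h2] with x h3 h4 h5
      rw [h3 h5]
      exact h4
    · filter_upwards [(hA i).isOpen_compl.mem_nhds hi] with x h3 h5
      exact absurd h5 h3
  have h' := eventually_all.2 h
  rw [mem_map]
  filter_upwards [hcov, h'] with x ⟨i, hi⟩ h3
  exact h3 i hi

/-- A function which agrees at every point with one of two functions with the same limit. -/
theorem tendsto_of_or {α β : Type*} {l : Filter α} {l' : Filter β} {f g₁ g₂ : α → β}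
    (h₁ : Tendsto g₁ l l') (h₂ : Tendsto g₂ l l') (h : ∀ᶠ x in l, f x = g₁ x ∨ f x = g₂ x) :
    Tendsto f l l' := by
  intro V hV
  have a₁ : ∀ᶠ x in l, g₁ x ∈ V := h₁ hV
  have a₂ : ∀ᶠ x in l, g₂ x ∈ V := h₂ hV
  rw [mem_map]
  filter_upwards [h, a₁, a₂] with x h3 h4 h5
  rcases h3 with h3 | h3
  · rw [Set.mem_preimage, h3]; exact h4
  · rw [Set.mem_preimage, h3]; exact h5

theorem sigma_neg_one : sigma (-1) = -1 := sigma_eq_self (by simp)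

theorem tendsto_conj_neg_one : Tendsto (starRingEnd ℂ) (𝓝 (-1)) (𝓝 (-1)) := by
  have := Complex.continuous_conj.tendsto (-1)
  simpa using this

/-- Two sheets, each covering `1 ≤ ‖z‖` near `-1` and followed by `sigma`, which are glued along
the unit circle by complex conjugation. -/
theorem hasLocalMultiplicity_fold {f P Q p q : ℂ → ℂ} {A B : Set ℂ} {w₀ : ℂ} (hAc : IsClosed A)
    (hBc : IsClosed B) (hw₀ : w₀ ∈ A) (hcov : ∀ᶠ w in 𝓝 w₀, w ∈ A ∨ w ∈ B) (hP0 : P w₀ = -1)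
    (hPc : Continuous P) (hQc : Continuous Q)
    (hA : ∀ᶠ w in 𝓝 w₀, w ∈ A → 1 ≤ ‖P w‖ ∧ p (P w) = w ∧ f w = sigma (P w))
    (hB : ∀ᶠ w in 𝓝 w₀, w ∈ B → 1 ≤ ‖Q w‖ ∧ q (Q w) = w ∧ f w = sigma (Q w))
    (hp : ContinuousAt p (-1)) (hq : ContinuousAt q (-1)) (hp0 : p (-1) = w₀) (hq0 : q (-1) = w₀)
    (hpA : ∀ᶠ z in 𝓝 (-1), 1 ≤ ‖z‖ → p z ∈ A ∧ P (p z) = z)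
    (hqB : ∀ᶠ z in 𝓝 (-1), 1 ≤ ‖z‖ → q z ∈ B ∧ Q (q z) = z)
    (hsep : ∀ᶠ w in 𝓝 w₀, w ∈ A → w ∈ B → ‖P w‖ = 1)
    (hglue : ∀ᶠ z in 𝓝 (-1), ‖z‖ = 1 → q z = p ((starRingEnd ℂ) z)) :
    HasLocalMultiplicity f w₀ 2 := by
  have hf0 : f w₀ = -1 := by
    rw [(hA.self_of_nhds hw₀).2.2, hP0, sigma_neg_one]
  have hk : Tendsto sigmaInv (𝓝 (-1)) (𝓝 (-1)) := by
    have := continuousAt_sigmaInv_neg_one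
    rwa [ContinuousAt, sigmaInv_neg_one] at this
  have hfc : ∀ᶠ w in 𝓝 w₀, ContinuousAt f w := by
    have hQne : ∀ᶠ w in 𝓝 w₀, w ∈ B → Q w ≠ 1 := by
      by_cases h : w₀ ∈ B
      · have : Q w₀ = -1 := by
          have h2 := (hqB.self_of_nhds (by simp)).2
          rwa [hq0] at h2
        filter_upwards [hQc.continuousAt.eventually_ne (show Q w₀ ≠ 1 by rw [this]; norm_num)]
          with w hw _ using hw
      · filter_upwards [hBc.isOpen_compl.mem_nhds h] with w hw hw2
        exact absurd hw2 hw
    have hPne : ∀ᶠ w in 𝓝 w₀, P w ≠ 1 :=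
      hPc.continuousAt.eventually_ne (by rw [hP0]; norm_num)
    filter_upwards [hcov.eventually_nhds, hA.eventually_nhds, hB.eventually_nhds, hPne, hQne]
      with w h1 h2 h3 h4 h5
    refine continuousAt_of_closed_cover (A := fun b : Bool => if b then A else B)
      (g := fun b : Bool => if b then fun w => sigma (P w) else fun w => sigma (Q w)) ?_ ?_ ?_ ?_
    · rintro (_ | _) <;> simpa
    · filter_upwards [h1] with x hx
      rcases hx with hx | hx
      · exact ⟨true, by simpa⟩
      · exact ⟨false, by simpa⟩
    · rintro (_ | _)
      · intro hw
        replace hw : w ∈ B := by simpa using hw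
        exact ContinuousAt.comp (f := Q) (continuousAt_sigma (h3.self_of_nhds hw).1 (h5 hw))
          hQc.continuousAt
      · intro hw
        replace hw : w ∈ A := by simpa using hw
        exact ContinuousAt.comp (f := P) (continuousAt_sigma (h2.self_of_nhds hw).1 h4)
          hPc.continuousAt
    · rintro (_ | _)
      · filter_upwards [h3] with x hx hxB
        exact (hx (by simpa using hxB)).2.2
      · filter_upwards [h2] with x hx hxA
        exact (hx (by simpa using hxA)).2.2
  have hfw : Tendsto f (𝓝 w₀) (𝓝 (-1)) := by
    have := hfc.self_of_nhds
    rwa [ContinuousAt, hf0] at this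
  have hs1 : ∀ᶠ s : ℂ in 𝓝 (-1), s ≠ 1 := eventually_ne_nhds (by norm_num)
  have hpw : Tendsto p (𝓝 (-1)) (𝓝 w₀) := by rwa [ContinuousAt, hp0] at hp
  have hqw : Tendsto q (𝓝 (-1)) (𝓝 w₀) := by rwa [ContinuousAt, hq0] at hq
  -- `sigmaInv` picks one preimage of s in |z| ≥ 1, and each of the two sheets has one point over
  -- it.
  refine hasLocalMultiplicity_two (h₁ := fun s => p (sigmaInv s)) (h₂ := fun s => q (sigmaInv s))
    hf0 (by rw [sigmaInv_neg_one, hp0]) (by rw [sigmaInv_neg_one, hq0]) ?_ ?_ ?_ ?_ ?_ ?_ hfc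
  · rw [ContinuousAt, sigmaInv_neg_one, hp0]
    exact hpw.comp hk
  · rw [ContinuousAt, sigmaInv_neg_one, hq0]
    exact hqw.comp hk
  · filter_upwards [hs1, hk.eventually hpA, hk.eventually (hpw.eventually hA)] with s h1 h2 h3
    obtain ⟨h4, h5⟩ := h2 (one_le_norm_sigmaInv s)
    rw [(h3 h4).2.2, h5, sigma_sigmaInv h1]
  · filter_upwards [hs1, hk.eventually hqB, hk.eventually (hqw.eventually hB)] with s h1 h2 h3
    obtain ⟨h4, h5⟩ := h2 (one_le_norm_sigmaInv s)
    rw [(h3 h4).2.2, h5, sigma_sigmaInv h1]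
  -- If the sections met over s, the common point would lie on the seam; the gluing would then make
  -- `sigmaInv s` real and of modulus 1, so s would be ±1.
  · filter_upwards [hs1, hk.eventually hpA, hk.eventually hqB, hk.eventually (hpw.eventually hsep),
      hk.eventually hglue, hk.eventually (tendsto_conj_neg_one.eventually hpA)]
      with s h1 h2 h3 h4 h5 h6 hs heq
    obtain ⟨a1, a2⟩ := h2 (one_le_norm_sigmaInv s)
    obtain ⟨b1, b2⟩ := h3 (one_le_norm_sigmaInv s)
    have hn := h4 a1 (by rw [heq]; exact b1)
    rw [a2] at hn
    have h7 := (h6 (by simpa using hn.ge)).2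
    rw [← h5 hn, ← heq, a2, eq_comm, Complex.conj_eq_iff_im] at h7
    have h8 := sigma_eq_self_of_im_eq_zero hn.ge h7
    rw [sigma_sigmaInv h1] at h8
    rw [← h8] at hn h7
    have h9 : s = s.re := Complex.ext (by simp) (by simpa using h7)
    rw [h9, Complex.norm_real, Real.norm_eq_abs, abs_eq zero_le_one] at hn
    rcases hn with hn | hn
    · exact h1 (by rw [h9, hn]; simp)
    · exact hs (by rw [h9, hn]; simp)
  -- The point of the sheet below w is `sigmaInv (f w)` or, on the unit circle, its conjugate; in
  -- the second case the gluing leads to the section of the other sheet.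
  · have hkf := hk.comp hfw
    filter_upwards [hcov, hA, hB, hfw.eventually hs1, hkf.eventually hglue,
      hkf.eventually (tendsto_conj_neg_one.eventually hglue)] with w h1 h2 h3 h4 h5 h6
    have hfk := sigma_sigmaInv h4
    rcases h1 with hw | hw
    · obtain ⟨a1, a2, a3⟩ := h2 hw
      rcases sigma_eq_sigma (one_le_norm_sigmaInv _) a1 (hfk.trans a3) with h7 | ⟨h7, h8⟩
      · left; rw [h7, a2]
      · right
        have := h5 h7
        simp only [Function.comp] at this
        rw [this, ← h8, a2]
    · obtain ⟨a1, a2, a3⟩ := h3 hw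
      rcases sigma_eq_sigma (one_le_norm_sigmaInv _) a1 (hfk.trans a3) with h7 | ⟨h7, h8⟩
      · right; rw [h7, a2]
      · left
        have := h6 (by simpa using h7)
        simp only [Function.comp, Complex.conj_conj] at this
        rw [← this, ← h8, a2]

/-- Two sheets over `1 ≤ ‖z‖` near `-1`, each of them half followed by `sigma` and half not, and a
sheet over `‖z‖ ≤ 1`, which together cover a neighbourhood of `-1` twice. -/
theorem hasLocalMultiplicity_foldCorner {f P Q D p q d : ℂ → ℂ} {A B C : Set ℂ} {w₀ : ℂ}
    (hAc : IsClosed A) (hBc : IsClosed B) (hCc : IsClosed C) (hwA : w₀ ∈ A)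
    (hcov : ∀ᶠ w in 𝓝 w₀, w ∈ A ∨ w ∈ B ∨ (w ∈ C ∧ ‖D w‖ < 1))
    (hPc : Continuous P) (hQc : Continuous Q) (hDc : Continuous D)
    (hA : ∀ᶠ w in 𝓝 w₀, w ∈ A → 1 ≤ ‖P w‖ ∧ p (P w) = w ∧ (0 ≤ (P w).im → f w = P w) ∧
      ((P w).im ≤ 0 → f w = sigma (P w)))
    (hB : ∀ᶠ w in 𝓝 w₀, w ∈ B → 1 ≤ ‖Q w‖ ∧ q (Q w) = w ∧ ((Q w).im ≤ 0 → f w = Q w) ∧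
      (0 ≤ (Q w).im → f w = sigma (Q w)))
    (hC : ∀ᶠ w in 𝓝 w₀, w ∈ C → d (D w) = w ∧ f w = D w)
    (hp : ContinuousAt p (-1)) (hq : ContinuousAt q (-1)) (hd : ContinuousAt d (-1))
    (hp0 : p (-1) = w₀) (hq0 : q (-1) = w₀) (hd0 : d (-1) = w₀)
    (hpA : ∀ᶠ z in 𝓝 (-1), 1 ≤ ‖z‖ → p z ∈ A ∧ P (p z) = z)
    (hqB : ∀ᶠ z in 𝓝 (-1), 1 ≤ ‖z‖ → q z ∈ B ∧ Q (q z) = z)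
    (hdC : ∀ᶠ z in 𝓝 (-1), ‖z‖ ≤ 1 → d z ∈ C ∧ D (d z) = z)
    (hsep : ∀ᶠ w in 𝓝 w₀, w ∈ A → w ∈ B → ‖P w‖ = 1 ∧ (P w).im ≤ 0 ∧
      Q w = (starRingEnd ℂ) (P w))
    (hsepC : ∀ᶠ w in 𝓝 w₀, w ∈ C → w ∈ A ∨ w ∈ B → ‖D w‖ = 1)
    (hglue : ∀ᶠ z in 𝓝 (-1), ‖z‖ = 1 → 0 ≤ z.im → q z = p ((starRingEnd ℂ) z)) :
    HasLocalMultiplicity f w₀ 2 := by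
  have hP0 : P w₀ = -1 := by
    have h2 := (hpA.self_of_nhds (by simp)).2
    rwa [hp0] at h2
  have hQ0 : Q w₀ = -1 := by
    have h2 := (hqB.self_of_nhds (by simp)).2
    rwa [hq0] at h2
  have hf0 : f w₀ = -1 := by
    rw [(hA.self_of_nhds hwA).2.2.1 (by rw [hP0]; simp), hP0]
  have hk : Tendsto sigmaInv (𝓝 (-1)) (𝓝 (-1)) := by
    have := continuousAt_sigmaInv_neg_one
    rwa [ContinuousAt, sigmaInv_neg_one] at this
  have hk' : Tendsto (fun s => (starRingEnd ℂ) (sigmaInv ((starRingEnd ℂ) s))) (𝓝 (-1))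
      (𝓝 (-1)) := tendsto_conj_neg_one.comp (hk.comp tendsto_conj_neg_one)
  have hPne : ∀ᶠ w in 𝓝 w₀, P w ≠ 1 :=
    hPc.continuousAt.eventually_ne (by rw [hP0]; norm_num)
  have hQne : ∀ᶠ w in 𝓝 w₀, Q w ≠ 1 :=
    hQc.continuousAt.eventually_ne (by rw [hQ0]; norm_num)
  have hfc : ∀ᶠ w in 𝓝 w₀, ContinuousAt f w := by
    filter_upwards [hcov.eventually_nhds, hA.eventually_nhds, hB.eventually_nhds,
      hC.eventually_nhds, hPne, hQne] with w h1 h2 h3 h4 h5 h6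
    have hPi : Continuous fun w => (P w).im := Complex.continuous_im.comp hPc
    have hQi : Continuous fun w => (Q w).im := Complex.continuous_im.comp hQc
    -- Five closed pieces: the sheet over the disc, and the two exterior sheets, each cut along Im =
    -- 0.
    refine continuousAt_of_closed_cover
      (A := ![C, A ∩ {w | 0 ≤ (P w).im}, A ∩ {w | (P w).im ≤ 0}, B ∩ {w | (Q w).im ≤ 0},
        B ∩ {w | 0 ≤ (Q w).im}])
      (g := ![D, P, fun w => sigma (P w), Q, fun w => sigma (Q w)]) ?_ ?_ ?_ ?_
    · intro i
      fin_cases i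
      · exact hCc
      · exact hAc.inter (isClosed_le continuous_const hPi)
      · exact hAc.inter (isClosed_le hPi continuous_const)
      · exact hBc.inter (isClosed_le hQi continuous_const)
      · exact hBc.inter (isClosed_le continuous_const hQi)
    · filter_upwards [h1] with x hx
      rcases hx with hx | hx | hx
      · rcases le_total 0 (P x).im with h | h
        · exact ⟨1, hx, h⟩
        · exact ⟨2, hx, h⟩
      · rcases le_total 0 (Q x).im with h | h
        · exact ⟨4, hx, h⟩
        · exact ⟨3, hx, h⟩
      · exact ⟨0, hx.1⟩
    · intro i
      fin_cases i
      · exact fun _ => hDc.continuousAt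
      · exact fun _ => hPc.continuousAt
      · exact fun hw => ContinuousAt.comp (f := P)
          (continuousAt_sigma (h2.self_of_nhds hw.1).1 h5) hPc.continuousAt
      · exact fun _ => hQc.continuousAt
      · exact fun hw => ContinuousAt.comp (f := Q)
          (continuousAt_sigma (h3.self_of_nhds hw.1).1 h6) hQc.continuousAt
    · intro i
      fin_cases i
      · filter_upwards [h4] with x hx hxC using (hx hxC).2
      · filter_upwards [h2] with x hx hxA using (hx hxA.1).2.2.1 hxA.2
      · filter_upwards [h2] with x hx hxA using (hx hxA.1).2.2.2 hxA.2
      · filter_upwards [h3] with x hx hxA using (hx hxA.1).2.2.1 hxA.2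
      · filter_upwards [h3] with x hx hxA using (hx hxA.1).2.2.2 hxA.2
  have hfw : Tendsto f (𝓝 w₀) (𝓝 (-1)) := by
    have := hfc.self_of_nhds
    rwa [ContinuousAt, hf0] at this
  have hs1 : ∀ᶠ s : ℂ in 𝓝 (-1), s ≠ 1 := eventually_ne_nhds (by norm_num)
  have hpw : Tendsto p (𝓝 (-1)) (𝓝 w₀) := by rwa [ContinuousAt, hp0] at hp
  have hqw : Tendsto q (𝓝 (-1)) (𝓝 w₀) := by rwa [ContinuousAt, hq0] at hq
  have hdw : Tendsto d (𝓝 (-1)) (𝓝 w₀) := by rwa [ContinuousAt, hd0] at hd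
  have hne1 : ∀ {s : ℂ}, s ≠ 1 → (starRingEnd ℂ) s ≠ 1 := fun hs h =>
    hs ((map_eq_one_iff _ (starRingEnd ℂ).injective).1 h)
  -- `h₁` runs through the two halves that are followed by σ, `h₂` through the two other halves and
  -- the sheet over the disc. For Im s > 0 the section of σ is conjugated so that it lands in the
  -- closed upper half-plane.
  refine hasLocalMultiplicity_two
    (h₁ := fun s => if s.im ≤ 0 then p (sigmaInv s)
      else q ((starRingEnd ℂ) (sigmaInv ((starRingEnd ℂ) s))))
    (h₂ := fun s => if ‖s‖ < 1 then d s else if s.im ≤ 0 then q s else p s)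
    hf0 (by simp [sigmaInv_neg_one, hp0]) (by simp [hq0]) ?_ ?_ ?_ ?_ ?_ ?_ hfc
  · have e : (if (-1 : ℂ).im ≤ 0 then p (sigmaInv (-1))
        else q ((starRingEnd ℂ) (sigmaInv ((starRingEnd ℂ) (-1))))) = w₀ := by
      simp [sigmaInv_neg_one, hp0]
    rw [ContinuousAt, e]
    refine tendsto_of_or (hpw.comp hk) (hqw.comp hk') (Eventually.of_forall fun s => ?_)
    by_cases h : s.im ≤ 0
    · left; simp [h]
    · right; simp [h]
  · have e : (if ‖(-1 : ℂ)‖ < 1 then d (-1) else if (-1 : ℂ).im ≤ 0 then q (-1) else p (-1)) =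
        w₀ := by simp [hq0]
    rw [ContinuousAt, e]
    have h1 : Tendsto (fun s : ℂ => if s.im ≤ 0 then q s else p s) (𝓝 (-1)) (𝓝 w₀) :=
      tendsto_of_or hqw hpw (Eventually.of_forall fun s => by
        by_cases h : s.im ≤ 0 <;> simp [h])
    exact tendsto_of_or hdw h1 (Eventually.of_forall fun s => by
        by_cases h : ‖s‖ < 1 <;> simp [h])
  · filter_upwards [hs1, hk.eventually hpA, hk'.eventually hqB, hk.eventually (hpw.eventually hA),
      hk'.eventually (hqw.eventually hB)] with s h1 h2 h3 h4 h5
    by_cases h : s.im ≤ 0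
    · simp only [h, if_true]
      obtain ⟨a1, a2⟩ := h2 (one_le_norm_sigmaInv s)
      rw [(h4 a1).2.2.2 (by rw [a2]; exact sigmaInv_im_nonpos h1 h), a2, sigma_sigmaInv h1]
    · simp only [h, if_false]
      have hn := one_le_norm_sigmaInv ((starRingEnd ℂ) s)
      obtain ⟨a1, a2⟩ := h3 (by simpa using hn)
      have h6 : ((starRingEnd ℂ) s).im ≤ 0 := by
        rw [Complex.conj_im]; linarith
      have h7 := sigmaInv_im_nonpos (hne1 h1) h6
      rw [(h5 a1).2.2.2 (by rw [a2, Complex.conj_im]; linarith), a2, sigma_conj hn,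
        sigma_sigmaInv (hne1 h1), Complex.conj_conj]
  · filter_upwards [hpA, hqB, hdC, hpw.eventually hA, hqw.eventually hB, hdw.eventually hC]
      with s h1 h2 h3 h4 h5 h6
    by_cases hn : ‖s‖ < 1
    · simp only [hn, if_true]
      obtain ⟨a1, a2⟩ := h3 hn.le
      rw [(h6 a1).2, a2]
    simp only [hn, if_false]
    have hn' : 1 ≤ ‖s‖ := not_lt.1 hn
    by_cases h : s.im ≤ 0
    · simp only [h, if_true]
      obtain ⟨a1, a2⟩ := h2 hn'
      rw [(h5 a1).2.2.1 (by rwa [a2]), a2]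
    · simp only [h, if_false]
      obtain ⟨a1, a2⟩ := h1 hn'
      rw [(h4 a1).2.2.1 (by rw [a2]; linarith), a2]
  · filter_upwards [hpA, hqB, hdC, hk.eventually hpA, hk'.eventually hqB,
      hqw.eventually hsep, hpw.eventually hsep, hdw.eventually hsepC, hs1]
      with s h1 h2 h3 h4 h5 h6 h7 h8 h10 hs
    have hnk := one_le_norm_sigmaInv s
    have hnk' : 1 ≤ ‖(starRingEnd ℂ) (sigmaInv ((starRingEnd ℂ) s))‖ := by
      simpa using one_le_norm_sigmaInv ((starRingEnd ℂ) s)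
    by_cases hn : ‖s‖ < 1
    · simp only [hn, if_true]
      obtain ⟨a1, a2⟩ := h3 hn.le
      intro heq
      have h9 : d s ∈ A ∨ d s ∈ B := by
        rw [← heq]
        by_cases h : s.im ≤ 0
        · simp only [h, if_true]; exact Or.inl (h4 hnk).1
        · simp only [h, if_false]; exact Or.inr (h5 hnk').1
      have := h8 a1 h9
      rw [a2] at this
      linarith
    simp only [hn, if_false]
    have hn' : 1 ≤ ‖s‖ := not_lt.1 hn
    by_cases h : s.im ≤ 0
    -- A common value would lie on the seam, where Q is conjugate to P and Im P ≤ 0; together with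
    -- Im s ≤ 0 this makes s real of modulus 1.
    · simp only [h, if_true]
      intro heq
      obtain ⟨a1, a2⟩ := h2 hn'
      obtain ⟨b1, b2⟩ := h4 hnk
      obtain ⟨c1, c2, c3⟩ := h6 (by rw [← heq]; exact b1) a1
      rw [a2, ← heq, b2] at c3
      rw [← heq, b2] at c1 c2
      have c4 : s.im = 0 := by
        refine le_antisymm h ?_
        rw [c3, Complex.conj_im]; linarith
      have c5 : ‖s‖ = 1 := by rw [c3]; simpa using c1
      have h9 : s = s.re := Complex.ext (by simp) (by simpa using c4)
      rw [h9, Complex.norm_real, Real.norm_eq_abs, abs_eq zero_le_one] at c5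
      rcases c5 with c5 | c5
      · exact h10 (by rw [h9, c5]; simp)
      · exact hs (by rw [h9, c5]; simp)
    · simp only [h, if_false]
      intro heq
      obtain ⟨a1, a2⟩ := h1 hn'
      obtain ⟨b1, b2⟩ := h5 hnk'
      obtain ⟨c1, c2, c3⟩ := h7 a1 (by rw [← heq]; exact b1)
      rw [a2] at c2
      exact h c2
  · filter_upwards [hcov, hA, hB, hC, hfw.eventually hs1, (hQc.tendsto' w₀ (-1) hQ0).eventually hglue]
      with w h1 h2 h3 h4 h5 h6
    rcases h1 with hw | hw | ⟨hw, hwn⟩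
    · obtain ⟨a1, a2, a3, a4⟩ := h2 hw
      by_cases h : (P w).im ≤ 0
      · left
        have e := a4 h
        rw [e] at h5 ⊢
        simp only [sigma_im_nonpos a1 h, if_true]
        rw [sigmaInv_sigma_of_im_nonpos a1 h h5, a2]
      · right
        rw [a3 (not_le.1 h).le]
        simp only [not_lt.2 a1, if_false, h]
        exact a2.symm
    · obtain ⟨a1, a2, a3, a4⟩ := h3 hw
      by_cases h : (Q w).im ≤ 0
      · right
        rw [a3 h]
        simp only [not_lt.2 a1, if_false, h, if_true]
        exact a2.symm
      · left
        have hQi : 0 ≤ (Q w).im := (not_le.1 h).le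
        have e := a4 hQi
        rw [e] at h5 ⊢
        have hconj : sigmaInv ((starRingEnd ℂ) (sigma (Q w))) = (starRingEnd ℂ) (Q w) := by
          rw [← sigma_conj a1]
          refine sigmaInv_sigma_of_im_nonpos (by simpa using a1) (by simpa using hQi) ?_
          rw [sigma_conj a1]
          exact hne1 h5
        -- In the first case σ (Q w) lies on the cut, where `sigmaInv` returns the conjugate of Q w;
        -- the gluing moves this point to the other sheet.
        by_cases hi : (sigma (Q w)).im ≤ 0
        · simp only [hi, if_true]
          rcases sigma_eq_sigma (one_le_norm_sigmaInv _) a1 (sigma_sigmaInv h5) with h7 | ⟨h7, h8⟩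
          · exact absurd (by rw [← h7]; exact sigmaInv_im_nonpos h5 hi) h
          · have h9 : sigmaInv (sigma (Q w)) = (starRingEnd ℂ) (Q w) := by
              conv_rhs => rw [h8, Complex.conj_conj]
            rw [h9, ← h6 (by rw [h8]; simpa using h7) hQi, a2]
        · simp only [hi, if_false]
          rw [hconj, Complex.conj_conj, a2]
    · right
      obtain ⟨a1, a2⟩ := h4 hw
      rw [a2]
      simp only [hwn, if_true, a1]

/-! ### The piecewise linear map of the square in terms of minima and maxima. -/

/-- The real part of `psiSquare`. -/
noncomputable def squareRe (q : ℕ) (x d : ℝ) : ℝ :=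
  if q ≤ 1 then x else max (min x (q * (1 - d))) (2 * x - 1)

/-- The imaginary part of `psiSquare`. -/
noncomputable def squareIm (q : ℕ) (x d : ℝ) : ℝ :=
  if q ≤ 1 then d else
    min d (max (1 / q * d + (1 - 1 / q) ^ 2 * x) (1 / q + 2 * (1 - 1 / q) * x - q * (1 - d)))

theorem exists_inv_natCast {q : ℕ} (hq : 2 ≤ q) :
    0 < 1 / (q : ℝ) ∧ 1 / (q : ℝ) ≤ 1 / 2 ∧ 1 / (q : ℝ) * q = 1 := by
  have h : (2 : ℝ) ≤ q := by exact_mod_cast hq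
  refine ⟨by positivity, ?_, by field_simp⟩
  exact one_div_le_one_div_of_le (by norm_num) h

section regions
variable {q : ℕ} {x d : ℝ}

/-- The lines from A = (1, 1 - a), a = 1/q, to 0, i and i + 1/2 are d = (1 - a) x, d = 1 - a x and d
= 1 - a (2 x - 1). They bound the four regions, and on each region one term of every minimum and
maximum is active. -/
theorem square_region₁ (hq : 2 ≤ q) (hx : x ≤ 1) (h : d ≤ (1 - 1 / q) * x) :
    squareRe q x d = x ∧ squareIm q x d = d := by
  obtain ⟨h0, h1, h2⟩ := exists_inv_natCast hq
  have hq1 : ¬ q ≤ 1 := by lia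
  rw [squareRe, squareIm, if_neg hq1, if_neg hq1]
  generalize 1 / (q : ℝ) = a at *
  have hq0 : (0 : ℝ) < q := by positivity
  have e : (q : ℝ) * a = 1 := by linarith
  constructor
  · rw [min_eq_left, max_eq_left (by linarith)]
    nlinarith [mul_le_mul_of_nonneg_left h hq0.le, mul_nonneg hq0.le (sub_nonneg.2 hx),
      mul_nonneg (mul_nonneg hq0.le (sub_nonneg.2 hx)) h0.le]
  · rw [min_eq_left]
    refine le_max_of_le_left ?_
    nlinarith [mul_le_mul_of_nonneg_left h (by linarith : 0 ≤ 1 - a)]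

theorem square_region₂ (hq : 2 ≤ q) (hx : x ≤ 1) (h : (1 - 1 / q) * x ≤ d)
    (h' : d ≤ 1 - 1 / q * x) :
    squareRe q x d = x ∧ squareIm q x d = 1 / q * d + (1 - 1 / q) ^ 2 * x := by
  obtain ⟨h0, h1, h2⟩ := exists_inv_natCast hq
  have hq1 : ¬ q ≤ 1 := by lia
  rw [squareRe, squareIm, if_neg hq1, if_neg hq1]
  have hq0 : (2 : ℝ) ≤ q := by exact_mod_cast hq
  generalize 1 / (q : ℝ) = a at *
  have e : (q : ℝ) * a = 1 := by linarith
  have h3 : x ≤ q * (1 - d) := by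
    nlinarith [mul_le_mul_of_nonneg_left h' (by linarith : (0 : ℝ) ≤ q)]
  constructor
  · rw [min_eq_left h3, max_eq_left (by linarith)]
  · have e1 : (a - q) * (1 - a * x - d) ≤ 0 :=
      mul_nonpos_of_nonpos_of_nonneg (by linarith) (by linarith)
    have e2 : q * a * x = x := by rw [e, one_mul]
    rw [max_eq_left, min_eq_right]
    · nlinarith [mul_le_mul_of_nonneg_left h (by linarith : 0 ≤ 1 - a)]
    · nlinarith

theorem square_region₃ (hq : 2 ≤ q) (hx : x ≤ 1) (h : 1 - 1 / q * x ≤ d)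
    (h' : d ≤ 1 - 1 / q * (2 * x - 1)) :
    squareRe q x d = q * (1 - d) ∧
      squareIm q x d = 1 / q + 2 * (1 - 1 / q) * x - q * (1 - d) := by
  obtain ⟨h0, h1, h2⟩ := exists_inv_natCast hq
  have hq1 : ¬ q ≤ 1 := by lia
  rw [squareRe, squareIm, if_neg hq1, if_neg hq1]
  have hq0 : (2 : ℝ) ≤ q := by exact_mod_cast hq
  generalize 1 / (q : ℝ) = a at *
  have e : (q : ℝ) * a = 1 := by linarith
  have h3 : q * (1 - d) ≤ x := by
    nlinarith [mul_le_mul_of_nonneg_left h (by linarith : (0 : ℝ) ≤ q)]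
  have h4 : 2 * x - 1 ≤ q * (1 - d) := by
    nlinarith [mul_le_mul_of_nonneg_left h' (by linarith : (0 : ℝ) ≤ q)]
  have h5 : 1 - d = a * (q * (1 - d)) := by linear_combination -(1 - d) * e
  constructor
  · rw [min_eq_right h3, max_eq_left h4]
  · have e1 : (a - q) * (1 - a * x - d) ≥ 0 :=
      mul_nonneg_of_nonpos_of_nonpos (by linarith) (by linarith)
    have e2 : q * a * x = x := by rw [e, one_mul]
    rw [max_eq_right, min_eq_right]
    · nlinarith [mul_le_mul_of_nonneg_left h4 (by linarith : 0 ≤ 1 - a)]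
    · nlinarith

theorem square_region₄ (hq : 2 ≤ q) (hx : x ≤ 1) (h : 1 - 1 / q * (2 * x - 1) ≤ d) :
    squareRe q x d = 2 * x - 1 ∧ squareIm q x d = d := by
  obtain ⟨h0, h1, h2⟩ := exists_inv_natCast hq
  have hq1 : ¬ q ≤ 1 := by lia
  rw [squareRe, squareIm, if_neg hq1, if_neg hq1]
  have hq0 : (2 : ℝ) ≤ q := by exact_mod_cast hq
  generalize 1 / (q : ℝ) = a at *
  have e : (q : ℝ) * a = 1 := by linarith
  have h4 : q * (1 - d) ≤ 2 * x - 1 := by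
    nlinarith [mul_le_mul_of_nonneg_left h (by linarith : (0 : ℝ) ≤ q)]
  have h5 : 1 - d = a * (q * (1 - d)) := by linear_combination -(1 - d) * e
  constructor
  · rw [min_eq_right (by linarith), max_eq_right h4]
  · rw [min_eq_left]
    refine le_max_of_le_right ?_
    nlinarith [mul_le_mul_of_nonneg_left h4 (by linarith : 0 ≤ 1 - a)]

/-- Replaces the case distinction by expressions whose continuity needs no matching along the edges
of the triangles. -/
theorem psiSquare_eq (hx : x ≤ 1) : psiSquare q ⟨x, d⟩ = ⟨squareRe q x d, squareIm q x d⟩ := by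
  unfold psiSquare
  dsimp only
  split_ifs with hq h1 h2 h3
  · simp [squareRe, squareIm, hq]
  · obtain ⟨e1, e2⟩ := square_region₁ (by lia) hx h1
    rw [e1, e2]
  · obtain ⟨e1, e2⟩ := square_region₂ (q := q) (d := d) (by lia) hx (not_le.1 h1).le
      (h2.trans_eq (by ring))
    rw [e1, e2]
    congr 1
    ring
  · obtain ⟨e1, e2⟩ := square_region₃ (q := q) (d := d) (by lia) hx
      ((show 1 - 1 / (q : ℝ) * x = 1 - x / q by ring).trans_le (not_le.1 h2).le)
      (h3.trans_eq (by ring))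
    rw [e1, e2]
  · obtain ⟨e1, e2⟩ := square_region₄ (q := q) (d := d) (by lia) hx
      ((show 1 - 1 / (q : ℝ) * (2 * x - 1) = 1 - 2 / q * (x - 1 / 2) by ring).trans_le
        (not_le.1 h3).le)
    rw [e1, e2]

theorem squareIm_le : squareIm q x d ≤ d := by
  unfold squareIm
  split_ifs
  · exact le_rfl
  · exact min_le_left _ _

theorem squareIm_nonneg (hx : 0 ≤ x) (hd : 0 ≤ d) : 0 ≤ squareIm q x d := by
  unfold squareIm
  split_ifs
  · exact hd
  · exact le_min hd (le_max_of_le_left (by positivity))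

theorem eq_zero_of_squareIm_eq_zero (hx : 0 ≤ x) (hd : 0 ≤ d) (h : squareIm q x d = 0) :
    d = 0 := by
  unfold squareIm at h
  split_ifs at h with hq
  · exact h
  · obtain ⟨h0, -, -⟩ := exists_inv_natCast (q := q) (by lia)
    by_contra hne
    have hd' : 0 < d := lt_of_le_of_ne hd (Ne.symm hne)
    have : 0 < min d (max (1 / q * d + (1 - 1 / q) ^ 2 * x)
        (1 / q + 2 * (1 - 1 / q) * x - q * (1 - d))) :=
      lt_min hd' (lt_max_of_lt_left (by positivity))
    linarith

theorem squareRe_nonneg (hx : 0 ≤ x) (hd : d ≤ 1) : 0 ≤ squareRe q x d := by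
  unfold squareRe
  split_ifs
  · exact hx
  · exact le_max_of_le_left (le_min hx (mul_nonneg (by positivity) (by linarith)))

theorem squareRe_le (hx : x ≤ 1) : squareRe q x d ≤ x := by
  unfold squareRe
  split_ifs
  · exact le_rfl
  · exact max_le (min_le_left _ _) (by linarith)

/-- Only the left edge and the slit are sent to the left edge; this is where |ζ| = 1. -/
theorem squareRe_eq_zero (hx : 0 ≤ x) (hd : d ≤ 1) (h : squareRe q x d = 0) :
    x = 0 ∨ (d = 1 ∧ x ≤ 1 / 2 ∧ 2 ≤ q) := by
  unfold squareRe at h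
  split_ifs at h with hq
  · exact Or.inl h
  · have h1 : min x (q * (1 - d)) ≤ 0 := (le_max_left _ _).trans h.le
    have h2 : 2 * x - 1 ≤ 0 := (le_max_right _ _).trans h.le
    rcases min_le_iff.1 h1 with h3 | h3
    · exact Or.inl (le_antisymm h3 hx)
    · right
      have : (0 : ℝ) < q := by
        have : 0 < q := by lia
        exact_mod_cast this
      refine ⟨le_antisymm hd ?_, by linarith, by lia⟩
      nlinarith

theorem square_injective {x' d' : ℝ} (hx : x ∈ Set.Icc 0 1) (hx' : x' ∈ Set.Icc 0 1)
    (hd : d ≤ 1) (hd' : d' ≤ 1)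
    (h₁ : squareRe q x d = squareRe q x' d') (h₂ : squareIm q x d = squareIm q x' d') :
    x = x' ∧ d = d' := by
  by_cases hq : q ≤ 1
  · simp only [squareRe, squareIm, hq, if_true] at h₁ h₂
    exact ⟨h₁, h₂⟩
  replace hq : 2 ≤ q := by lia
  obtain ⟨h0, h1, h2⟩ := exists_inv_natCast hq
  have hq0 : (2 : ℝ) ≤ q := by exact_mod_cast hq
  -- `G` is the inverse on the image triangles, which are separated by the lines from A to 0, to i/q
  -- and to i.
  set G : ℝ → ℝ → ℝ × ℝ := fun u t =>
    if t ≤ (1 - 1 / q) * u then (u, t)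
    else if t ≤ 1 / q + (1 - 2 * (1 / q)) * u then (u, q * (t - (1 - 1 / q) ^ 2 * u))
    else if t ≤ 1 - 1 / q * u then ((t + u - 1 / q) / (2 * (1 - 1 / q)), 1 - 1 / q * u)
    else ((u + 1) / 2, t) with hG
  have key : ∀ x d : ℝ, x ∈ Set.Icc 0 1 → d ≤ 1 →
      G (squareRe q x d) (squareIm q x d) = (x, d) := by
    clear h₁ h₂ hx hx' hd hd'
    intro x d hx hd
    obtain ⟨hx0, hx1⟩ := hx
    have A1 := square_region₁ (d := d) hq hx1
    have A2 := square_region₂ (d := d) hq hx1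
    have A3 := square_region₃ (d := d) hq hx1
    have A4 := square_region₄ (d := d) hq hx1
    simp only [hG]
    clear_value G
    generalize 1 / (q : ℝ) = a at *
    have e : (q : ℝ) * a = 1 := by linarith
    have ha : 2 * (1 - a) ≠ 0 := by linarith
    by_cases c1 : d ≤ (1 - a) * x
    · obtain ⟨e1, e2⟩ := A1 c1
      rw [e1, e2, if_pos c1]
    rw [not_le] at c1
    by_cases c2 : d ≤ 1 - a * x
    · obtain ⟨e1, e2⟩ := A2 c1.le c2
      rw [e1, e2, if_neg (by nlinarith), if_pos (by nlinarith)]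
      congr 1
      linear_combination d * e
    rw [not_le] at c2
    by_cases c3 : d ≤ 1 - a * (2 * x - 1)
    · obtain ⟨e1, e2⟩ := A3 c2.le c3
      have h3 : q * (1 - d) < x := by
        nlinarith [mul_lt_mul_of_pos_left c2 (by linarith : (0 : ℝ) < q)]
      have h4 : 2 * x - 1 ≤ q * (1 - d) := by
        nlinarith [mul_le_mul_of_nonneg_left c3 (by linarith : (0 : ℝ) ≤ q)]
      have h5 : a * (q * (1 - d)) = 1 - d := by linear_combination (1 - d) * e
      rw [e1, e2, if_neg, if_neg, if_pos]
      · rw [h5]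
        refine Prod.ext ?_ (by simp)
        simp only
        rw [div_eq_iff ha]
        ring
      · nlinarith [mul_le_mul_of_nonneg_left h4 (by linarith : 0 ≤ 1 - a)]
      · nlinarith [mul_lt_mul_of_pos_left h3 (by linarith : 0 < 2 * (1 - a))]
      · nlinarith [mul_lt_mul_of_pos_left h3 (by linarith : 0 < 2 - a)]
    · rw [not_le] at c3
      obtain ⟨e1, e2⟩ := A4 c3.le
      rw [e1, e2, if_neg (by nlinarith), if_neg (by nlinarith), if_neg (by linarith)]
      congr 1
      ring
  have := (key x d hx hd).symm.trans ((by rw [h₁, h₂]) : _ = _) |>.trans (key x' d' hx' hd')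
  exact Prod.mk.inj this

end regions

/-! ### Inverting the square map along its left edge, and the resulting row maps. -/

/-- The real part of the inverse of `psiSquare` near the left edge of the square. -/
noncomputable def edgeRe (q : ℕ) (u t : ℝ) : ℝ := max u ((t + u - 1 / q) / (2 * (1 - 1 / q)))

/-- The imaginary part of the inverse of `psiSquare` near the left edge of the square. -/
noncomputable def edgeIm (q : ℕ) (u t : ℝ) : ℝ :=
  min (q * (t - (1 - 1 / q) ^ 2 * u)) (1 - 1 / q * u)

/-- On the two regions that touch the left edge and the slit, the two affine inverses combine into
one maximum and one minimum. -/
theorem edge_square {q : ℕ} {x d : ℝ} (hq : 2 ≤ q) (hx : x ≤ 1) (h : (1 - 1 / q) * x ≤ d)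
    (h' : d ≤ 1 - 1 / q * (2 * x - 1)) :
    edgeRe q (squareRe q x d) (squareIm q x d) = x ∧
      edgeIm q (squareRe q x d) (squareIm q x d) = d := by
  obtain ⟨h0, h1, h2⟩ := exists_inv_natCast hq
  have A2 := square_region₂ (d := d) hq hx h
  have A3 := square_region₃ (d := d) hq hx
  have hq0 : (2 : ℝ) ≤ q := by exact_mod_cast hq
  unfold edgeRe edgeIm
  generalize 1 / (q : ℝ) = a at *
  have e : (q : ℝ) * a = 1 := by linarith
  have ha : 0 < 2 * (1 - a) := by linarith
  by_cases c2 : d ≤ 1 - a * x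
  · obtain ⟨e1, e2⟩ := A2 c2
    rw [e1, e2]
    have h3 : (q : ℝ) * (a * d + (1 - a) ^ 2 * x - (1 - a) ^ 2 * x) = d := by
      linear_combination d * e
    rw [h3]
    refine ⟨max_eq_left ?_, min_eq_left c2⟩
    rw [div_le_iff₀ ha]
    nlinarith
  · rw [not_le] at c2
    obtain ⟨e1, e2⟩ := A3 c2.le h'
    have h3 : q * (1 - d) < x := by
      nlinarith [mul_lt_mul_of_pos_left c2 (by linarith : (0 : ℝ) < q)]
    have h5 : a * (q * (1 - d)) = 1 - d := by linear_combination (1 - d) * e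
    have h6 : (a + 2 * (1 - a) * x - q * (1 - d) + q * (1 - d) - a) / (2 * (1 - a)) = x := by
      rw [div_eq_iff ha.ne']; ring
    rw [e1, e2, h5, h6]
    refine ⟨max_eq_right h3.le, ?_⟩
    rw [min_eq_right, sub_sub_cancel]
    have h7 : 2 * (1 - a) * (q * (1 - d)) ≤ 2 * (1 - a) * x := by gcongr
    have : (1 - (1 - d)) = a * q * d := by rw [h2]; ring
    rw [this, mul_comm a, mul_assoc]
    refine mul_le_mul_of_nonneg_left ?_ (by linarith)
    have h8 : a * d = a - a * (a * (q * (1 - d))) := by rw [h5]; ring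
    nlinarith

theorem square_edge {q : ℕ} {u t : ℝ} (hq : 2 ≤ q) (hu0 : 0 ≤ u) (hu : u ≤ 1)
    (h : (1 - 1 / q) * u ≤ t) (h' : t ≤ 1 - 1 / q * u) :
    (0 ≤ edgeRe q u t ∧ edgeRe q u t ≤ 1 ∧ edgeIm q u t ≤ 1) ∧
    squareRe q (edgeRe q u t) (edgeIm q u t) = u ∧
      squareIm q (edgeRe q u t) (edgeIm q u t) = t := by
  have hx1 : edgeRe q u t ≤ 1 := by
    obtain ⟨h0, h1, h2⟩ := exists_inv_natCast hq
    unfold edgeRe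
    generalize 1 / (q : ℝ) = a at *
    refine max_le hu ?_
    rw [div_le_iff₀ (by linarith)]
    nlinarith
  have hx0 : 0 ≤ edgeRe q u t := le_max_of_le_left hu0
  obtain ⟨h0, h1, h2⟩ := exists_inv_natCast hq
  have hd1 : edgeIm q u t ≤ 1 :=
    min_le_of_right_le (by linarith [mul_nonneg h0.le hu0])
  refine ⟨⟨hx0, hx1, hd1⟩, ?_⟩
  have A2 := square_region₂ (d := edgeIm q u t) hq hx1
  have A3 := square_region₃ (d := edgeIm q u t) hq hx1
  have hq0 : (2 : ℝ) ≤ q := by exact_mod_cast hq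
  unfold edgeRe edgeIm at *
  generalize 1 / (q : ℝ) = a at *
  have e : (q : ℝ) * a = 1 := by linarith
  have ha : 0 < 2 * (1 - a) := by linarith
  -- The line from A to i/q separates the images of the two regions.
  by_cases c : t ≤ a + (1 - 2 * a) * u
  · have c1 : (t + u - a) / (2 * (1 - a)) ≤ u := by rw [div_le_iff₀ ha]; linarith
    have h3 : q * (a - a * a * u) = 1 - a * u := by linear_combination (1 - a * u) * e
    have c2 : q * (t - (1 - a) ^ 2 * u) ≤ 1 - a * u := by
      rw [← h3]
      refine mul_le_mul_of_nonneg_left ?_ (by linarith)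
      nlinarith
    rw [max_eq_left c1, min_eq_left c2] at *
    have h4 : (1 - a) * u ≤ q * (t - (1 - a) ^ 2 * u) := by
      have : (1 - a) * u = q * (a * (1 - a) * u) := by linear_combination -(1 - a) * u * e
      rw [this]
      refine mul_le_mul_of_nonneg_left ?_ (by linarith)
      nlinarith
    obtain ⟨e1, e2⟩ := A2 h4 c2
    refine ⟨e1, ?_⟩
    rw [e2]
    linear_combination (t - (1 - a) ^ 2 * u) * e
  · rw [not_le] at c
    have c1 : u ≤ (t + u - a) / (2 * (1 - a)) := by rw [le_div_iff₀ ha]; linarith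
    have h3 : q * (a - a * a * u) = 1 - a * u := by linear_combination (1 - a * u) * e
    have c2 : 1 - a * u ≤ q * (t - (1 - a) ^ 2 * u) := by
      rw [← h3]
      refine mul_le_mul_of_nonneg_left ?_ (by linarith)
      nlinarith
    rw [max_eq_right c1, min_eq_right c2] at *
    have h5 : 2 * ((t + u - a) / (2 * (1 - a))) - 1 ≤ u := by
      have : (t + u - a) / (2 * (1 - a)) ≤ (u + 1) / 2 := by
        rw [div_le_div_iff₀ ha (by norm_num)]
        nlinarith
      linarith
    have h6 : 2 * (1 - a) * ((t + u - a) / (2 * (1 - a))) = t + u - a := by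
      have : 1 - a ≠ 0 := by linarith
      field_simp
    have h7 : q * (1 - (1 - a * u)) = u := by linear_combination u * e
    obtain ⟨e1, e2⟩ := A3 (by nlinarith) (by nlinarith)
    rw [h7] at e1 e2
    refine ⟨e1, ?_⟩
    rw [e2, h6]
    ring

/-- The map `psiSquare`, moved to the row `2 k ≤ Im w ≤ 2 k + 1`, followed by the interpolation
between `t ↦ e + q t` on the left edge and `t ↦ ρ (2 k + t)` on the right edge. -/
noncomputable def rowLog (ρ : ℝ) (q : ℕ) (e k : ℝ) (w : ℂ) : ℂ :=
  ⟨ρ * squareRe q w.re (w.im - 2 * k),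
    (1 - squareRe q w.re (w.im - 2 * k)) * (e + q * squareIm q w.re (w.im - 2 * k)) +
      squareRe q w.re (w.im - 2 * k) * (ρ * (2 * k + squareIm q w.re (w.im - 2 * k)))⟩

/-- The inverse of `rowLog` near the left edge of the square. -/
noncomputable def rowLogInv (ρ : ℝ) (q : ℕ) (e k : ℝ) (L : ℂ) : ℂ :=
  let u := L.re / ρ
  let t := (L.im - (1 - u) * e - u * (ρ * (2 * k))) / ((1 - u) * q + u * ρ)
  ⟨edgeRe q u t, 2 * k + edgeIm q u t⟩

theorem continuous_complex_mk {f g : ℂ → ℝ} {w : ℂ} (hf : ContinuousAt f w)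
    (hg : ContinuousAt g w) : ContinuousAt (fun w => (⟨f w, g w⟩ : ℂ)) w := by
  have h : (fun w => (⟨f w, g w⟩ : ℂ)) = fun w => (f w : ℂ) + (g w : ℂ) * Complex.I := by
    funext w
    exact Complex.mk_eq_add_mul_I _ _
  rw [h]
  exact (Complex.continuous_ofReal.continuousAt.comp hf).add
    ((Complex.continuous_ofReal.continuousAt.comp hg).mul continuousAt_const)

theorem continuous_rowLog (ρ : ℝ) (q : ℕ) (e k : ℝ) : Continuous (rowLog ρ q e k) := by
  have hre : Continuous fun w : ℂ => squareRe q w.re (w.im - 2 * k) := by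
    unfold squareRe
    split_ifs <;> fun_prop
  have him : Continuous fun w : ℂ => squareIm q w.re (w.im - 2 * k) := by
    unfold squareIm
    split_ifs <;> fun_prop
  rw [continuous_iff_continuousAt]
  intro w
  unfold rowLog
  apply continuous_complex_mk <;> apply Continuous.continuousAt <;> fun_prop

section slit
variable {ρ : ℝ} {q : ℕ} {e k : ℝ}

/-- On the slit u = 0 and q t = 1 + 2 (q - 1) x: the slit is stretched by the factor 2 (q - 1), the
denominator in the lists of branched points. -/
theorem rowLog_slit (hq : 2 ≤ q) {w : ℂ} (hw : w.im = 2 * k + 1) (hx : w.re ≤ 1 / 2)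
    (hx0 : 0 ≤ w.re) :
    rowLog ρ q e k w = ⟨0, e + 1 + 2 * (q - 1) * w.re⟩ := by
  obtain ⟨h0, h1, h2⟩ := exists_inv_natCast hq
  have hd : w.im - 2 * k = 1 := by linarith
  obtain ⟨e1, e2⟩ := square_region₃ (x := w.re) (d := 1) hq (by linarith) (by nlinarith) (by nlinarith)
  rw [rowLog, hd, e1, e2]
  simp only [sub_self, mul_zero, sub_zero, one_mul, zero_mul, add_zero]
  congr 1
  linear_combination (1 - 2 * w.re) * h2

theorem rowLog_left {w : ℂ} (hq : 1 ≤ q) (hw : w.re = 0) (h0 : 2 * k ≤ w.im)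
    (h1 : w.im ≤ 2 * k + 1) :
    rowLog ρ q e k w = ⟨0, e + (w.im - 2 * k)⟩ := by
  rcases hq.eq_or_lt with rfl | hq
  · simp [rowLog, squareRe, squareIm, hw]
  · obtain ⟨a0, a1, a2⟩ := exists_inv_natCast (q := q) (by lia)
    obtain ⟨e1, e2⟩ := square_region₂ (q := q) (x := w.re) (d := w.im - 2 * k) (by lia)
      (by rw [hw]; norm_num) (by rw [hw]; linarith) (by rw [hw]; linarith)
    rw [rowLog, e1, e2, hw]
    simp only [mul_zero, sub_zero, one_mul, zero_mul, add_zero]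
    congr 1
    linear_combination (w.im - 2 * k) * a2

theorem rowLog_re_nonneg (hρ : 0 ≤ ρ) {w : ℂ} (hx : 0 ≤ w.re) (hw : w.im ≤ 2 * k + 1) :
    0 ≤ (rowLog ρ q e k w).re :=
  mul_nonneg hρ (squareRe_nonneg hx (by linarith))

theorem rowLog_re_eq_zero (hρ : 0 < ρ) {w : ℂ} (hx : 0 ≤ w.re) (hw : w.im ≤ 2 * k + 1)
    (h : (rowLog ρ q e k w).re = 0) : w.re = 0 ∨ (w.im = 2 * k + 1 ∧ w.re ≤ 1 / 2 ∧ 2 ≤ q) := by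
  rcases squareRe_eq_zero (q := q) (d := w.im - 2 * k) hx (by linarith)
    ((mul_eq_zero.1 h).resolve_left hρ.ne') with h1 | ⟨h1, h2⟩
  · exact Or.inl h1
  · exact Or.inr ⟨by linarith, h2⟩

theorem rowLogInv_rowLog (hq : 2 ≤ q) (hρ : 0 < ρ) {w : ℂ} (hx0 : 0 ≤ w.re) (hx : w.re ≤ 1)
    (h : (1 - 1 / q) * w.re ≤ w.im - 2 * k)
    (h1 : w.im - 2 * k ≤ 1) (h' : w.im - 2 * k ≤ 1 - 1 / q * (2 * w.re - 1)) :
    rowLogInv ρ q e k (rowLog ρ q e k w) = w := by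
  obtain ⟨e1, e2⟩ := edge_square hq hx h h'
  have hu : (rowLog ρ q e k w).re / ρ = squareRe q w.re (w.im - 2 * k) := by
    simp only [rowLog]
    field_simp
  have hu0 := squareRe_nonneg (q := q) hx0 h1
  have hu1 := (squareRe_le (q := q) (d := w.im - 2 * k) hx).trans hx
  -- A convex combination of the positive slopes q and ρ.
  have hden : 0 < (1 - squareRe q w.re (w.im - 2 * k)) * q + squareRe q w.re (w.im - 2 * k) * ρ := by
    have hq0 : (2 : ℝ) ≤ q := by exact_mod_cast hq
    generalize squareRe q w.re (w.im - 2 * k) = u at *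
    rcases hu0.eq_or_lt with h | h
    · rw [← h]; linarith
    · have := mul_pos h hρ
      nlinarith
  have ht : ((rowLog ρ q e k w).im - (1 - squareRe q w.re (w.im - 2 * k)) * e -
      squareRe q w.re (w.im - 2 * k) * (ρ * (2 * k))) /
      ((1 - squareRe q w.re (w.im - 2 * k)) * q + squareRe q w.re (w.im - 2 * k) * ρ) =
      squareIm q w.re (w.im - 2 * k) := by
    rw [div_eq_iff hden.ne', rowLog]
    ring
  unfold rowLogInv
  simp only [hu, ht, e1, e2]
  apply Complex.ext
  · rfl
  · simp

theorem rowLog_rowLogInv (hq : 2 ≤ q) (hρ : 0 < ρ) {L : ℂ} {u t : ℝ} (hu : u = L.re / ρ)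
    (ht : t = (L.im - (1 - u) * e - u * (ρ * (2 * k))) / ((1 - u) * q + u * ρ))
    (hu0 : 0 ≤ u) (hu1 : u ≤ 1) (h : (1 - 1 / q) * u ≤ t) (h' : t ≤ 1 - 1 / q * u) :
    0 ≤ (rowLogInv ρ q e k L).re ∧ (rowLogInv ρ q e k L).im ≤ 2 * k + 1 ∧
      rowLog ρ q e k (rowLogInv ρ q e k L) = L := by
  obtain ⟨⟨a1, a2, a3⟩, e1, e2⟩ := square_edge hq hu0 hu1 h h'
  have hw : rowLogInv ρ q e k L = ⟨edgeRe q u t, 2 * k + edgeIm q u t⟩ := by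
    rw [ht, hu, rowLogInv]
  have hden : 0 < (1 - u) * q + u * ρ := by
    have hq0 : (2 : ℝ) ≤ q := by exact_mod_cast hq
    rcases hu0.eq_or_lt with h | h
    · rw [← h]; linarith
    · have := mul_pos h hρ
      nlinarith
  rw [hw]
  refine ⟨a1, by simpa using a3, ?_⟩
  rw [rowLog]
  simp only [add_sub_cancel_left, e1, e2]
  apply Complex.ext
  · simp only [hu]
    field_simp
  · simp only
    rw [eq_div_iff hden.ne'] at ht
    linear_combination ht

theorem continuousAt_rowLogInv (hq : 2 ≤ q) {L : ℂ} (hL : L.re = 0) :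
    ContinuousAt (rowLogInv ρ q e k) L := by
  have hq0 : (q : ℝ) ≠ 0 := by
    have : q ≠ 0 := by lia
    exact_mod_cast this
  have hne : (1 - L.re / ρ) * q + L.re / ρ * ρ ≠ 0 := by rw [hL]; simpa using hq0
  have hu : ContinuousAt (fun L : ℂ => L.re / ρ) L :=
    (Complex.continuous_re.div_const ρ).continuousAt
  have ht : ContinuousAt (fun L : ℂ => (L.im - (1 - L.re / ρ) * e - L.re / ρ * (ρ * (2 * k))) /
      ((1 - L.re / ρ) * q + L.re / ρ * ρ)) L := by
    refine ContinuousAt.div ?_ ?_ hne <;> apply Continuous.continuousAt <;> fun_prop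
  unfold rowLogInv edgeRe edgeIm
  apply continuous_complex_mk
  · exact hu.max (((ht.add hu).sub continuousAt_const).div_const _)
  · refine ContinuousAt.add continuousAt_const (Filter.Tendsto.min ?_ ?_)
    · exact continuousAt_const.mul (ht.sub (continuousAt_const.mul hu))
    · exact continuousAt_const.sub (continuousAt_const.mul hu)

theorem rowLogInv_slit (hq : 2 ≤ q) {b : ℝ} (hb : e + 1 ≤ b) :
    rowLogInv ρ q e k ⟨0, b⟩ = ⟨(b - e - 1) / (2 * (q - 1)), 2 * k + 1⟩ := by
  obtain ⟨h0, h1, h2⟩ := exists_inv_natCast hq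
  have hq0 : (2 : ℝ) ≤ q := by exact_mod_cast hq
  unfold rowLogInv edgeRe edgeIm
  simp only [zero_div, sub_zero, one_mul, zero_mul, add_zero, mul_zero]
  have e1 : ((b - e) / q - 1 / q) / (2 * (1 - 1 / q)) = (b - e - 1) / (2 * (q - 1)) := by
    have : (q : ℝ) - 1 ≠ 0 := by linarith
    field_simp
  have e2 : q * ((b - e) / q) = b - e := by field_simp
  rw [e1, e2, min_eq_right (by linarith), max_eq_right]
  exact div_nonneg (by linarith) (by linarith)

end slit

/-! ### Sheets over |z| ≥ 1 near a point of a slit. -/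

/-- The exponential of `rowLog`, normalized to be `-1` at the point `x₀ + (2 k + 1) i`. -/
noncomputable def sheet (ρ : ℝ) (q : ℕ) (e k x₀ : ℝ) (w : ℂ) : ℂ :=
  -Complex.exp (Real.pi * (rowLog ρ q e k w - ⟨0, e + 1 + 2 * (q - 1) * x₀⟩))

/-- The local inverse of `sheet`. -/
noncomputable def sheetInv (ρ : ℝ) (q : ℕ) (e k x₀ : ℝ) (z : ℂ) : ℂ :=
  rowLogInv ρ q e k (⟨0, e + 1 + 2 * (q - 1) * x₀⟩ + Complex.log (-z) / Real.pi)

theorem continuous_sheet (ρ : ℝ) (q : ℕ) (e k x₀ : ℝ) : Continuous (sheet ρ q e k x₀) := by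
  have := continuous_rowLog ρ q e k
  unfold sheet
  fun_prop

theorem log_exp_pi_mul {L : ℂ} (h : |L.im| < 1) :
    Complex.log (Complex.exp (Real.pi * L)) / Real.pi = L := by
  have hpi := Real.pi_pos
  rw [abs_lt] at h
  rw [Complex.log_exp]
  · have : (Real.pi : ℂ) ≠ 0 := by exact_mod_cast hpi.ne'
    field_simp
  · rw [Complex.im_ofReal_mul]; nlinarith
  · rw [Complex.im_ofReal_mul]; nlinarith

theorem norm_exp_pi_mul (L : ℂ) : ‖Complex.exp (Real.pi * L)‖ = Real.exp (Real.pi * L.re) := by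
  rw [Complex.norm_exp, Complex.re_ofReal_mul]

theorem log_neg_div_pi_re (z : ℂ) :
    (Complex.log (-z) / Real.pi).re = Real.log ‖z‖ / Real.pi := by
  rw [Complex.div_ofReal_re, Complex.log_re, norm_neg]

theorem continuousAt_log_neg : ContinuousAt (fun z : ℂ => Complex.log (-z) / Real.pi) (-1) := by
  refine ContinuousAt.div_const (ContinuousAt.clog continuousAt_neg ?_) _
  simp

theorem exp_log_neg {z : ℂ} (hz : z ≠ 0) :
    -Complex.exp (Real.pi * (Complex.log (-z) / Real.pi)) = z := by
  have : (Real.pi : ℂ) ≠ 0 := by exact_mod_cast Real.pi_pos.ne'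
  rw [mul_div_cancel₀ _ this, Complex.exp_log (neg_ne_zero.2 hz), neg_neg]

section sheet
variable {ρ : ℝ} {q : ℕ} {e k x₀ : ℝ}

theorem rowLog_base (hq : 2 ≤ q) (h0 : 0 ≤ x₀) (h1 : x₀ < 1 / 2) :
    rowLog ρ q e k ⟨x₀, 2 * k + 1⟩ = ⟨0, e + 1 + 2 * (q - 1) * x₀⟩ :=
  rowLog_slit (w := ⟨x₀, 2 * k + 1⟩) hq rfl h1.le h0

theorem rowLogInv_base (hq : 2 ≤ q) (h0 : 0 ≤ x₀) :
    rowLogInv ρ q e k ⟨0, e + 1 + 2 * (q - 1) * x₀⟩ = ⟨x₀, 2 * k + 1⟩ := by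
  have hq0 : (2 : ℝ) ≤ q := by exact_mod_cast hq
  rw [rowLogInv_slit hq (by nlinarith)]
  congr 1
  have : (q : ℝ) - 1 ≠ 0 := by linarith
  field_simp
  ring

/-- For x₀ < 1/2 only the two regions next to the left edge and the slit occur near the base point,
so `rowLogInv` inverts the row map; near the base point the exponent also stays where the principal
logarithm inverts the exponential. -/
theorem sheet_left_inv (hq : 2 ≤ q) (hρ : 0 < ρ) (h0 : 0 ≤ x₀) (h1 : x₀ < 1 / 2) :
    ∀ᶠ w in 𝓝 (⟨x₀, 2 * k + 1⟩ : ℂ), 0 ≤ w.re → w.im ≤ 2 * k + 1 →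
      1 ≤ ‖sheet ρ q e k x₀ w‖ ∧ sheetInv ρ q e k x₀ (sheet ρ q e k x₀ w) = w := by
  obtain ⟨a0, a1, a2⟩ := exists_inv_natCast hq
  have c1 : ∀ᶠ w in 𝓝 (⟨x₀, 2 * k + 1⟩ : ℂ), w.re < 1 / 2 :=
    Complex.continuous_re.continuousAt.eventually_lt continuousAt_const h1
  have c2 : ∀ᶠ w in 𝓝 (⟨x₀, 2 * k + 1⟩ : ℂ), (1 - 1 / q) * w.re < w.im - 2 * k := by
    apply ContinuousAt.eventually_lt
    · exact (continuous_const.mul Complex.continuous_re).continuousAt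
    · exact (Complex.continuous_im.sub continuous_const).continuousAt
    · simp only; nlinarith
  have c3 : ∀ᶠ w in 𝓝 (⟨x₀, 2 * k + 1⟩ : ℂ), w.im - 2 * k < 1 - 1 / q * (2 * w.re - 1) := by
    apply ContinuousAt.eventually_lt
    · exact (Complex.continuous_im.sub continuous_const).continuousAt
    · apply Continuous.continuousAt; fun_prop
    · simp only; nlinarith
  have c4 : ∀ᶠ w in 𝓝 (⟨x₀, 2 * k + 1⟩ : ℂ),
      |(rowLog ρ q e k w - ⟨0, e + 1 + 2 * (q - 1) * x₀⟩).im| < 1 := by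
    have hc := continuous_rowLog ρ q e k
    apply ContinuousAt.eventually_lt
    · exact (Complex.continuous_im.comp (hc.sub continuous_const)).abs.continuousAt
    · exact continuousAt_const
    · rw [rowLog_base hq h0 h1]; simp
  filter_upwards [c1, c2, c3, c4] with w h2 h3 h4 h5 hre him
  constructor
  · rw [sheet, norm_neg, norm_exp_pi_mul, Real.one_le_exp_iff]
    refine mul_nonneg Real.pi_pos.le ?_
    simpa using rowLog_re_nonneg hρ.le hre him
  · rw [sheetInv, sheet, neg_neg, log_exp_pi_mul h5, add_sub_cancel]
    exact rowLogInv_rowLog hq hρ hre (by linarith) h3.le (by linarith) h4.le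

theorem sheetInv_neg_one (hq : 2 ≤ q) (h0 : 0 ≤ x₀) :
    sheetInv ρ q e k x₀ (-1) = ⟨x₀, 2 * k + 1⟩ := by
  rw [sheetInv]
  simp only [neg_neg, Complex.log_one, zero_div, add_zero]
  exact rowLogInv_base hq h0

theorem sheet_base (hq : 2 ≤ q) (h0 : 0 ≤ x₀) (h1 : x₀ < 1 / 2) :
    sheet ρ q e k x₀ ⟨x₀, 2 * k + 1⟩ = -1 := by
  rw [sheet, rowLog_base hq h0 h1]
  simp

theorem continuousAt_sheetInv (hq : 2 ≤ q) :
    ContinuousAt (sheetInv ρ q e k x₀) (-1) := by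
  unfold sheetInv
  refine ContinuousAt.comp (g := rowLogInv ρ q e k)
    (f := fun z : ℂ => (⟨0, e + 1 + 2 * (q - 1) * x₀⟩ : ℂ) + Complex.log (-z) / Real.pi) ?_ ?_
  · apply continuousAt_rowLogInv hq
    simp
  · exact continuousAt_const.add continuousAt_log_neg

theorem continuousAt_conj_sheetInv_conj (hq : 2 ≤ q) :
    ContinuousAt (fun z => (starRingEnd ℂ) (sheetInv ρ q e k x₀ ((starRingEnd ℂ) z))) (-1) := by
  have h1 : Tendsto (sheetInv ρ q e k x₀) (𝓝 (-1)) (𝓝 (sheetInv ρ q e k x₀ (-1))) :=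
    continuousAt_sheetInv hq
  have h2 := (Complex.continuous_conj.tendsto _).comp (h1.comp tendsto_conj_neg_one)
  rw [ContinuousAt, map_neg, map_one]
  exact h2

theorem sheet_right_inv (hq : 2 ≤ q) (hρ : 0 < ρ) (h0 : 0 ≤ x₀) (h1 : x₀ < 1 / 2) :
    ∀ᶠ z in 𝓝 (-1 : ℂ), 1 ≤ ‖z‖ → (0 ≤ (sheetInv ρ q e k x₀ z).re ∧
      (sheetInv ρ q e k x₀ z).im ≤ 2 * k + 1) ∧ sheet ρ q e k x₀ (sheetInv ρ q e k x₀ z) = z := by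
  obtain ⟨a0, a1, a2⟩ := exists_inv_natCast hq
  have hq0 : (2 : ℝ) ≤ q := by exact_mod_cast hq
  set L : ℂ → ℂ := fun z => (⟨0, e + 1 + 2 * (q - 1) * x₀⟩ : ℂ) + Complex.log (-z) / Real.pi
    with hLdef
  have hL : ContinuousAt L (-1) := continuousAt_const.add continuousAt_log_neg
  have hL1 : L (-1) = ⟨0, e + 1 + 2 * (q - 1) * x₀⟩ := by simp [hLdef]
  have hu : ContinuousAt (fun z => (L z).re / ρ) (-1) :=
    (Complex.continuous_re.continuousAt.comp hL).div_const ρ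
  have hLi : ContinuousAt (fun z => (L z).im) (-1) := Complex.continuous_im.continuousAt.comp hL
  have hne : (1 - (L (-1)).re / ρ) * q + (L (-1)).re / ρ * ρ ≠ 0 := by
    rw [hL1]; simp; lia
  have ht : ContinuousAt (fun z => ((L z).im - (1 - (L z).re / ρ) * e -
      (L z).re / ρ * (ρ * (2 * k))) / ((1 - (L z).re / ρ) * q + (L z).re / ρ * ρ)) (-1) := by
    refine ContinuousAt.div ?_ ?_ hne <;> fun_prop
  have hu1 : (L (-1)).re / ρ = 0 := by rw [hL1]; simp
  have ht1 : ((L (-1)).im - (1 - (L (-1)).re / ρ) * e -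
      (L (-1)).re / ρ * (ρ * (2 * k))) / ((1 - (L (-1)).re / ρ) * q + (L (-1)).re / ρ * ρ) =
      1 / q + 2 * (1 - 1 / q) * x₀ := by
    rw [hu1, hL1]
    have : (q : ℝ) ≠ 0 := by linarith
    simp only
    field_simp
    ring
  -- At z = -1 one has u = 0 and t = 1/q + 2 (1 - 1/q) x₀, strictly inside the admissible region
  -- except for the condition u ≥ 0, which is |z| ≥ 1.
  have c1 := hu.eventually_lt (continuousAt_const (y := (1 : ℝ))) (by rw [hu1]; norm_num)
  have c2 := (continuousAt_const.mul hu : ContinuousAt (fun z => (1 - 1 / (q : ℝ)) *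
    ((L z).re / ρ)) (-1)).eventually_lt ht (by
      show (1 - 1 / (q : ℝ)) * ((L (-1)).re / ρ) < _
      rw [ht1, hu1]; nlinarith)
  have c3 := ht.eventually_lt (continuousAt_const.sub (continuousAt_const.mul hu) :
    ContinuousAt (fun z => 1 - 1 / (q : ℝ) * ((L z).re / ρ)) (-1)) (by
      show _ < 1 - 1 / (q : ℝ) * ((L (-1)).re / ρ)
      rw [ht1, hu1]; nlinarith)
  filter_upwards [c1, c2, c3] with z h2 h3 h4 hz
  have hLre : 0 ≤ (L z).re / ρ := by
    have : (L z).re = (Complex.log (-z) / Real.pi).re := by simp [hLdef]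
    rw [this, log_neg_div_pi_re]
    exact div_nonneg (div_nonneg (Real.log_nonneg hz) Real.pi_pos.le) hρ.le
  obtain ⟨r1, r2, r3⟩ := rowLog_rowLogInv (e := e) (k := k) (L := L z) hq hρ rfl rfl hLre h2.le
    h3.le h4.le
  refine ⟨⟨r1, r2⟩, ?_⟩
  have hz0 : z ≠ 0 := by
    rintro rfl
    simp at hz
    linarith
  have : sheetInv ρ q e k x₀ z = rowLogInv ρ q e k (L z) := rfl
  rw [sheet, this, r3, hLdef]
  simp only [add_sub_cancel_left]
  exact exp_log_neg hz0

/-- Conjugation turns the upper half of a sector into a lower half, with k replaced by -(k + 1) and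
e by -(e + 2 q). On |z| = 1 both inverses give the slit point with abscissa x₀ + arg (-z) / (2 π (q
- 1)); for x₀ = 0 it is non-negative only if Im z ≤ 0. -/
theorem sheetInv_glue (hq : 2 ≤ q) (h0 : 0 ≤ x₀) :
    ∀ᶠ z in 𝓝 (-1 : ℂ), ‖z‖ = 1 → (x₀ = 0 → z.im ≤ 0) →
      sheetInv ρ q e k x₀ z =
        (starRingEnd ℂ) (sheetInv ρ q (-(e + 2 * q)) (-(k + 1)) x₀ z) := by
  have hq0 : (2 : ℝ) ≤ q := by exact_mod_cast hq
  have hc : ContinuousAt (fun z : ℂ => (Complex.log (-z) / Real.pi).im) (-1) :=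
    Complex.continuous_im.continuousAt.comp continuousAt_log_neg
  have c1 : ∀ᶠ z in 𝓝 (-1 : ℂ), 0 < x₀ → 0 < 2 * (q - 1) * x₀ + (Complex.log (-z) / Real.pi).im := by
    rcases h0.eq_or_lt with h | h
    · exact Eventually.of_forall fun z hz => absurd hz (by rw [← h]; exact lt_irrefl _)
    · have hc' : ContinuousAt (fun z : ℂ => 2 * (q - 1) * x₀ +
          (Complex.log (-z) / Real.pi).im) (-1) := continuousAt_const.add hc
      have h3 : 0 < 2 * (q - 1) * x₀ := mul_pos (by linarith) h
      filter_upwards [continuousAt_const.eventually_lt hc' (by simpa using h3)] with z hz _ using hz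
  filter_upwards [c1] with z h2 hz hz2
  have hnn : 0 ≤ 2 * (q - 1) * x₀ + (Complex.log (-z) / Real.pi).im := by
    rcases h0.eq_or_lt with h | h
    · rw [← h, mul_zero, zero_add, Complex.div_ofReal_im, Complex.log_im]
      refine div_nonneg (Complex.arg_nonneg_iff.2 ?_) Real.pi_pos.le
      simpa using hz2 h.symm
    · exact (h2 h).le
  have hre : (Complex.log (-z) / Real.pi).re = 0 := by
    rw [log_neg_div_pi_re, hz]; simp
  have hval : ∀ b : ℝ, (⟨0, b⟩ : ℂ) + Complex.log (-z) / Real.pi =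
      ⟨0, b + (Complex.log (-z) / Real.pi).im⟩ := by
    intro b
    apply Complex.ext
    · rw [Complex.add_re, hre]; simp
    · simp
  rw [sheetInv, sheetInv, hval, hval, rowLogInv_slit hq (by linarith), rowLogInv_slit hq (by linarith)]
  apply Complex.ext
  · simp only [Complex.conj_re]
    congr 1
    ring
  · simp only [Complex.conj_im]
    ring

theorem sheet_slit (hq : 2 ≤ q) {w : ℂ} (hw : w.im = 2 * k + 1) (hx : w.re ≤ 1 / 2)
    (hx0 : 0 ≤ w.re) :
    sheet ρ q e k x₀ w = -Complex.exp ((Real.pi * (2 * (q - 1) * (w.re - x₀)) : ℝ) * Complex.I) := by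
  rw [sheet, rowLog_slit hq hw hx hx0]
  congr 2
  apply Complex.ext <;> simp
  ring

theorem sheet_conj_slit (hq : 2 ≤ q) {w : ℂ} (hw : w.im = 2 * k + 1) (hx : w.re ≤ 1 / 2)
    (hx0 : 0 ≤ w.re) :
    sheet ρ q (-(e + 2 * q)) (-(k + 1)) x₀ ((starRingEnd ℂ) w) = sheet ρ q e k x₀ w := by
  rw [sheet_slit hq hw hx hx0, sheet_slit hq (by rw [Complex.conj_im, hw]; ring)
    (by simpa using hx) (by simpa using hx0),
    Complex.conj_re]

end sheet

/-! ### Multiplicity 2 where two sheets meet along a slit. -/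

theorem tendsto_conj (w : ℂ) : Tendsto (starRingEnd ℂ) (𝓝 w) (𝓝 ((starRingEnd ℂ) w)) :=
  Complex.continuous_conj.tendsto w

theorem conj_base (x₀ k : ℝ) :
    (starRingEnd ℂ) (⟨x₀, 2 * k + 1⟩ : ℂ) = ⟨x₀, 2 * -(k + 1) + 1⟩ := by
  apply Complex.ext
  · simp
  · simp only [Complex.conj_im]; ring

/-- At an interior point of the slit `Im w = 2 k + 1`. -/
theorem hasLocalMultiplicity_slit {ρ : ℝ} {q : ℕ} {e k x₀ : ℝ} (hq : 2 ≤ q) (hρ : 0 < ρ)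
    (h0 : 0 < x₀) (h1 : x₀ < 1 / 2) {f : ℂ → ℂ}
    (hlow : ∀ᶠ w in 𝓝 (⟨x₀, 2 * k + 1⟩ : ℂ), w.im ≤ 2 * k + 1 →
      f w = sigma (sheet ρ q e k x₀ w))
    (hhigh : ∀ᶠ w in 𝓝 (⟨x₀, 2 * k + 1⟩ : ℂ), 2 * k + 1 ≤ w.im → f w =
      sigma ((starRingEnd ℂ) (sheet ρ q (-(e + 2 * q)) (-(k + 1)) x₀ ((starRingEnd ℂ) w)))) :
    HasLocalMultiplicity f ⟨x₀, 2 * k + 1⟩ 2 := by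
  have hre : ∀ᶠ w in 𝓝 (⟨x₀, 2 * k + 1⟩ : ℂ), 0 < w.re :=
    continuousAt_const.eventually_lt Complex.continuous_re.continuousAt h0
  have hre2 : ∀ᶠ w in 𝓝 (⟨x₀, 2 * k + 1⟩ : ℂ), w.re < 1 / 2 :=
    Complex.continuous_re.continuousAt.eventually_lt continuousAt_const h1
  have htc : Tendsto (starRingEnd ℂ) (𝓝 (⟨x₀, 2 * k + 1⟩ : ℂ)) (𝓝 ⟨x₀, 2 * -(k + 1) + 1⟩) := by
    rw [← conj_base]; exact tendsto_conj _
  -- The upper side of the slit is handled by conjugating in source and target, which makes it a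
  -- sheet of the same kind.
  refine hasLocalMultiplicity_fold (A := {w | w.im ≤ 2 * k + 1}) (B := {w | 2 * k + 1 ≤ w.im})
    (P := sheet ρ q e k x₀) (p := sheetInv ρ q e k x₀)
    (Q := fun w => (starRingEnd ℂ) (sheet ρ q (-(e + 2 * q)) (-(k + 1)) x₀ ((starRingEnd ℂ) w)))
    (q := fun z => (starRingEnd ℂ) (sheetInv ρ q (-(e + 2 * q)) (-(k + 1)) x₀ ((starRingEnd ℂ) z)))
    (isClosed_le Complex.continuous_im continuous_const)
    (isClosed_le continuous_const Complex.continuous_im) (le_refl (2 * k + 1))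
    (Eventually.of_forall fun w => le_total w.im (2 * k + 1)) (sheet_base hq h0.le h1) (continuous_sheet _ _ _ _ _)
    (Complex.continuous_conj.comp ((continuous_sheet _ _ _ _ _).comp Complex.continuous_conj))
    ?_ ?_ (continuousAt_sheetInv hq) ?_ (sheetInv_neg_one hq h0.le) ?_ ?_ ?_ ?_ ?_
  · filter_upwards [hlow, sheet_left_inv hq hρ h0.le h1, hre] with w h2 h3 h4 hw
    obtain ⟨h5, h6⟩ := h3 h4.le hw
    exact ⟨h5, h6, h2 hw⟩
  · filter_upwards [hhigh, htc.eventually (sheet_left_inv (e := -(e + 2 * q)) hq hρ h0.le h1),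
      hre] with w h2 h3 h4 hw
    obtain ⟨h5, h6⟩ := h3 (by simpa using h4.le) (by
      replace hw : 2 * k + 1 ≤ w.im := hw
      rw [Complex.conj_im]; linarith)
    exact ⟨by simpa using h5, by rw [Complex.conj_conj, h6, Complex.conj_conj], h2 hw⟩
  · exact continuousAt_conj_sheetInv_conj hq
  · rw [map_neg, map_one, sheetInv_neg_one hq h0.le, ← conj_base, Complex.conj_conj]
  · filter_upwards [sheet_right_inv (e := e) (k := k) hq hρ h0.le h1] with z h2 hz
    exact ⟨(h2 hz).1.2, (h2 hz).2⟩
  · filter_upwards [tendsto_conj_neg_one.eventually (sheet_right_inv (e := -(e + 2 * q))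
      (k := -(k + 1)) hq hρ h0.le h1)] with z h2 hz
    obtain ⟨⟨-, h3⟩, h4⟩ := h2 (by simpa using hz)
    refine ⟨?_, by rw [Complex.conj_conj, h4, Complex.conj_conj]⟩
    show 2 * k + 1 ≤ ((starRingEnd ℂ) _).im
    rw [Complex.conj_im]
    linarith
  · filter_upwards [hre, hre2] with w h2 h3 hA hB
    rw [sheet_slit hq (le_antisymm hA hB) h3.le h2.le, norm_neg, Complex.norm_exp_ofReal_mul_I]
  · filter_upwards [tendsto_conj_neg_one.eventually (sheetInv_glue (ρ := ρ) (e := e) (k := k) hq h0.le)]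
      with z h2 hz
    exact (h2 (by simpa using hz) fun h => absurd h h0.ne').symm

/-- At the end on `|z| = 1` of the slit `Im w = 2 k + 1`. -/
theorem hasLocalMultiplicity_slit_corner {ρ : ℝ} {q : ℕ} {e k : ℝ} (hq : 2 ≤ q) (hρ : 0 < ρ)
    {f : ℂ → ℂ}
    (hlow : ∀ᶠ w in 𝓝 (⟨0, 2 * k + 1⟩ : ℂ), 0 ≤ w.re → w.im ≤ 2 * k + 1 →
      (0 ≤ (sheet ρ q e k 0 w).im → f w = sheet ρ q e k 0 w) ∧
      ((sheet ρ q e k 0 w).im ≤ 0 → f w = sigma (sheet ρ q e k 0 w)))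
    (hhigh : ∀ᶠ w in 𝓝 (⟨0, 2 * k + 1⟩ : ℂ), 0 ≤ w.re → 2 * k + 1 ≤ w.im →
      (0 ≤ (sheet ρ q (-(e + 2 * q)) (-(k + 1)) 0 ((starRingEnd ℂ) w)).im → f w =
        (starRingEnd ℂ) (sheet ρ q (-(e + 2 * q)) (-(k + 1)) 0 ((starRingEnd ℂ) w))) ∧
      ((sheet ρ q (-(e + 2 * q)) (-(k + 1)) 0 ((starRingEnd ℂ) w)).im ≤ 0 → f w =
        sigma ((starRingEnd ℂ) (sheet ρ q (-(e + 2 * q)) (-(k + 1)) 0 ((starRingEnd ℂ) w)))))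
    (hleft : ∀ᶠ w in 𝓝 (⟨0, 2 * k + 1⟩ : ℂ), w.re ≤ 0 →
      f w = -Complex.exp (Real.pi * (w - ⟨0, 2 * k + 1⟩))) :
    HasLocalMultiplicity f ⟨0, 2 * k + 1⟩ 2 := by
  have hhalf : (0 : ℝ) < 1 / 2 := by norm_num
  have hq0 : (2 : ℝ) ≤ q := by exact_mod_cast hq
  have hpi := Real.pi_pos
  -- For Re w ≥ 0 this keeps the angle 2 π (q - 1) Re w in [0, π], so the lower side of the slit is
  -- mapped into Im ≤ 0; it also gives Re w ≤ 1/2.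
  have hre2 : ∀ᶠ w in 𝓝 (⟨0, 2 * k + 1⟩ : ℂ), 2 * ((q : ℝ) - 1) * w.re < 1 := by
    apply ContinuousAt.eventually_lt
    · exact (continuous_const.mul Complex.continuous_re).continuousAt
    · exact continuousAt_const
    · simp
  have htc : Tendsto (starRingEnd ℂ) (𝓝 (⟨0, 2 * k + 1⟩ : ℂ)) (𝓝 ⟨0, 2 * -(k + 1) + 1⟩) := by
    rw [← conj_base]; exact tendsto_conj _
  have hlog0 : Complex.log (-(-1)) / Real.pi = 0 := by simp
  refine hasLocalMultiplicity_foldCorner (A := {w | 0 ≤ w.re} ∩ {w | w.im ≤ 2 * k + 1})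
    (B := {w | 0 ≤ w.re} ∩ {w | 2 * k + 1 ≤ w.im}) (C := {w | w.re ≤ 0})
    (P := sheet ρ q e k 0) (p := sheetInv ρ q e k 0)
    (Q := fun w => (starRingEnd ℂ) (sheet ρ q (-(e + 2 * q)) (-(k + 1)) 0 ((starRingEnd ℂ) w)))
    (q := fun z => (starRingEnd ℂ) (sheetInv ρ q (-(e + 2 * q)) (-(k + 1)) 0 ((starRingEnd ℂ) z)))
    (D := fun w => -Complex.exp (Real.pi * (w - ⟨0, 2 * k + 1⟩)))
    (d := fun z => ⟨0, 2 * k + 1⟩ + Complex.log (-z) / Real.pi)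
    ((isClosed_le continuous_const Complex.continuous_re).inter
      (isClosed_le Complex.continuous_im continuous_const))
    ((isClosed_le continuous_const Complex.continuous_re).inter
      (isClosed_le continuous_const Complex.continuous_im))
    (isClosed_le Complex.continuous_re continuous_const)
    ⟨le_refl (0 : ℝ), le_refl (2 * k + 1)⟩ ?_ (continuous_sheet _ _ _ _ _)
    (Complex.continuous_conj.comp ((continuous_sheet _ _ _ _ _).comp Complex.continuous_conj))
    (by fun_prop) ?_ ?_ ?_ (continuousAt_sheetInv hq) ?_
    (continuousAt_const.add continuousAt_log_neg) (sheetInv_neg_one hq le_rfl) ?_ ?_ ?_ ?_ ?_ ?_ ?_ ?_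
  · refine Eventually.of_forall fun w => ?_
    rcases lt_or_ge w.re 0 with h | h
    · refine Or.inr (Or.inr ⟨h.le, ?_⟩)
      rw [norm_neg, norm_exp_pi_mul, Real.exp_lt_one_iff]
      simpa using mul_neg_of_pos_of_neg hpi h
    · rcases le_total w.im (2 * k + 1) with h2 | h2
      · exact Or.inl ⟨h, h2⟩
      · exact Or.inr (Or.inl ⟨h, h2⟩)
  · filter_upwards [hlow, sheet_left_inv (e := e) hq hρ le_rfl hhalf] with w h2 h3 hw
    obtain ⟨h5, h6⟩ := h3 hw.1 hw.2
    exact ⟨h5, h6, h2 hw.1 hw.2⟩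
  · filter_upwards [hhigh, htc.eventually (sheet_left_inv (e := -(e + 2 * q)) hq hρ le_rfl hhalf)]
      with w h2 h3 hw
    obtain ⟨h4, h5⟩ := hw
    replace h5 : 2 * k + 1 ≤ w.im := h5
    obtain ⟨h6, h7⟩ := h3 (by simpa using h4) (by rw [Complex.conj_im]; linarith)
    obtain ⟨h8, h9⟩ := h2 h4 h5
    refine ⟨by simpa using h6, by rw [Complex.conj_conj, h7, Complex.conj_conj], ?_, ?_⟩
    · intro h
      exact h8 (by simpa using h)
    · intro h
      exact h9 (by simpa using h)
  · have c4 : ∀ᶠ w in 𝓝 (⟨0, 2 * k + 1⟩ : ℂ), |(w - ⟨0, 2 * k + 1⟩).im| < 1 := by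
      apply ContinuousAt.eventually_lt
      · apply Continuous.continuousAt; fun_prop
      · exact continuousAt_const
      · simp
    filter_upwards [hleft, c4] with w h2 h3 hw
    refine ⟨?_, h2 hw⟩
    rw [neg_neg, log_exp_pi_mul h3, add_sub_cancel]
  · exact continuousAt_conj_sheetInv_conj hq
  · rw [map_neg, map_one, sheetInv_neg_one hq le_rfl, ← conj_base, Complex.conj_conj]
  · rw [hlog0, add_zero]
  · filter_upwards [sheet_right_inv (e := e) (k := k) hq hρ le_rfl hhalf] with z h2 hz
    exact h2 hz
  · filter_upwards [tendsto_conj_neg_one.eventually (sheet_right_inv (e := -(e + 2 * q))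
      (k := -(k + 1)) hq hρ le_rfl hhalf)] with z h2 hz
    obtain ⟨⟨h5, h3⟩, h4⟩ := h2 (by simpa using hz)
    refine ⟨⟨by simpa using h5, ?_⟩, by rw [Complex.conj_conj, h4, Complex.conj_conj]⟩
    show 2 * k + 1 ≤ ((starRingEnd ℂ) _).im
    rw [Complex.conj_im]
    linarith
  · filter_upwards [eventually_ne_nhds (show (-1 : ℂ) ≠ 0 by norm_num)] with z hz0 hz
    constructor
    · show (_ + _ : ℂ).re ≤ 0
      rw [Complex.add_re, log_neg_div_pi_re]
      simp only [zero_add]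
      exact div_nonpos_of_nonpos_of_nonneg (Real.log_nonpos (norm_nonneg _) hz) hpi.le
    · rw [add_sub_cancel_left]
      exact exp_log_neg hz0
  · filter_upwards [hre2] with w h2 hA hB
    have h3 : 0 ≤ w.re := hA.1
    have h4 : w.im = 2 * k + 1 := le_antisymm hA.2 hB.2
    have h5 : w.re ≤ 1 / 2 := by nlinarith
    rw [sheet_conj_slit hq h4 h5 h3]
    refine ⟨?_, ?_, rfl⟩
    · rw [sheet_slit hq h4 h5 h3, norm_neg, Complex.norm_exp_ofReal_mul_I]
    · rw [sheet_slit hq h4 h5 h3, Complex.neg_im, Complex.exp_ofReal_mul_I_im, neg_nonpos, sub_zero]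
      refine Real.sin_nonneg_of_nonneg_of_le_pi ?_ ?_
      · exact mul_nonneg hpi.le (mul_nonneg (by linarith) h3)
      · nlinarith
  · refine Eventually.of_forall fun w hC hAB => ?_
    have h3 : 0 ≤ w.re := by
      rcases hAB with h | h <;> exact h.1
    rw [norm_neg, norm_exp_pi_mul, Complex.sub_re, le_antisymm hC h3]
    simp
  · filter_upwards [tendsto_conj_neg_one.eventually (sheetInv_glue (ρ := ρ) (e := e) (k := k) hq le_rfl)]
      with z h2 hz hz2
    exact (h2 (by simpa using hz) fun _ => by simpa using hz2).symm

/-! ### Arithmetic of the sectors; injectivity of `etaLog` and `tauLog`. -/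

/-- The value of `m` in the `j + 1`-st sector. -/
def sectorMult (n M j : ℕ) : ℕ := if j < lowCount n M then M / n else M / n + 1

section arith
variable {n M : ℕ}

theorem lowCount_pos (hn : 1 ≤ n) : 1 ≤ lowCount n M := by
  have h := Nat.lt_mul_div_succ M (show 0 < n by lia)
  unfold lowCount
  lia

/-- The subtraction in `lowCount` is not truncated, because M < n (M / n + 1). -/
theorem lowCount_add (hn : 1 ≤ n) : lowCount n M + M = n * (M / n) + n := by
  have h := Nat.lt_mul_div_succ M (show 0 < n by lia)
  unfold lowCount
  have : n * (M / n + 1) = n * (M / n) + n := by ring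
  lia

theorem lowCount_le (hn : 1 ≤ n) : lowCount n M ≤ n := by
  have h := lowCount_add (M := M) hn
  have h2 := Nat.mul_div_le M n
  lia

theorem one_le_natDiv (hn : 1 ≤ n) (hM : n < M) : 1 ≤ M / n :=
  (Nat.one_le_div_iff (by lia)).2 hM.le

theorem sectorMult_pos (hn : 1 ≤ n) (hM : n < M) (j : ℕ) : 1 ≤ sectorMult n M j := by
  have := one_le_natDiv hn hM
  unfold sectorMult
  split_ifs <;> lia

/-- The truncated difference `j - lowCount n M` starts to grow exactly with the sectors of
multiplier M / n + 1. -/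
theorem sectorEnd_succ (j : ℕ) :
    sectorEnd n M (j + 1) = sectorEnd n M j + 2 * sectorMult n M j := by
  unfold sectorEnd sectorMult
  have h1 : 2 * (j + 1) * (M / n) = 2 * j * (M / n) + 2 * (M / n) := by ring
  split_ifs <;> lia

theorem sectorEnd_zero : sectorEnd n M 0 = 0 := by
  simp [sectorEnd]

theorem sectorEnd_self (hn : 1 ≤ n) : sectorEnd n M n = 2 * M := by
  have h := lowCount_add (M := M) hn
  have h1 := lowCount_le (M := M) hn
  unfold sectorEnd
  have h2 : 2 * n * (M / n) = 2 * (n * (M / n)) := by ring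
  lia

theorem sectorEnd_mono : Monotone (sectorEnd n M) :=
  monotone_nat_of_le_succ fun j => by rw [sectorEnd_succ]; lia

theorem even_sectorEnd (j : ℕ) : ∃ a : ℕ, sectorEnd n M j = 2 * a :=
  ⟨j * (M / n) + (j - lowCount n M), by unfold sectorEnd; ring⟩

theorem sectorEnd_eq_of_le {j : ℕ} (hn : 1 ≤ n) (h : lowCount n M ≤ j) :
    (sectorEnd n M j : ℝ) = 2 * M + ((M / n : ℕ) + 1) * (2 * j - 2 * n) := by
  have h1 : ((lowCount n M : ℝ)) + M = n * (M / n : ℕ) + n := by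
    exact_mod_cast lowCount_add (M := M) hn
  unfold sectorEnd
  push_cast [h]
  linear_combination -2 * h1

/-- In the logarithmic coordinate of ζ ^ M the circle map has integral slope on every sector. -/
theorem mul_tauCircle (hn : 1 ≤ n) (hM : n < M) {j : ℕ} {v : ℝ} (h1 : 2 * j ≤ v)
    (h2 : v ≤ 2 * j + 2) :
    (M / n : ℝ) * tauCircle n M v = sectorEnd n M j + sectorMult n M j * (v - 2 * j) := by
  have hn0 : (n : ℝ) ≠ 0 := by positivity
  have hM0 : (M : ℝ) ≠ 0 := by
    have : M ≠ 0 := by lia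
    positivity
  unfold tauCircle
  by_cases hj : j < lowCount n M
  · have hv : v ≤ 2 * lowCount n M := by
      have : (j : ℝ) + 1 ≤ lowCount n M := by exact_mod_cast hj
      linarith
    have he : (sectorEnd n M j : ℝ) = 2 * j * (M / n : ℕ) := by
      unfold sectorEnd
      rw [Nat.sub_eq_zero_of_le hj.le]
      push_cast
      ring
    rw [if_pos hv, sectorMult, if_pos hj, he]
    field_simp
    ring
  · have hj' : lowCount n M ≤ j := not_lt.1 hj
    have he := sectorEnd_eq_of_le hn hj'
    rw [sectorMult, if_neg hj, he]
    push_cast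
    -- The first case is only the break v = 2 j = 2 p, where the two linear formulas agree.
    by_cases hv : v ≤ 2 * lowCount n M
    · have hjr : (lowCount n M : ℝ) ≤ j := by exact_mod_cast hj'
      have hvj : v = 2 * j := le_antisymm (by linarith) h1
      have hpj : (lowCount n M : ℝ) = j := by linarith
      have h3 : ((lowCount n M : ℝ)) + M = n * (M / n : ℕ) + n := by
        exact_mod_cast lowCount_add (M := M) hn
      rw [if_pos hv, hvj]
      field_simp
      rw [hpj] at h3
      linear_combination -h3
    · rw [if_neg hv]
      field_simp
      ring

theorem floor_half {y : ℝ} {j : ℕ} (h1 : 2 * j ≤ y) (h2 : y < 2 * j + 2) : ⌊y / 2⌋ = (j : ℤ) := by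
  rw [Int.floor_eq_iff]
  push_cast
  constructor <;> linarith

theorem etaLog_eq {w : ℂ} {j : ℕ} (h1 : 2 * j ≤ w.im) (h2 : w.im < 2 * j + 2) :
    etaLog n M w = psiStrip (sectorMult n M j) w := by
  unfold etaLog sectorMult
  by_cases hj : j < lowCount n M
  · have : (j : ℝ) + 1 ≤ lowCount n M := by exact_mod_cast hj
    rw [if_pos hj, if_pos (by linarith)]
  · have : (lowCount n M : ℝ) ≤ j := by exact_mod_cast not_lt.1 hj
    rw [if_neg hj, if_neg (by linarith)]

theorem etaLog_low {w : ℂ} {j : ℕ} (hx : w.re ≤ 1) (h1 : 2 * j ≤ w.im) (h2 : w.im ≤ 2 * j + 1) :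
    etaLog n M w = ⟨squareRe (sectorMult n M j) w.re (w.im - 2 * j),
      2 * j + squareIm (sectorMult n M j) w.re (w.im - 2 * j)⟩ := by
  rw [etaLog_eq h1 (by linarith), psiStrip]
  simp only [floor_half h1 (by linarith)]
  push_cast
  rw [if_pos (by linarith), psiSquare_eq hx]
  apply Complex.ext <;> simp
  ring

theorem etaLog_high {w : ℂ} {j : ℕ} (hx : w.re ≤ 1) (h1 : 2 * j + 1 < w.im)
    (h2 : w.im < 2 * j + 2) :
    etaLog n M w = ⟨squareRe (sectorMult n M j) w.re (2 * j + 2 - w.im),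
      2 * j + 2 - squareIm (sectorMult n M j) w.re (2 * j + 2 - w.im)⟩ := by
  rw [etaLog_eq (j := j) (by linarith) (by linarith), psiStrip]
  simp only [floor_half (j := j) (y := w.im) (by linarith) (by linarith)]
  push_cast
  rw [if_neg (by linarith), psiSquare_eq hx]
  have : 2 - (w.im - 2 * (j : ℝ)) = 2 * j + 2 - w.im := by ring
  rw [this]
  apply Complex.ext <;> simp
  ring

theorem exists_sector {y : ℝ} (h0 : 0 ≤ y) (h1 : y < 2 * n) :
    ∃ j < n, 2 * (j : ℝ) ≤ y ∧ y < 2 * j + 2 := by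
  refine ⟨⌊y / 2⌋₊, ?_, ?_, ?_⟩
  · rw [Nat.floor_lt (by linarith)]; linarith
  · have := Nat.floor_le (show 0 ≤ y / 2 by linarith)
    linarith
  · have := Nat.lt_floor_add_one (y / 2)
    linarith

/-- The final equivalence keeps the two halves of a sector apart: the slit belongs to the lower
half, and the open upper half stays strictly above the middle line. So the map is one-to-one
although it jumps across the slits. -/
theorem etaLog_mem {w : ℂ} {j : ℕ} (hx0 : 0 ≤ w.re) (hx : w.re ≤ 1) (h1 : 2 * j ≤ w.im)
    (h2 : w.im < 2 * j + 2) :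
    0 ≤ (etaLog n M w).re ∧ (etaLog n M w).re ≤ 1 ∧ 2 * j ≤ (etaLog n M w).im ∧
      (etaLog n M w).im < 2 * j + 2 ∧ ((etaLog n M w).im ≤ 2 * j + 1 ↔ w.im ≤ 2 * j + 1) := by
  by_cases h : w.im ≤ 2 * j + 1
  · rw [etaLog_low hx h1 h]
    have h3 := squareIm_nonneg (q := sectorMult n M j) hx0 (show 0 ≤ w.im - 2 * j by linarith)
    have h4 := squareIm_le (q := sectorMult n M j) (x := w.re) (d := w.im - 2 * j)
    refine ⟨squareRe_nonneg hx0 (by linarith), (squareRe_le hx).trans hx, ?_, ?_, ?_⟩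
    · simp only; linarith
    · simp only; linarith
    · simp only; constructor <;> intro <;> linarith
  · rw [not_le] at h
    rw [etaLog_high hx h h2]
    have h3 := squareIm_nonneg (q := sectorMult n M j) hx0 (show 0 ≤ 2 * j + 2 - w.im by linarith)
    have h5 : squareIm (sectorMult n M j) w.re (2 * j + 2 - w.im) ≠ 0 := fun h6 => by
      have := eq_zero_of_squareIm_eq_zero hx0 (by linarith) h6
      linarith
    have h4 := squareIm_le (q := sectorMult n M j) (x := w.re) (d := 2 * j + 2 - w.im)
    have h6 := lt_of_le_of_ne h3 h5.symm
    refine ⟨squareRe_nonneg hx0 (by linarith), (squareRe_le hx).trans hx, ?_, ?_, ?_⟩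
    · simp only; linarith
    · simp only; linarith
    · simp only; constructor <;> intro <;> linarith

theorem etaLog_injOn : Set.InjOn (etaLog n M) {w | 0 ≤ w.re ∧ w.re ≤ 1 ∧ 0 ≤ w.im ∧ w.im < 2 * n} := by
  rintro w ⟨hx0, hx, hy0, hy⟩ w' ⟨hx0', hx', hy0', hy'⟩ h
  obtain ⟨j, -, j1, j2⟩ := exists_sector hy0 hy
  obtain ⟨j', -, j1', j2'⟩ := exists_sector hy0' hy'
  obtain ⟨-, -, a1, a2, a3⟩ := etaLog_mem (n := n) (M := M) hx0 hx j1 j2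
  obtain ⟨-, -, b1, b2, b3⟩ := etaLog_mem (n := n) (M := M) hx0' hx' j1' j2'
  obtain rfl : j = j' := by
    have := floor_half a1 a2
    rw [h, floor_half b1 b2] at this
    exact_mod_cast this.symm
  rw [h] at a3
  have hiff := a3.symm.trans b3
  by_cases hl : w.im ≤ 2 * j + 1
  · have hl' := hiff.1 hl
    rw [etaLog_low hx j1 hl, etaLog_low hx' j1' hl', Complex.ext_iff] at h
    obtain ⟨e1, e2⟩ := square_injective ⟨hx0, hx⟩ ⟨hx0', hx'⟩ (by linarith) (by linarith) h.1
      (by have := h.2; simp only at this; linarith)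
    exact Complex.ext e1 (by linarith)
  · have hl' : ¬ w'.im ≤ 2 * j + 1 := fun h => hl (hiff.2 h)
    rw [not_le] at hl hl'
    rw [etaLog_high hx hl j2, etaLog_high hx' hl' j2', Complex.ext_iff] at h
    obtain ⟨e1, e2⟩ := square_injective ⟨hx0, hx⟩ ⟨hx0', hx'⟩ (by linarith) (by linarith) h.1
      (by have := h.2; simp only at this; linarith)
    exact Complex.ext e1 (by linarith)

theorem tauCircle_strictMono (hn : 1 ≤ n) (hM : n < M) : StrictMono (tauCircle n M) := by
  intro v v' h
  have hn0 : (0 : ℝ) < n := by positivity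
  have hM0 : (0 : ℝ) < M := by
    have : 0 < M := by lia
    exact_mod_cast this
  have hm : (0 : ℝ) < (M / n : ℕ) := by exact_mod_cast one_le_natDiv hn hM
  have hs1 : (0 : ℝ) < n * (M / n : ℕ) / M := by positivity
  have hs2 : (0 : ℝ) < n * ((M / n : ℕ) + 1) / M := by positivity
  have h3 : ((lowCount n M : ℝ)) + M = n * (M / n : ℕ) + n := by
    exact_mod_cast lowCount_add (M := M) hn
  -- The two linear pieces agree at the break v = 2 p.
  have hmid : (n * (M / n : ℕ) / M : ℝ) * (2 * lowCount n M) =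
      2 * n + (n * ((M / n : ℕ) + 1) / M : ℝ) * (2 * lowCount n M - 2 * n) := by
    field_simp
    linear_combination -h3
  unfold tauCircle
  split_ifs with c1 c2 c2
  · exact mul_lt_mul_of_pos_left h hs1
  · have e1 := mul_le_mul_of_nonneg_left c1 hs1.le
    have e2 := mul_lt_mul_of_pos_left (not_le.1 c2) hs2
    linarith
  · linarith
  · have e2 := mul_lt_mul_of_pos_left h hs2
    linarith

/-- For fixed real part the imaginary part is a convex combination of two strictly increasing
functions. -/
theorem tauLog_injOn (hn : 1 ≤ n) (hM : n < M) :
    Set.InjOn (tauLog n M) {w | 0 ≤ w.re ∧ w.re ≤ 1 ∧ 0 ≤ w.im ∧ w.im < 2 * n} := by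
  have key : ∀ u v v' : ℝ, 0 ≤ u → u ≤ 1 → v < v' →
      (1 - u) * tauCircle n M v + u * v < (1 - u) * tauCircle n M v' + u * v' := by
    intro u v v' hu0 hu1 h
    have h2 := tauCircle_strictMono hn hM h
    rcases hu0.eq_or_lt with h3 | h3
    · rw [← h3]; linarith
    · have := mul_lt_mul_of_pos_left h h3
      have := mul_le_mul_of_nonneg_left h2.le (sub_nonneg.2 hu1)
      linarith
  rintro w ⟨hx0, hx, hy0, hy⟩ w' ⟨hx0', hx', hy0', hy'⟩ h
  rw [tauLog, tauLog, Complex.ext_iff] at h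
  obtain ⟨h1, h2⟩ := h
  simp only at h1 h2
  refine Complex.ext h1 ?_
  rw [← h1] at h2
  rcases lt_trichotomy w.im w'.im with h3 | h3 | h3
  · have := key w.re _ _ hx0 hx h3
    linarith
  · exact h3
  · have := key w.re _ _ hx0 hx h3
    linarith

end arith

/-! ### The interpolating map in the logarithmic coordinate. -/

/-- The logarithmic coordinate of `ζ ^ M`, extended to the right of the annulus. -/
noncomputable def annulusLog (n M : ℕ) (w : ℂ) : ℂ :=
  (M / n : ℝ) * (if w.re ≤ 1 then tauLog n M (etaLog n M w) else w)

/-- The condition on the argument in `slitLunes`. -/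
def nearSlit (n M : ℕ) (b : ℝ) : Prop :=
  ∃ j < n, (sectorEnd n M j : ℝ) + 1 ≤ b ∧ b ≤ (sectorEnd n M (j + 1) : ℝ) - 1

open Classical in
/-- The map `σ` on the lunes that neighbour a slit, in terms of a logarithmic coordinate. -/
noncomputable def slitSigma (n M : ℕ) (L : ℂ) : ℂ :=
  if Complex.exp (Real.pi * L) ∈ lunes ∧ nearSlit n M L.im then sigma (Complex.exp (Real.pi * L))
  else Complex.exp (Real.pi * L)

/-- The normalized interpolating map in the logarithmic coordinate. -/
noncomputable def logMap (n M : ℕ) (w : ℂ) : ℂ :=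
  interpolatingMap n M 1 1 (Complex.exp ((Real.pi / n : ℝ) * w))

section log
variable {n M : ℕ}

theorem annulusLog_low (hn : 1 ≤ n) (hM : n < M) {w : ℂ} {j : ℕ} (hx0 : 0 ≤ w.re) (hx : w.re ≤ 1)
    (h1 : 2 * j ≤ w.im) (h2 : w.im ≤ 2 * j + 1) :
    annulusLog n M w = rowLog (M / n) (sectorMult n M j) (sectorEnd n M j) j w := by
  obtain ⟨-, -, h3, h4, -⟩ := etaLog_mem (n := n) (M := M) hx0 hx h1 (by linarith)
  have h5 := mul_tauCircle hn hM h3 h4.le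
  rw [annulusLog, if_pos hx, tauLog]
  rw [etaLog_low hx h1 h2] at *
  simp only at h5 ⊢
  rw [rowLog]
  apply Complex.ext
  · rw [Complex.re_ofReal_mul]
  · rw [Complex.im_ofReal_mul]
    linear_combination (1 - squareRe (sectorMult n M j) w.re (w.im - 2 * j)) * h5

/-- After conjugation the upper half of the sector is row -(j + 1), whose lower left corner has
height minus the next sector end. -/
theorem annulusLog_high (hn : 1 ≤ n) (hM : n < M) {w : ℂ} {j : ℕ} (hx0 : 0 ≤ w.re)
    (hx : w.re ≤ 1) (h1 : 2 * j + 1 < w.im) (h2 : w.im < 2 * j + 2) :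
    annulusLog n M w = (starRingEnd ℂ) (rowLog (M / n) (sectorMult n M j)
      (-(sectorEnd n M j + 2 * sectorMult n M j)) (-(j + 1)) ((starRingEnd ℂ) w)) := by
  obtain ⟨-, -, h3, h4, -⟩ := etaLog_mem (n := n) (M := M) hx0 hx (j := j) (by linarith) h2
  have h5 := mul_tauCircle hn hM h3 h4.le
  rw [annulusLog, if_pos hx, tauLog]
  rw [etaLog_high hx h1 h2] at *
  simp only at h5 ⊢
  rw [rowLog]
  have h6 : ((starRingEnd ℂ) w).im - 2 * -((j : ℝ) + 1) = 2 * j + 2 - w.im := by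
    rw [Complex.conj_im]; ring
  rw [h6, Complex.conj_re]
  apply Complex.ext
  · rw [Complex.re_ofReal_mul, Complex.conj_re]
  · rw [Complex.im_ofReal_mul, Complex.conj_im]
    linear_combination (1 - squareRe (sectorMult n M j) w.re (2 * j + 2 - w.im)) * h5

theorem ratio_pos (hn : 1 ≤ n) (hM : n < M) : (1 : ℝ) < M / n := by
  rw [one_lt_div (by positivity)]
  exact_mod_cast hM

/-- Each factor is one-to-one, and points with Re w ≤ 1 keep real part at most 1 before the scaling
by M/n, so the two definitions cannot collide. -/
theorem annulusLog_injOn (hn : 1 ≤ n) (hM : n < M) :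
    Set.InjOn (annulusLog n M) {w | 0 ≤ w.re ∧ 0 ≤ w.im ∧ w.im < 2 * n} := by
  have hρ : ((M / n : ℝ) : ℂ) ≠ 0 := by
    exact_mod_cast (zero_lt_one.trans (ratio_pos hn hM)).ne'
  have hre : ∀ w : ℂ, w.re ≤ 1 → 0 ≤ w.re → 0 ≤ w.im → w.im < 2 * n →
      0 ≤ (etaLog n M w).re ∧ (etaLog n M w).re ≤ 1 ∧ 0 ≤ (etaLog n M w).im ∧
        (etaLog n M w).im < 2 * n := by
    intro w h1 h2 h3 h4
    obtain ⟨j, hj, j1, j2⟩ := exists_sector h3 h4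
    obtain ⟨a1, a2, a3, a4, -⟩ := etaLog_mem (n := n) (M := M) h2 h1 j1 j2
    have hj' : (j : ℝ) + 1 ≤ n := by exact_mod_cast hj
    exact ⟨a1, a2, le_trans (by positivity) a3, by linarith⟩
  rintro w ⟨hx0, hy0, hy⟩ w' ⟨hx0', hy0', hy'⟩ h
  unfold annulusLog at h
  replace h := mul_left_cancel₀ hρ h
  split_ifs at h with h1 h2 h2
  · exact etaLog_injOn ⟨hx0, h1, hy0, hy⟩ ⟨hx0', h2, hy0', hy'⟩
      (tauLog_injOn hn hM (hre w h1 hx0 hy0 hy) (hre w' h2 hx0' hy0' hy') h)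
  · have := (hre w h1 hx0 hy0 hy).2.1
    have h3 := congrArg Complex.re h
    simp only [tauLog] at h3
    linarith
  · have := (hre w' h2 hx0' hy0' hy').2.1
    have h3 := congrArg Complex.re h
    simp only [tauLog] at h3
    linarith
  · exact h

theorem annulusLog_re_nonneg (hn : 1 ≤ n) (hM : n < M) {w : ℂ} (hx0 : 0 ≤ w.re) (hy0 : 0 ≤ w.im)
    (hy : w.im < 2 * n) : 0 ≤ (annulusLog n M w).re := by
  have hρ := ratio_pos hn hM
  rw [annulusLog, Complex.re_ofReal_mul]
  refine mul_nonneg (by linarith) ?_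
  split_ifs with h
  · obtain ⟨j, hj, j1, j2⟩ := exists_sector hy0 hy
    exact (etaLog_mem (n := n) (M := M) hx0 h j1 j2).1
  · exact hx0

theorem annulusLog_im_mem (hn : 1 ≤ n) (hM : n < M) {w : ℂ} (hx0 : 0 ≤ w.re) (hy0 : 0 ≤ w.im)
    (hy : w.im < 2 * n) : 0 ≤ (annulusLog n M w).im ∧ (annulusLog n M w).im < 2 * M := by
  have hρ := ratio_pos hn hM
  have hn0 : (0 : ℝ) < n := by positivity
  have hMn : (M / n : ℝ) * (2 * n) = 2 * M := by field_simp
  rw [annulusLog, Complex.im_ofReal_mul, ← hMn]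
  have hρ0 : (0 : ℝ) < M / n := by linarith
  suffices h : 0 ≤ (if w.re ≤ 1 then tauLog n M (etaLog n M w) else w).im ∧
      (if w.re ≤ 1 then tauLog n M (etaLog n M w) else w).im < 2 * n from
    ⟨mul_nonneg hρ0.le h.1, mul_lt_mul_of_pos_left h.2 hρ0⟩
  split_ifs with h
  · obtain ⟨j, hj, j1, j2⟩ := exists_sector hy0 hy
    obtain ⟨a1, a2, a3, a4, -⟩ := etaLog_mem (n := n) (M := M) hx0 h j1 j2
    have hj' : (j : ℝ) + 1 ≤ n := by exact_mod_cast hj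
    have hj0 : (0 : ℝ) ≤ j := by positivity
    rw [tauLog]
    simp only
    generalize (etaLog n M w).re = u at *
    generalize (etaLog n M w).im = v at *
    have t0 : tauCircle n M 0 = 0 := by simp [tauCircle]
    have t1 : tauCircle n M (2 * n) = 2 * n := by
      have := mul_tauCircle (v := 2 * n) (j := n) hn hM le_rfl (by linarith)
      rw [sectorEnd_self hn, sub_self, mul_zero, add_zero] at this
      push_cast at this
      rw [← hMn] at this
      exact mul_left_cancel₀ hρ0.ne' this
    have t2 : 0 ≤ tauCircle n M v := by
      rcases (show 0 ≤ v by linarith).eq_or_lt with h | h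
      · rw [← h, t0]
      · rw [← t0]
        exact (tauCircle_strictMono hn hM h).le
    have t3 : tauCircle n M v < 2 * n := by
      conv_rhs => rw [← t1]
      exact tauCircle_strictMono hn hM (by linarith)
    constructor
    · exact add_nonneg (mul_nonneg (by linarith) t2) (mul_nonneg a1 (by linarith))
    · rcases a1.eq_or_lt with h | h
      · rw [← h]; linarith
      · have e1 := mul_lt_mul_of_pos_left (show v < 2 * n by linarith) h
        have e2 := mul_le_mul_of_nonneg_left t3.le (show 0 ≤ 1 - u by linarith)
        linarith
  · exact ⟨hy0, hy⟩

theorem norm_logMap_arg (w : ℂ) :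
    ‖Complex.exp ((Real.pi / n : ℝ) * w)‖ = Real.exp (Real.pi / n * w.re) := by
  rw [Complex.norm_exp, Complex.re_ofReal_mul]

theorem logMap_of_re_neg (hn : 1 ≤ n) {w : ℂ} (hw : w.re < 0) :
    logMap n M w = Complex.exp (Real.pi * w) := by
  have hn0 : (0 : ℝ) < n := by positivity
  have h : ‖Complex.exp ((Real.pi / n : ℝ) * w)‖ < 1 := by
    rw [norm_logMap_arg, Real.exp_lt_one_iff]
    exact mul_neg_of_pos_of_neg (div_pos Real.pi_pos hn0) hw
  rw [logMap, interpolatingMap, if_pos h, one_mul, ← Complex.exp_nat_mul]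
  congr 1
  push_cast
  have : (n : ℂ) ≠ 0 := by exact_mod_cast hn0.ne'
  field_simp

theorem logCoord_exp (hn : 1 ≤ n) {w : ℂ} (h0 : 0 ≤ w.im) (h1 : w.im < 2 * n) :
    logCoord n (Complex.exp ((Real.pi / n : ℝ) * w)) = w := by
  have hn0 : (0 : ℝ) < n := by positivity
  have hpi := Real.pi_pos
  have ha : (if 0 ≤ (Complex.exp ((Real.pi / n : ℝ) * w)).arg then
      (Complex.exp ((Real.pi / n : ℝ) * w)).arg
      else (Complex.exp ((Real.pi / n : ℝ) * w)).arg + 2 * Real.pi) = Real.pi / n * w.im := by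
    have hk : 0 < Real.pi / n := div_pos hpi hn0
    have hnn : 0 ≤ Real.pi / n * w.im := mul_nonneg hk.le h0
    have hlt : Real.pi / n * w.im < 2 * Real.pi := by
      have := mul_lt_mul_of_pos_left h1 hk
      have e : Real.pi / n * (2 * n) = 2 * Real.pi := by field_simp
      linarith
    rw [Complex.arg_exp, Complex.im_ofReal_mul]
    -- Beyond π the principal argument is smaller by 2 π, which `logCoord` adds again.
    by_cases hle : Real.pi / n * w.im ≤ Real.pi
    · have : toIocMod Real.two_pi_pos (-Real.pi) (Real.pi / n * w.im) = Real.pi / n * w.im := by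
        rw [toIocMod_eq_self]
        constructor <;> linarith
      rw [this, if_pos hnn]
    · have : toIocMod Real.two_pi_pos (-Real.pi) (Real.pi / n * w.im) =
          Real.pi / n * w.im - 2 * Real.pi := by
        rw [← toIocMod_sub, toIocMod_eq_self]
        constructor <;> linarith
      rw [this, if_neg (by linarith)]
      ring
  rw [logCoord, ha, norm_logMap_arg, Real.log_exp]
  apply Complex.ext
  · rw [Complex.re_ofReal_mul]
    field_simp
  · rw [Complex.im_ofReal_mul]
    field_simp

theorem mem_slitLunes_iff (w : ℂ) :
    w ∈ slitLunes n M ↔ Complex.exp (Real.pi * ((M / n : ℝ) * w)) ∈ lunes ∧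
      nearSlit n M (((M / n : ℝ) : ℂ) * w).im := by
  have e1 : Complex.exp ((M * Real.pi / n : ℝ) * w) =
      Complex.exp (Real.pi * ((M / n : ℝ) * w)) := by
    congr 1
    push_cast
    ring
  have e2 : w.im * M / n = (((M / n : ℝ) : ℂ) * w).im := by
    rw [Complex.im_ofReal_mul]
    ring
  unfold slitLunes nearSlit
  rw [← e1, ← e2]
  rfl

/-- ‖P‖ ^ 2 ≤ 1 + 2 ‖P‖ forces ‖P‖ ≤ 1 + √2. The bound 3 suffices to keep exp (π L) out of the lunes
when Re L > 1. -/
theorem lunes_norm_lt {P : ℂ} (h : P ∈ lunes) : ‖P‖ < 3 := by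
  obtain ⟨h1, h2⟩ := h
  have := Complex.abs_im_le_norm P
  nlinarith

theorem exp_notMem_lunes {L : ℂ} (h : 1 < L.re) : Complex.exp (Real.pi * L) ∉ lunes := by
  intro hl
  have h1 := lunes_norm_lt hl
  rw [norm_exp_pi_mul] at h1
  have h2 := Real.add_one_le_exp (Real.pi * L.re)
  have h3 := Real.pi_gt_three
  nlinarith

theorem logMap_of_one_lt (hn : 1 ≤ n) {w : ℂ} (hw : 1 < w.re) :
    logMap n M w = Complex.exp (Real.pi * ((M / n : ℝ) * w)) := by
  have hn0 : (0 : ℝ) < n := by positivity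
  have hk : 0 < Real.pi / n := div_pos Real.pi_pos hn0
  have h : Real.exp (Real.pi / n) < ‖Complex.exp ((Real.pi / n : ℝ) * w)‖ := by
    rw [norm_logMap_arg, Real.exp_lt_exp]
    nlinarith
  have h1 : 1 < Real.exp (Real.pi / n) := Real.one_lt_exp_iff.2 hk
  rw [logMap, interpolatingMap, if_neg (by linarith), one_mul, if_neg (by linarith), one_mul,
    Complex.ofReal_one, one_pow, div_one, ← Complex.exp_nat_mul]
  congr 1
  push_cast
  have : (n : ℂ) ≠ 0 := by exact_mod_cast hn0.ne'
  field_simp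

/-- This includes Re w > 1: there Re L > 1 as well, which is beyond the lunes, so `slitSigma` is the
exponential. -/
theorem logMap_eq_slitSigma (hn : 1 ≤ n) (hM : n < M) {w : ℂ} (hx0 : 0 ≤ w.re) (hy0 : 0 ≤ w.im)
    (hy : w.im < 2 * n) : logMap n M w = slitSigma n M (annulusLog n M w) := by
  have hn0 : (0 : ℝ) < n := by positivity
  have hk : 0 < Real.pi / n := div_pos Real.pi_pos hn0
  by_cases hx : w.re ≤ 1
  · have h : ‖Complex.exp ((Real.pi / n : ℝ) * w)‖ ≤ Real.exp (Real.pi / n) := by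
      rw [norm_logMap_arg, Real.exp_le_exp]
      nlinarith
    have h1 : 1 ≤ ‖Complex.exp ((Real.pi / n : ℝ) * w)‖ := by
      rw [norm_logMap_arg, Real.one_le_exp_iff]
      exact mul_nonneg hk.le hx0
    have e1 : ∀ w : ℂ, Complex.exp ((M * Real.pi / n : ℝ) * w) =
        Complex.exp (Real.pi * ((M / n : ℝ) * w)) := by
      intro w
      congr 1
      push_cast
      ring
    rw [logMap, interpolatingMap, if_neg (by linarith), one_mul, if_pos h, Complex.ofReal_one,
      one_pow, one_mul, one_mul, div_one, unitInterpolation]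
    rw [logCoord_exp hn hy0 hy, e1, slitSigma, annulusLog, if_pos hx]
    by_cases hs : tauLog n M (etaLog n M w) ∈ slitLunes n M
    · rw [if_pos hs, if_pos ((mem_slitLunes_iff _).1 hs)]
    · rw [if_neg hs, if_neg (mt (mem_slitLunes_iff _).2 hs)]
  · rw [not_le] at hx
    have h1 : annulusLog n M w = (M / n : ℝ) * w := by
      rw [annulusLog, if_neg (not_le.2 hx)]
    have h2 := ratio_pos hn hM
    rw [logMap_of_one_lt hn hx, h1, slitSigma, if_neg]
    rintro ⟨h3, -⟩
    refine exp_notMem_lunes ?_ h3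
    rw [Complex.re_ofReal_mul]
    nlinarith

theorem logMap_add_period (hn : 1 ≤ n) (w : ℂ) : logMap n M (w + 2 * n * Complex.I) = logMap n M w := by
  have : (n : ℂ) ≠ 0 := by
    have : n ≠ 0 := by lia
    exact_mod_cast this
  unfold logMap
  congr 1
  have e : ((Real.pi / n : ℝ) : ℂ) * (w + 2 * n * Complex.I) =
      (Real.pi / n : ℝ) * w + 2 * Real.pi * Complex.I := by
    push_cast
    field_simp
  rw [e, Complex.exp_periodic]

end log

/-! ### Continuation across Im w = 0, and continuity off the slits. -/

/-- `annulusLog`, continued below the real axis by periodicity. -/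
noncomputable def extLog (n M : ℕ) (w : ℂ) : ℂ :=
  if 0 ≤ w.im then annulusLog n M w
  else annulusLog n M (w + 2 * n * Complex.I) - 2 * M * Complex.I

theorem add_period_im (n : ℕ) (w : ℂ) : (w + 2 * n * Complex.I).im = w.im + 2 * n := by simp

theorem squareRe_one {q : ℕ} {d : ℝ} : squareRe q 1 d = 1 ∧ squareIm q 1 d = d := by
  by_cases hq : q ≤ 1
  · simp [squareRe, squareIm, hq]
  · rcases le_total d (1 - 1 / q) with h | h
    · exact square_region₁ (by lia) le_rfl (by rwa [mul_one])
    · have := square_region₄ (q := q) (x := 1) (d := d) (by lia) le_rfl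
        (by linarith)
      exact ⟨by rw [this.1]; norm_num, this.2⟩

theorem square_bottom {q : ℕ} {x : ℝ} (hx0 : 0 ≤ x) (hx : x ≤ 1) :
    squareRe q x 0 = x ∧ squareIm q x 0 = 0 := by
  by_cases hq : q ≤ 1
  · simp [squareRe, squareIm, hq]
  · obtain ⟨h0, h1, -⟩ := exists_inv_natCast (q := q) (by lia)
    exact square_region₁ (by lia) hx (mul_nonneg (by linarith) hx0)

theorem squareIm_top {q : ℕ} {x : ℝ} (hx : x ≤ 1) (h : 2 ≤ q → 1 / 2 ≤ x) :
    squareIm q x 1 = 1 := by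
  by_cases hq : q ≤ 1
  · simp [squareIm, hq]
  · have h2 := h (by lia)
    obtain ⟨h0, h1, -⟩ := exists_inv_natCast (q := q) (by lia)
    exact (square_region₄ (by lia) hx (by nlinarith)).2

section
variable {n M : ℕ}

theorem annulusLog_right {w : ℂ} (hx : w.re = 1) (h0 : 0 ≤ w.im)
    (h1 : w.im < 2 * n) : annulusLog n M w = (M / n : ℝ) * w := by
  obtain ⟨j, -, j1, j2⟩ := exists_sector h0 h1
  have he : etaLog n M w = w := by
    rcases le_or_gt w.im (2 * j + 1) with h | h
    · rw [etaLog_low hx.le j1 h, hx, squareRe_one.1, squareRe_one.2]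
      exact Complex.ext hx.symm (by simp)
    · rw [etaLog_high hx.le h j2, hx, squareRe_one.1, squareRe_one.2]
      exact Complex.ext hx.symm (by simp)
  rw [annulusLog, if_pos hx.le, he, tauLog]
  congr 1
  refine Complex.ext rfl ?_
  simp [hx]

/-- The sign of the imaginary part is preserved, so the value reveals which of the two definitions
was used. -/
theorem extLog_injOn (hn : 1 ≤ n) (hM : n < M) :
    Set.InjOn (extLog n M) {w | 0 ≤ w.re ∧ -1 < w.im ∧ w.im < 2 * n} := by
  have hnr : (1 : ℝ) ≤ n := by exact_mod_cast hn
  have him : ∀ w : ℂ, 0 ≤ w.re → -1 < w.im → w.im < 2 * n →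
      (0 ≤ (extLog n M w).im ↔ 0 ≤ w.im) := by
    intro w h1 h2 h3
    unfold extLog
    split_ifs with h
    · exact iff_of_true (annulusLog_im_mem hn hM h1 h h3).1 h
    · refine iff_of_false ?_ h
      have := (annulusLog_im_mem (w := w + 2 * n * Complex.I) hn hM (by simpa using h1)
        (by rw [add_period_im]; linarith) (by rw [add_period_im]; linarith)).2
      simp only [Complex.sub_im, Complex.mul_im, Complex.mul_re, Complex.re_ofNat, Complex.im_ofNat,
        Complex.natCast_re, Complex.natCast_im, Complex.I_re, Complex.I_im]
      linarith
  rintro w ⟨h1, h2, h3⟩ w' ⟨h1', h2', h3'⟩ h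
  have hiff := him w h1 h2 h3
  rw [h, him w' h1' h2' h3'] at hiff
  unfold extLog at h
  by_cases hw : 0 ≤ w.im
  · rw [if_pos hw, if_pos (hiff.2 hw)] at h
    exact annulusLog_injOn hn hM ⟨h1, hw, h3⟩ ⟨h1', hiff.2 hw, h3'⟩ h
  · have hw' : ¬ 0 ≤ w'.im := fun h => hw (hiff.1 h)
    rw [if_neg hw, if_neg hw'] at h
    have := annulusLog_injOn hn hM ⟨by simpa using h1, by rw [add_period_im]; linarith,
      by rw [add_period_im]; linarith⟩ ⟨by simpa using h1', by rw [add_period_im]; linarith,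
      by rw [add_period_im]; linarith⟩ (sub_left_injective h)
    exact add_left_injective _ this

theorem extLog_re_nonneg (hn : 1 ≤ n) (hM : n < M) {w : ℂ} (h1 : 0 ≤ w.re) (h2 : -1 < w.im)
    (h3 : w.im < 2 * n) : 0 ≤ (extLog n M w).re := by
  have hnr : (1 : ℝ) ≤ n := by exact_mod_cast hn
  unfold extLog
  split_ifs with h
  · exact annulusLog_re_nonneg hn hM h1 h h3
  · have := annulusLog_re_nonneg (w := w + 2 * n * Complex.I) hn hM (by simpa using h1)
        (by rw [add_period_im]; linarith) (by rw [add_period_im]; linarith)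
    simpa using this

/-- A pasting lemma for limits; a piece that stays away from the base point needs no limit. -/
theorem tendsto_of_cover {α β : Type*} {l : Filter α} {l' : Filter β} {f : α → β} {ι : Type*}
    [Finite ι] {A : ι → α → Prop} (hcov : ∀ᶠ x in l, ∃ i, A i x) {g : ι → α → β}
    (hg : ∀ i, (∀ᶠ x in l, ¬ A i x) ∨ Tendsto (g i) l l')
    (hfg : ∀ i, ∀ᶠ x in l, A i x → f x = g i x) : Tendsto f l l' := by
  intro V hV
  have h : ∀ i, ∀ᶠ x in l, A i x → f x ∈ V := by
    intro i
    rcases hg i with hi | hi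
    · filter_upwards [hi] with x h1 h2
      exact absurd h2 h1
    · have h3 : ∀ᶠ x in l, g i x ∈ V := hi hV
      filter_upwards [hfg i, h3] with x h1 h2 h3
      rw [h1 h3]
      exact h2
  have h' := eventually_all.2 h
  rw [mem_map]
  filter_upwards [hcov, h'] with x ⟨i, hi⟩ h3
  exact h3 i hi

/-- The upper half of the `j + 1`-st sector in the coordinates of `annulusLog`. -/
noncomputable def upperRowLog (n M j : ℕ) (w : ℂ) : ℂ :=
  (starRingEnd ℂ) (rowLog (M / n) (sectorMult n M j)
      (-(sectorEnd n M j + 2 * sectorMult n M j)) (-(j + 1)) ((starRingEnd ℂ) w))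

/-- The lower half of the `j + 1`-st sector in the coordinates of `annulusLog`. -/
noncomputable def lowerRowLog (n M j : ℕ) (w : ℂ) : ℂ :=
  rowLog (M / n) (sectorMult n M j) (sectorEnd n M j) j w

theorem continuous_lowerRowLog (j : ℕ) : Continuous (lowerRowLog n M j) :=
  continuous_rowLog _ _ _ _

theorem continuous_upperRowLog (j : ℕ) : Continuous (upperRowLog n M j) :=
  Complex.continuous_conj.comp ((continuous_rowLog _ _ _ _).comp Complex.continuous_conj)

/-- Beyond the slit, or if q = 1, the middle line of the sector is mapped into itself by ψ_q, so the
two halves match. -/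
theorem upperRowLog_middle {j : ℕ} {w : ℂ} (hx : w.re ≤ 1) (hy : w.im = 2 * j + 1)
    (h : 2 ≤ sectorMult n M j → 1 / 2 ≤ w.re) : upperRowLog n M j w = lowerRowLog n M j w := by
  have h1 : w.im - 2 * (j : ℝ) = 1 := by rw [hy]; ring
  have h2 : ((starRingEnd ℂ) w).im - 2 * -((j : ℝ) + 1) = 1 := by
    rw [Complex.conj_im, hy]; ring
  have h3 := squareIm_top hx h
  rw [upperRowLog, lowerRowLog, rowLog, rowLog, h1, h2, Complex.conj_re, h3]
  apply Complex.ext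
  · rfl
  · simp only [Complex.conj_im]
    ring

theorem upperRowLog_top {j : ℕ} {w : ℂ} (hx0 : 0 ≤ w.re) (hx : w.re ≤ 1) (hy : w.im = 2 * j + 2) :
    upperRowLog n M j w =
      ⟨M / n * w.re, (1 - w.re) * sectorEnd n M (j + 1) + w.re * (M / n * (2 * (j + 1)))⟩ := by
  have h2 : ((starRingEnd ℂ) w).im - 2 * -((j : ℝ) + 1) = 0 := by
    rw [Complex.conj_im, hy]; ring
  rw [upperRowLog, rowLog, h2, Complex.conj_re, (square_bottom hx0 hx).1, (square_bottom hx0 hx).2,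
    sectorEnd_succ]
  apply Complex.ext
  · rfl
  · simp only [Complex.conj_im]
    push_cast
    ring

theorem lowerRowLog_bottom {j : ℕ} {w : ℂ} (hx0 : 0 ≤ w.re) (hx : w.re ≤ 1) (hy : w.im = 2 * j) :
    lowerRowLog n M j w =
      ⟨M / n * w.re, (1 - w.re) * sectorEnd n M j + w.re * (M / n * (2 * j))⟩ := by
  have h2 : w.im - 2 * (j : ℝ) = 0 := by rw [hy]; ring
  rw [lowerRowLog, rowLog, h2, (square_bottom hx0 hx).1, (square_bottom hx0 hx).2]
  apply Complex.ext
  · rfl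
  · simp only
    ring

/-- Below the line Im w = 2 j lies the upper half of the preceding sector; for j = 0 it is that of
the last sector, moved by the period. -/
theorem exists_extLog_below (hn : 1 ≤ n) (hM : n < M) {j : ℕ} (hj : j < n) :
    ∃ g : ℂ → ℂ, Continuous g ∧
      (∀ w : ℂ, 0 ≤ w.re → w.re ≤ 1 → w.im = 2 * j → g w = lowerRowLog n M j w) ∧
      ∀ w : ℂ, 0 ≤ w.re → w.re ≤ 1 → 2 * (j : ℝ) - 1 < w.im → w.im < 2 * j → extLog n M w = g w := by
  have hn0 : (n : ℝ) ≠ 0 := by positivity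
  rcases j with _ | j
  · obtain ⟨N, rfl⟩ : ∃ N, n = N + 1 := ⟨n - 1, by lia⟩
    refine ⟨fun w => upperRowLog (N + 1) M N (w + 2 * (N + 1 : ℕ) * Complex.I) - 2 * M * Complex.I,
      ?_, ?_, ?_⟩
    · exact ((continuous_upperRowLog N).comp (continuous_id.add continuous_const)).sub
        continuous_const
    · intro w h1 h2 h3
      beta_reduce
      rw [lowerRowLog_bottom h1 h2 h3, upperRowLog_top (by simpa using h1) (by simpa using h2)
        (by rw [add_period_im, h3]; push_cast; ring), sectorEnd_self hn, sectorEnd_zero]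
      apply Complex.ext
      · simp
      · simp
        have : (N : ℝ) + 1 ≠ 0 := by exact_mod_cast hn0
        field_simp
        ring
    · intro w h1 h2 h3 h4
      push_cast at h3 h4
      rw [extLog, if_neg (by linarith)]
      congr 1
      exact annulusLog_high hn hM (by simpa using h1) (by simpa using h2)
        (by rw [add_period_im]; push_cast; linarith) (by rw [add_period_im]; push_cast; linarith)
  · refine ⟨upperRowLog n M j, continuous_upperRowLog j, ?_, ?_⟩
    · intro w h1 h2 h3
      rw [lowerRowLog_bottom h1 h2 h3, upperRowLog_top h1 h2 (by rw [h3]; push_cast; ring)]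
      push_cast
      rfl
    · intro w h1 h2 h3 h4
      push_cast at h3 h4
      have hj0 : (0 : ℝ) ≤ j := by positivity
      rw [extLog, if_pos (by linarith)]
      exact annulusLog_high hn hM h1 h2 (by linarith) (by linarith)

theorem eventually_lt_im {w₀ : ℂ} {S : Set ℂ} {a : ℝ} (h : a < w₀.im) :
    ∀ᶠ w : ℂ in 𝓝[S] w₀, a < w.im :=
  (continuousAt_const.eventually_lt Complex.continuous_im.continuousAt h).filter_mono
    nhdsWithin_le_nhds

theorem eventually_im_lt {w₀ : ℂ} {S : Set ℂ} {a : ℝ} (h : w₀.im < a) :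
    ∀ᶠ w : ℂ in 𝓝[S] w₀, w.im < a :=
  (Complex.continuous_im.continuousAt.eventually_lt continuousAt_const h).filter_mono
    nhdsWithin_le_nhds

theorem eventually_re_lt {w₀ : ℂ} {S : Set ℂ} {a : ℝ} (h : w₀.re < a) :
    ∀ᶠ w : ℂ in 𝓝[S] w₀, w.re < a :=
  (Complex.continuous_re.continuousAt.eventually_lt continuousAt_const h).filter_mono
    nhdsWithin_le_nhds

theorem eventually_lt_re {w₀ : ℂ} {S : Set ℂ} {a : ℝ} (h : a < w₀.re) :
    ∀ᶠ w : ℂ in 𝓝[S] w₀, a < w.re :=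
  (continuousAt_const.eventually_lt Complex.continuous_re.continuousAt h).filter_mono
    nhdsWithin_le_nhds

/-- `extLog` is continuous off the slits and at their ends `Re w = 1 / 2`. -/
theorem tendsto_extLog (hn : 1 ≤ n) (hM : n < M) {w₀ : ℂ} {j : ℕ} (hj : j < n) (hx0 : 0 ≤ w₀.re)
    (hx : w₀.re ≤ 1) (h1 : 2 * j ≤ w₀.im) (h2 : w₀.im < 2 * j + 2)
    (hslit : w₀.im = 2 * j + 1 → 2 ≤ sectorMult n M j → 1 / 2 ≤ w₀.re) :
    Tendsto (extLog n M) (𝓝[{w | 0 ≤ w.re}] w₀) (𝓝 (annulusLog n M w₀)) := by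
  have hj' : (j : ℝ) + 1 ≤ n := by exact_mod_cast hj
  have hj0 : (0 : ℝ) ≤ j := by positivity
  obtain ⟨g, hgc, hg1, hg2⟩ := exists_extLog_below hn hM hj
  have hS : ∀ᶠ w : ℂ in 𝓝[{w | 0 ≤ w.re}] w₀, 0 ≤ w.re := eventually_mem_nhdsWithin
  have htend : ∀ {g : ℂ → ℂ}, Continuous g → g w₀ = annulusLog n M w₀ →
      Tendsto g (𝓝[{w | 0 ≤ w.re}] w₀) (𝓝 (annulusLog n M w₀)) := by
    intro g hg h
    rw [← h]
    exact hg.continuousAt.tendsto.mono_left nhdsWithin_le_nhds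
  have hlow : w₀.im ≤ 2 * j + 1 → lowerRowLog n M j w₀ = annulusLog n M w₀ := fun h =>
    (annulusLog_low hn hM hx0 hx h1 h).symm
  -- The pieces are the outside of the annulus, the part below the sector, and the two halves of the
  -- sector.
  refine tendsto_of_cover
    (A := ![fun w => 1 < w.re, fun w => w.re ≤ 1 ∧ w.im < 2 * j,
      fun w => w.re ≤ 1 ∧ 2 * j ≤ w.im ∧ w.im ≤ 2 * j + 1,
      fun w => w.re ≤ 1 ∧ 2 * j + 1 < w.im])
    (g := ![fun w => (M / n : ℝ) * w, g, lowerRowLog n M j, upperRowLog n M j]) ?_ ?_ ?_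
  · refine Eventually.of_forall fun w => ?_
    rcases lt_or_ge 1 w.re with h | h
    · exact ⟨0, h⟩
    rcases lt_or_ge w.im (2 * j) with h' | h'
    · exact ⟨1, h, h'⟩
    rcases le_or_gt w.im (2 * j + 1) with h'' | h''
    · exact ⟨2, h, h', h''⟩
    · exact ⟨3, h, h''⟩
  · intro i
    fin_cases i
    · rcases hx.eq_or_lt with h | h
      · right
        exact htend (continuous_const.mul continuous_id)
          (annulusLog_right h (by linarith) (by linarith)).symm
      · left
        filter_upwards [eventually_re_lt h] with w hw using not_lt.2 hw.le
    · rcases h1.eq_or_lt with h | h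
      · right
        exact htend hgc ((hg1 w₀ hx0 hx h.symm).trans (hlow (by linarith)))
      · left
        filter_upwards [eventually_lt_im h] with w hw h3
        exact absurd h3.2 (not_lt.2 hw.le)
    · rcases le_or_gt w₀.im (2 * j + 1) with h | h
      · right
        exact htend (continuous_lowerRowLog j) (hlow h)
      · left
        filter_upwards [eventually_lt_im h] with w hw h3
        exact absurd h3.2.2 (not_le.2 hw)
    · rcases lt_trichotomy w₀.im (2 * j + 1) with h | h | h
      · left
        filter_upwards [eventually_im_lt h] with w hw h3
        exact absurd h3.2 (not_lt.2 hw.le)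
      · right
        exact htend (continuous_upperRowLog j)
          ((upperRowLog_middle hx h (hslit h)).trans (hlow h.le))
      · right
        exact htend (continuous_upperRowLog j) (annulusLog_high hn hM hx0 hx h h2).symm
  · have e1 : ∀ᶠ w : ℂ in 𝓝[{w | 0 ≤ w.re}] w₀, 2 * (j : ℝ) - 1 < w.im :=
      eventually_lt_im (by linarith)
    have e2 : ∀ᶠ w : ℂ in 𝓝[{w | 0 ≤ w.re}] w₀, w.im < 2 * j + 2 := eventually_im_lt h2
    intro i
    fin_cases i
    · have hρ : (M / n : ℝ) * (2 * n) = 2 * M := by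
        have hn0 : (n : ℝ) ≠ 0 := by positivity
        field_simp
      filter_upwards with w h3
      replace h3 : ¬ w.re ≤ 1 := not_le.2 h3
      show extLog n M w = (M / n : ℝ) * w
      unfold extLog
      split_ifs with h
      · rw [annulusLog, if_neg h3]
      · rw [annulusLog, if_neg (by simpa using h3)]
        have hρ' : ((M / n : ℝ) : ℂ) * (2 * n) = 2 * M := by exact_mod_cast hρ
        linear_combination Complex.I * hρ'
    · filter_upwards [e1, hS] with w h4 h5 h3
      exact hg2 w h5 h3.1 h4 h3.2
    · filter_upwards [hS] with w h5 h3
      show extLog n M w = _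
      rw [extLog, if_pos (by linarith [h3.2.1])]
      exact annulusLog_low hn hM h5 h3.1 h3.2.1 h3.2.2
    · filter_upwards [hS, e2] with w h5 h6 h3
      show extLog n M w = _
      rw [extLog, if_pos (by linarith [h3.2])]
      exact annulusLog_high hn hM h5 h3.1 h3.2 h6

end

/-! ### The exponential exp (π L) and the partial application of σ. -/

/-- The periods are the multiples of 2 i, and heights in the strip differ by less than 2. -/
theorem exp_pi_injOn (b : ℝ) :
    Set.InjOn (fun L : ℂ => Complex.exp (Real.pi * L)) {L | |L.im - b| < 1} := by
  intro L hL L' hL' h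
  replace hL := abs_lt.1 (show |L.im - b| < 1 from hL)
  replace hL' := abs_lt.1 (show |L'.im - b| < 1 from hL')
  have hpi : (Real.pi : ℂ) ≠ 0 := by exact_mod_cast Real.pi_pos.ne'
  obtain ⟨k, hk⟩ := Complex.exp_eq_exp_iff_exists_int.1 h
  have hk' : L = L' + (2 * k : ℝ) * Complex.I := by
    apply mul_left_cancel₀ hpi
    rw [hk]
    push_cast
    ring
  have him := congrArg Complex.im hk'
  rw [Complex.add_im, Complex.im_ofReal_mul, Complex.I_im] at him
  have h1 : (k : ℝ) < 1 := by linarith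
  have h2 : (-1 : ℝ) < k := by linarith
  have h3 : k < 1 := by exact_mod_cast h1
  have h4 : -1 < k := by exact_mod_cast h2
  obtain rfl : k = 0 := by lia
  rw [hk']
  simp

theorem mem_nhds_im_sub_lt (L : ℂ) : {L' : ℂ | |L'.im - L.im| < 1} ∈ 𝓝 L := by
  have hc : Continuous fun L' : ℂ => |L'.im - L.im| := by fun_prop
  exact (isOpen_lt hc continuous_const).mem_nhds (by simp)

theorem one_le_norm_exp_pi {L : ℂ} (h : 0 ≤ L.re) : 1 ≤ ‖Complex.exp (Real.pi * L)‖ := by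
  rw [norm_exp_pi_mul, Real.one_le_exp_iff]
  exact mul_nonneg Real.pi_pos.le h

theorem one_lt_norm_exp_pi {L : ℂ} (h : 0 < L.re) : 1 < ‖Complex.exp (Real.pi * L)‖ := by
  rw [norm_exp_pi_mul, Real.one_lt_exp_iff]
  exact mul_pos Real.pi_pos h

theorem norm_exp_pi_eq_one {L : ℂ} (h : ‖Complex.exp (Real.pi * L)‖ = 1) : L.re = 0 := by
  rw [norm_exp_pi_mul, Real.exp_eq_one_iff] at h
  exact (mul_eq_zero.1 h).resolve_left Real.pi_pos.ne'

theorem exp_pi_im (L : ℂ) :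
    (Complex.exp (Real.pi * L)).im = Real.exp (Real.pi * L.re) * Real.sin (Real.pi * L.im) := by
  rw [Complex.exp_im, Complex.re_ofReal_mul, Complex.im_ofReal_mul]

theorem exp_pi_im_of_int {L : ℂ} {k : ℤ} (h : L.im = k) : (Complex.exp (Real.pi * L)).im = 0 := by
  rw [exp_pi_im, h, mul_comm Real.pi (k : ℝ), Real.sin_int_mul_pi, mul_zero]

theorem continuous_exp_pi : Continuous fun L : ℂ => Complex.exp (Real.pi * L) := by fun_prop

theorem isClosed_lunes : IsClosed lunes := by
  have e : lunes = {z : ℂ | 1 ≤ ‖z‖} ∩ {z : ℂ | ‖z‖ ^ 2 ≤ 1 + 2 * |z.im|} := rfl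
  rw [e]
  refine IsClosed.inter (isClosed_le continuous_const continuous_norm) (isClosed_le ?_ ?_) <;>
    fun_prop

section
variable {n M : ℕ}

/-- At integral heights exp (π L) is real, and σ fixes it; so end points of the `nearSlit` intervals
are harmless. -/
theorem slitSigma_eq_exp_of {L : ℂ} (hL : 0 ≤ L.re)
    (h : nearSlit n M L.im → ∃ k : ℤ, L.im = k) :
    slitSigma n M L = Complex.exp (Real.pi * L) := by
  unfold slitSigma
  split_ifs with hc
  · obtain ⟨k, hk⟩ := h hc.2
    exact sigma_eq_self_of_im_eq_zero (one_le_norm_exp_pi hL) (exp_pi_im_of_int hk)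
  · rfl

/-- The two arcs next to a sector end come from |z| = 1; they meet the `nearSlit` intervals at
integral heights at most. -/
theorem slitSigma_eq_exp {L : ℂ} {j : ℕ} (hL : 0 ≤ L.re) (h1 : (sectorEnd n M j : ℝ) - 1 ≤ L.im)
    (h2 : L.im ≤ sectorEnd n M j + 1) : slitSigma n M L = Complex.exp (Real.pi * L) := by
  refine slitSigma_eq_exp_of hL ?_
  rintro ⟨i, -, h3, h4⟩
  rcases lt_or_ge i j with hij | hij
  · have : (sectorEnd n M (i + 1) : ℝ) ≤ sectorEnd n M j := by
      exact_mod_cast sectorEnd_mono (show i + 1 ≤ j by lia)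
    exact ⟨(sectorEnd n M j : ℤ) - 1, by push_cast; linarith⟩
  · have : (sectorEnd n M j : ℝ) ≤ sectorEnd n M i := by
      exact_mod_cast sectorEnd_mono hij
    exact ⟨(sectorEnd n M j : ℤ) + 1, by push_cast; linarith⟩

/-- Outside the lunes σ is the identity, so both branches of the definition agree there. -/
theorem slitSigma_eq_sigma {L : ℂ} (hL : 0 ≤ L.re) (h : nearSlit n M L.im) :
    slitSigma n M L = sigma (Complex.exp (Real.pi * L)) := by
  unfold slitSigma
  split_ifs with hc
  · rfl
  · symm
    apply sigma_eq_self
    have h1 := one_le_norm_exp_pi hL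
    by_contra hlt
    exact hc ⟨⟨h1, (not_le.1 hlt).le⟩, h⟩

/-- The intervals in `nearSlit` have integral ends, so membership is constant between consecutive
integers. -/
theorem nearSlit_of_floor_eq {b b' : ℝ} (h : ⌊b⌋ = ⌊b'⌋) (hb : ∀ k : ℤ, b ≠ k)
    (hs : nearSlit n M b) : nearSlit n M b' := by
  obtain ⟨j, hj, h1, h2⟩ := hs
  refine ⟨j, hj, ?_, ?_⟩
  · have : (sectorEnd n M j : ℤ) + 1 ≤ ⌊b⌋ := by
      rw [Int.le_floor]; push_cast; exact h1
    rw [h, Int.le_floor] at this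
    push_cast at this
    exact this
  · have h3 : b < ((sectorEnd n M (j + 1) : ℤ) - 1 : ℤ) :=
      lt_of_le_of_ne (by push_cast; exact h2) (hb _)
    rw [← Int.floor_lt, h, Int.floor_lt] at h3
    push_cast at h3
    exact h3.le

theorem sigma_exp_injOn (b : ℝ) :
    Set.InjOn (fun L : ℂ => sigma (Complex.exp (Real.pi * L))) {L | 0 < L.re ∧ |L.im - b| < 1} := by
  rintro L ⟨h1, h2⟩ L' ⟨h1', h2'⟩ h
  rcases sigma_eq_sigma (one_lt_norm_exp_pi h1).le (one_lt_norm_exp_pi h1').le h with h3 | ⟨h3, -⟩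
  · exact exp_pi_injOn b h2 h2' h3
  · exact absurd h3 (one_lt_norm_exp_pi h1).ne'

/-- The lunes meet the real axis only in |P| = 1. So if Re L₀ > 0 and exp (π L₀) lies in the lunes,
the height of L₀ is not an integer and `nearSlit` is locally constant; off the lunes the map is the
exponential. -/
theorem exists_injOn_slitSigma {L₀ : ℂ} (h : 0 < L₀.re) :
    ∃ N ∈ 𝓝 L₀, Set.InjOn (slitSigma n M) N := by
  have hpos : {L : ℂ | 0 < L.re} ∈ 𝓝 L₀ :=
    (isOpen_lt continuous_const Complex.continuous_re).mem_nhds h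
  have hN := inter_mem hpos (mem_nhds_im_sub_lt L₀)
  have hexp : ∀ K ∈ 𝓝 L₀, (∀ L ∈ K, slitSigma n M L = Complex.exp (Real.pi * L)) →
      ∃ N ∈ 𝓝 L₀, Set.InjOn (slitSigma n M) N := by
    intro K hK hKe
    refine ⟨_, inter_mem hK (mem_nhds_im_sub_lt L₀), ?_⟩
    intro L hL L' hL' hLL'
    rw [hKe L hL.1, hKe L' hL'.1] at hLL'
    exact exp_pi_injOn _ hL.2 hL'.2 hLL'
  by_cases hl : Complex.exp (Real.pi * L₀) ∈ lunes
  · have hint : ∀ k : ℤ, L₀.im ≠ k := by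
      intro k hk
      have h1 := hl.2
      rw [exp_pi_im_of_int hk, abs_zero] at h1
      have h2 := one_lt_norm_exp_pi h
      nlinarith
    have hfl : {L : ℂ | ⌊L.im⌋ = ⌊L₀.im⌋} ∈ 𝓝 L₀ := by
      have h1 : (⌊L₀.im⌋ : ℝ) < L₀.im := lt_of_le_of_ne (Int.floor_le _) (hint _).symm
      have h2 := Int.lt_floor_add_one L₀.im
      filter_upwards [Complex.continuous_im.continuousAt.eventually (lt_mem_nhds h1),
        Complex.continuous_im.continuousAt.eventually (gt_mem_nhds h2)] with L h3 h4
      exact Int.floor_eq_iff.2 ⟨le_of_lt h3, h4⟩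
    have hne : {L : ℂ | ∀ k : ℤ, L.im ≠ k} ∈ 𝓝 L₀ := by
      have h1 : (⌊L₀.im⌋ : ℝ) < L₀.im := lt_of_le_of_ne (Int.floor_le _) (hint _).symm
      filter_upwards [hfl, Complex.continuous_im.continuousAt.eventually (lt_mem_nhds h1)]
        with L h2 h3 k hk
      have h4 : ⌊L.im⌋ = k := by rw [hk, Int.floor_intCast]
      rw [← h2, h4, hk] at h3
      exact lt_irrefl _ h3
    by_cases hs : nearSlit n M L₀.im
    · refine ⟨_, inter_mem hN hfl, ?_⟩
      have he : ∀ L ∈ ({L : ℂ | 0 < L.re} ∩ {L' : ℂ | |L'.im - L₀.im| < 1}) ∩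
          {L : ℂ | ⌊L.im⌋ = ⌊L₀.im⌋}, slitSigma n M L = sigma (Complex.exp (Real.pi * L)) := by
        intro L hL
        exact slitSigma_eq_sigma (le_of_lt hL.1.1) (nearSlit_of_floor_eq hL.2.symm hint hs)
      intro L hL L' hL' hLL'
      rw [he L hL, he L' hL'] at hLL'
      exact sigma_exp_injOn _ hL.1 hL'.1 hLL'
    · refine hexp _ (inter_mem hpos (inter_mem hfl hne)) fun L hL => ?_
      exact slitSigma_eq_exp_of (le_of_lt hL.1) fun h =>
        absurd (nearSlit_of_floor_eq hL.2.1 hL.2.2 h) hs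
  · have hcl : {L : ℂ | Complex.exp (Real.pi * L) ∉ lunes} ∈ 𝓝 L₀ :=
      (isClosed_lunes.preimage continuous_exp_pi).isOpen_compl.mem_nhds hl
    refine hexp _ hcl fun L hL => ?_
    rw [slitSigma, if_neg fun h => hL h.1]

/-- Near the heights 0 and 2 M, both of them sector ends, σ has no effect. -/
theorem slitSigma_add_period {L : ℂ} (hn : 1 ≤ n) (hL : 0 ≤ L.re) (h : |L.im| < 1) :
    slitSigma n M (L + 2 * M * Complex.I) = slitSigma n M L := by
  rw [abs_lt] at h
  have him : (L + 2 * M * Complex.I).im = L.im + 2 * M := by simp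
  rw [slitSigma_eq_exp (j := 0) hL (by rw [sectorEnd_zero]; push_cast; linarith)
    (by rw [sectorEnd_zero]; push_cast; linarith),
    slitSigma_eq_exp (j := n) (by simpa using hL)
    (by rw [sectorEnd_self hn, him]; push_cast; linarith)
    (by rw [sectorEnd_self hn, him]; push_cast; linarith)]
  have e : (Real.pi : ℂ) * (L + 2 * M * Complex.I) =
      Real.pi * L + M * (2 * Real.pi * Complex.I) := by ring
  rw [e]
  exact Complex.exp_periodic.nat_mul M _

/-- For Im w₀ = 0 the points below the axis are moved up by the period; the assumed limit keeps the
height of L below 1 in absolute value, where `slitSigma_add_period` applies. -/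
theorem eventually_logMap_eq (hn : 1 ≤ n) (hM : n < M) {w₀ : ℂ} (h0 : 0 ≤ w₀.im)
    (h1 : w₀.im < 2 * n) {S : Set ℂ} (hS : ∀ w ∈ S, 0 ≤ w.re)
    (hl : w₀.im = 0 → Tendsto (extLog n M) (𝓝[S] w₀) (𝓝 (annulusLog n M w₀)) ∧
      (annulusLog n M w₀).im = 0) :
    ∀ᶠ w in 𝓝[S] w₀, logMap n M w = slitSigma n M (extLog n M w) := by
  have hnr : (1 : ℝ) ≤ n := by exact_mod_cast hn
  have e1 : ∀ᶠ w : ℂ in 𝓝[S] w₀, w.im < 2 * n := eventually_im_lt h1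
  have e2 : ∀ᶠ w : ℂ in 𝓝[S] w₀, -1 < w.im := eventually_lt_im (by linarith)
  have hmem : ∀ᶠ w : ℂ in 𝓝[S] w₀, w ∈ S := eventually_mem_nhdsWithin
  have hpos : ∀ w : ℂ, 0 ≤ w.re → 0 ≤ w.im → w.im < 2 * n →
      logMap n M w = slitSigma n M (extLog n M w) := by
    intro w hx hy hy'
    rw [logMap_eq_slitSigma hn hM hx hy hy', extLog, if_pos hy]
  rcases h0.eq_or_lt with h | h
  · obtain ⟨h2, h3⟩ := hl h.symm
    have e3 : ∀ᶠ w in 𝓝[S] w₀, |(extLog n M w).im| < 1 := by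
      exact (Complex.continuous_im.abs.continuousAt.tendsto.comp h2).eventually_lt_const
        (by rw [h3]; simp)
    filter_upwards [e1, e2, e3, hmem] with w a1 a2 a3 a4
    by_cases hw : 0 ≤ w.im
    · exact hpos w (hS w a4) hw a1
    · have hx := hS w a4
      have hre := extLog_re_nonneg hn hM hx a2 a1
      rw [← slitSigma_add_period hn hre a3, ← logMap_add_period hn, extLog, if_neg hw,
        sub_add_cancel]
      exact logMap_eq_slitSigma hn hM (by simpa using hx) (by rw [add_period_im]; linarith)
        (by rw [add_period_im]; linarith)
  · filter_upwards [e1, eventually_lt_im h, hmem] with w a1 a2 a4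
    exact hpos w (hS w a4) a2.le a1

end

/-! ### Local injectivity at the points that are not listed. -/

section
variable {n M : ℕ}

theorem annulusLog_re_eq_zero (hn : 1 ≤ n) (hM : n < M) {w : ℂ} {j : ℕ} (hx : 0 ≤ w.re)
    (h1 : 2 * j ≤ w.im) (h2 : w.im < 2 * j + 2) (h : (annulusLog n M w).re = 0) :
    w.re = 0 ∨ (w.im = 2 * j + 1 ∧ w.re ≤ 1 / 2 ∧ 2 ≤ sectorMult n M j) := by
  have hρ := ratio_pos hn hM
  rcases le_or_gt w.re 1 with hx1 | hx1
  · rcases le_or_gt w.im (2 * j + 1) with hy | hy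
    · rw [annulusLog_low hn hM hx hx1 h1 hy] at h
      exact rowLog_re_eq_zero (by linarith) hx hy h
    · rw [annulusLog_high hn hM hx hx1 hy h2, Complex.conj_re] at h
      rcases rowLog_re_eq_zero (by linarith) (by simpa using hx)
        (by rw [Complex.conj_im]; linarith) h with h3 | ⟨h3, -⟩
      · exact Or.inl (by simpa using h3)
      · rw [Complex.conj_im] at h3
        linarith
  · rw [annulusLog, if_neg (not_le.2 hx1), Complex.re_ofReal_mul] at h
    nlinarith

theorem annulusLog_left_low (hn : 1 ≤ n) (hM : n < M) {w : ℂ} {j : ℕ} (hx : w.re = 0)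
    (h1 : 2 * j ≤ w.im) (h2 : w.im ≤ 2 * j + 1) :
    annulusLog n M w = ⟨0, sectorEnd n M j + (w.im - 2 * j)⟩ := by
  rw [annulusLog_low hn hM hx.ge (by rw [hx]; norm_num) h1 h2,
    rowLog_left (sectorMult_pos hn hM j) hx h1 h2]

theorem annulusLog_left_high (hn : 1 ≤ n) (hM : n < M) {w : ℂ} {j : ℕ} (hx : w.re = 0)
    (h1 : 2 * j + 1 < w.im) (h2 : w.im < 2 * j + 2) :
    annulusLog n M w = ⟨0, sectorEnd n M (j + 1) - (2 * j + 2 - w.im)⟩ := by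
  rw [annulusLog_high hn hM hx.ge (by rw [hx]; norm_num) h1 h2,
    rowLog_left (sectorMult_pos hn hM j) (by simpa using hx) (by rw [Complex.conj_im]; linarith)
      (by rw [Complex.conj_im]; linarith), sectorEnd_succ]
  apply Complex.ext
  · simp
  · simp only [Complex.conj_im]
    push_cast
    ring

theorem annulusLog_slit (hn : 1 ≤ n) (hM : n < M) {w : ℂ} {j : ℕ} (hq : 2 ≤ sectorMult n M j)
    (hx0 : 0 ≤ w.re) (hx : w.re ≤ 1 / 2) (h : w.im = 2 * j + 1) :
    annulusLog n M w = ⟨0, sectorEnd n M j + 1 + 2 * (sectorMult n M j - 1) * w.re⟩ := by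
  rw [annulusLog_low hn hM hx0 (by linarith) (by linarith) h.le, rowLog_slit hq h hx hx0]

theorem exists_injOn_of_re_neg (hn : 1 ≤ n) {w₀ : ℂ} (h : w₀.re < 0) :
    ∃ N ∈ 𝓝 w₀, Set.InjOn (logMap n M) N := by
  refine ⟨_, inter_mem ((isOpen_lt Complex.continuous_re continuous_const).mem_nhds h)
    (mem_nhds_im_sub_lt w₀), ?_⟩
  intro w hw w' hw' hww
  rw [logMap_of_re_neg hn hw.1, logMap_of_re_neg hn hw'.1] at hww
  exact exp_pi_injOn _ hw.2 hw'.2 hww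

theorem exists_injOn_of_one_lt_re (hn : 1 ≤ n) (hM : n < M) {w₀ : ℂ} (h : 1 < w₀.re) :
    ∃ N ∈ 𝓝 w₀, Set.InjOn (logMap n M) N := by
  have hρ : ((M / n : ℝ) : ℂ) ≠ 0 := by
    exact_mod_cast (zero_lt_one.trans (ratio_pos hn hM)).ne'
  have hc : Continuous fun w : ℂ => ((M / n : ℝ) : ℂ) * w := by fun_prop
  refine ⟨_, inter_mem ((isOpen_lt continuous_const Complex.continuous_re).mem_nhds h)
    (hc.continuousAt (mem_nhds_im_sub_lt _)), ?_⟩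
  intro w hw w' hw' hww
  rw [logMap_of_one_lt hn hw.1, logMap_of_one_lt hn hw'.1] at hww
  exact mul_left_cancel₀ hρ (exp_pi_injOn _ hw.2 hw'.2 hww)

theorem eventually_mem_domain {w₀ : ℂ} {S : Set ℂ} (hS : ∀ w ∈ S, 0 ≤ w.re) (h0 : 0 ≤ w₀.im)
    (h1 : w₀.im < 2 * n) :
    ∀ᶠ w in 𝓝[S] w₀, w ∈ {w : ℂ | 0 ≤ w.re ∧ -1 < w.im ∧ w.im < 2 * n} := by
  have e2 : ∀ᶠ w : ℂ in 𝓝[S] w₀, -1 < w.im := eventually_lt_im (by linarith)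
  have e1 : ∀ᶠ w : ℂ in 𝓝[S] w₀, w.im < 2 * n := eventually_im_lt h1
  have hmem : ∀ᶠ w : ℂ in 𝓝[S] w₀, w ∈ S := eventually_mem_nhdsWithin
  filter_upwards [e1, e2, hmem] with w a1 a2 a3 using ⟨hS w a3, a2, a1⟩

theorem annulusLog_im_of_im_eq_zero (hn : 1 ≤ n) (hM : n < M) {w : ℂ} (hx0 : 0 ≤ w.re)
    (hx : w.re ≤ 1) (h : w.im = 0) : (annulusLog n M w).im = 0 := by
  rw [annulusLog_low (j := 0) hn hM hx0 hx (by simp [h]) (by simp [h])]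
  have h2 := lowerRowLog_bottom (n := n) (M := M) (j := 0) hx0 hx (by simp [h])
  rw [lowerRowLog] at h2
  rw [h2, sectorEnd_zero]
  simp

/-- Off the slits, inside the annulus or on its outer boundary. -/
theorem exists_injOn_of_annulusLog_re_pos (hn : 1 ≤ n) (hM : n < M) {w₀ : ℂ} {j : ℕ} (hj : j < n)
    (hx0 : 0 < w₀.re) (hx : w₀.re ≤ 1) (h1 : 2 * j ≤ w₀.im) (h2 : w₀.im < 2 * j + 2)
    (hslit : w₀.im = 2 * j + 1 → 2 ≤ sectorMult n M j → 1 / 2 ≤ w₀.re)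
    (hpos : 0 < (annulusLog n M w₀).re) :
    ∃ N ∈ 𝓝 w₀, Set.InjOn (logMap n M) N := by
  have hj' : (j : ℝ) + 1 ≤ n := by exact_mod_cast hj
  have hj0 : (0 : ℝ) ≤ j := by positivity
  have ht := tendsto_extLog hn hM hj hx0.le hx h1 h2 hslit
  have hnhds : 𝓝[{w : ℂ | 0 ≤ w.re}] w₀ = 𝓝 w₀ :=
    nhdsWithin_eq_nhds.2 (mem_of_superset ((isOpen_lt continuous_const
      Complex.continuous_re).mem_nhds hx0) fun w hw =>
        (show 0 ≤ w.re from le_of_lt (show 0 < w.re from hw)))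
  have e1 := eventually_logMap_eq hn hM (by linarith) (by linarith)
    (S := {w : ℂ | 0 ≤ w.re}) (fun w hw => hw)
    fun h => ⟨ht, annulusLog_im_of_im_eq_zero hn hM hx0.le hx h⟩
  have e2 := eventually_mem_domain (n := n) (w₀ := w₀) (S := {w : ℂ | 0 ≤ w.re}) (fun w hw => hw)
    (by linarith) (by linarith)
  rw [hnhds] at ht e1 e2
  obtain ⟨N, hN, hinj⟩ := exists_injOn_slitSigma (n := n) (M := M) hpos
  refine ⟨_, inter_mem (ht hN) (inter_mem e1 e2), ?_⟩
  rintro w ⟨hw1, hw2, hw3⟩ w' ⟨hw1', hw2', hw3'⟩ hww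
  rw [show logMap n M w = _ from hw2, show logMap n M w' = _ from hw2'] at hww
  exact extLog_injOn hn hM hw3 hw3' (hinj hw1 hw1' hww)

/-- On the inner boundary of the annulus, off the slits. -/
theorem exists_injOn_of_re_eq_zero (hn : 1 ≤ n) (hM : n < M) {w₀ : ℂ} {j : ℕ} (hj : j < n)
    (hx0 : w₀.re = 0) (h1 : 2 * j ≤ w₀.im) (h2 : w₀.im < 2 * j + 2)
    (hslit : w₀.im = 2 * j + 1 → ¬ 2 ≤ sectorMult n M j) :
    ∃ N ∈ 𝓝 w₀, Set.InjOn (logMap n M) N := by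
  have hj' : (j : ℝ) + 1 ≤ n := by exact_mod_cast hj
  have hj0 : (0 : ℝ) ≤ j := by positivity
  have ht := tendsto_extLog hn hM hj hx0.ge (by rw [hx0]; norm_num) h1 h2
    fun h h' => absurd h' (hslit h)
  have e1 := eventually_logMap_eq hn hM (by linarith) (by linarith)
    (S := {w : ℂ | 0 ≤ w.re}) (fun w hw => hw)
    fun h => ⟨ht, annulusLog_im_of_im_eq_zero hn hM hx0.ge (by rw [hx0]; norm_num) h⟩
  have e2 := eventually_mem_domain (n := n) (w₀ := w₀) (S := {w : ℂ | 0 ≤ w.re}) (fun w hw => hw)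
    (by linarith) (by linarith)
  have hnear : ∀ᶠ L : ℂ in 𝓝 (annulusLog n M w₀), 0 ≤ L.re →
      slitSigma n M L = Complex.exp (Real.pi * L) := by
    have key : ∀ i : ℕ, (sectorEnd n M i : ℝ) - 1 < (annulusLog n M w₀).im →
        (annulusLog n M w₀).im < sectorEnd n M i + 1 → ∀ᶠ L : ℂ in 𝓝 (annulusLog n M w₀), 0 ≤ L.re →
          slitSigma n M L = Complex.exp (Real.pi * L) := by
      intro i a1 a2
      have b1 := eventually_lt_im (S := Set.univ) a1
      have b2 := eventually_im_lt (S := Set.univ) a2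
      rw [nhdsWithin_univ] at b1 b2
      filter_upwards [b1, b2] with L c1 c2 c3 using slitSigma_eq_exp c3 c1.le c2.le
    rcases lt_trichotomy w₀.im (2 * j + 1) with hy | hy | hy
    · rw [annulusLog_left_low hn hM hx0 h1 hy.le] at key ⊢
      exact key j (by simp only; linarith) (by simp only; linarith)
    -- For q = 1 the sector has only two arcs, one next to each of its ends, so σ is not used on
    -- either side of the middle.
    · have hq : sectorMult n M j = 1 := by
        have := hslit hy
        have := sectorMult_pos hn hM j
        lia
      have hs : (sectorEnd n M (j + 1) : ℝ) = sectorEnd n M j + 2 := by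
        rw [sectorEnd_succ, hq]
        push_cast
        ring
      rw [annulusLog_left_low hn hM hx0 h1 hy.le, hy]
      have b1 := eventually_lt_im (S := Set.univ) (w₀ := ⟨0, sectorEnd n M j + (2 * j + 1 - 2 * j)⟩)
        (a := sectorEnd n M j) (by simp only; linarith)
      have b2 := eventually_im_lt (S := Set.univ) (w₀ := ⟨0, sectorEnd n M j + (2 * j + 1 - 2 * j)⟩)
        (a := sectorEnd n M j + 2) (by simp only; linarith)
      rw [nhdsWithin_univ] at b1 b2
      filter_upwards [b1, b2] with L c1 c2 c3
      rcases le_total L.im (sectorEnd n M j + 1) with hL | hL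
      · exact slitSigma_eq_exp c3 (by linarith) hL
      · exact slitSigma_eq_exp (j := j + 1) c3 (by rw [hs]; linarith) (by rw [hs]; linarith)
    · rw [annulusLog_left_high hn hM hx0 hy h2] at key ⊢
      exact key (j + 1) (by simp only; linarith) (by simp only; linarith)
  have hright : ∃ N ∈ 𝓝 w₀, ∀ w ∈ N, 0 ≤ w.re → w ∈ {w : ℂ | 0 ≤ w.re ∧ -1 < w.im ∧ w.im < 2 * n} ∧
      |(extLog n M w).im - (annulusLog n M w₀).im| < 1 ∧
      logMap n M w = Complex.exp (Real.pi * extLog n M w) := by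
    have e3 := ht.eventually hnear
    have e4 := ht (mem_nhds_im_sub_lt _)
    have e5 : ∀ᶠ w in 𝓝[{w : ℂ | 0 ≤ w.re}] w₀,
        w ∈ {w : ℂ | 0 ≤ w.re ∧ -1 < w.im ∧ w.im < 2 * n} ∧
        |(extLog n M w).im - (annulusLog n M w₀).im| < 1 ∧
        logMap n M w = Complex.exp (Real.pi * extLog n M w) := by
      filter_upwards [e1, e2, e3, e4] with w a1 a2 a3 a4
      exact ⟨a2, a4, a1.trans (a3 (extLog_re_nonneg hn hM a2.1 a2.2.1 a2.2.2))⟩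
    exact ⟨_, eventually_nhdsWithin_iff.1 e5, fun w hw hx => hw hx⟩
  obtain ⟨N, hN, hNr⟩ := hright
  refine ⟨_, inter_mem hN (mem_nhds_im_sub_lt w₀), ?_⟩
  -- The values have modulus less than 1 on Re w < 0 and at least 1 on Re w ≥ 0.
  have hne : ∀ w ∈ N, ∀ w' : ℂ, 0 ≤ w.re → w'.re < 0 → logMap n M w ≠ logMap n M w' := by
    intro w hw w' hx hx' h
    obtain ⟨a1, a2, a3⟩ := hNr w hw hx
    have hre := extLog_re_nonneg hn hM a1.1 a1.2.1 a1.2.2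
    have h3 := one_le_norm_exp_pi hre
    rw [← a3, h, logMap_of_re_neg hn hx', norm_exp_pi_mul, Real.one_le_exp_iff] at h3
    nlinarith [Real.pi_pos]
  rintro w ⟨hw1, hw2⟩ w' ⟨hw1', hw2'⟩ hww
  rcases lt_or_ge w.re 0 with hx | hx <;> rcases lt_or_ge w'.re 0 with hx' | hx'
  · rw [logMap_of_re_neg hn hx, logMap_of_re_neg hn hx'] at hww
    exact exp_pi_injOn _ hw2 hw2' hww
  · exact absurd hww.symm (hne w' hw1' w hx' hx)
  · exact absurd hww (hne w hw1 w' hx hx')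
  · obtain ⟨a1, a2, a3⟩ := hNr w hw1 hx
    obtain ⟨b1, b2, b3⟩ := hNr w' hw1' hx'
    rw [a3, b3] at hww
    exact extLog_injOn hn hM a1 b1 (exp_pi_injOn _ a2 b2 hww)

theorem conj_exp_pi (L : ℂ) :
    (starRingEnd ℂ) (Complex.exp (Real.pi * L)) = Complex.exp (Real.pi * (starRingEnd ℂ) L) := by
  rw [← Complex.exp_conj, map_mul, Complex.conj_ofReal]

/-- At the end of the slit inside the annulus. -/
theorem exists_injOn_tip (hn : 1 ≤ n) (hM : n < M) {w₀ : ℂ} {j : ℕ} (hj : j < n)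
    (hx0 : w₀.re = 1 / 2) (hy : w₀.im = 2 * j + 1) (hq : 2 ≤ sectorMult n M j) :
    ∃ N ∈ 𝓝 w₀, Set.InjOn (logMap n M) N := by
  have hj' : (j : ℝ) + 1 ≤ n := by exact_mod_cast hj
  have hj0 : (0 : ℝ) ≤ j := by positivity
  have hq' : (2 : ℝ) ≤ sectorMult n M j := by exact_mod_cast hq
  have hpos : 0 < w₀.re := by rw [hx0]; norm_num
  have hnhds : 𝓝[{w : ℂ | 0 ≤ w.re}] w₀ = 𝓝 w₀ :=
    nhdsWithin_eq_nhds.2 (mem_of_superset ((isOpen_lt continuous_const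
      Complex.continuous_re).mem_nhds hpos) fun w hw =>
        (show 0 ≤ w.re from le_of_lt (show 0 < w.re from hw)))
  have ht := tendsto_extLog hn hM hj (by rw [hx0]; norm_num) (by rw [hx0]; norm_num)
    (by linarith) (by linarith) fun _ _ => hx0.ge
  have e2 := eventually_mem_domain (n := n) (w₀ := w₀) (S := {w : ℂ | 0 ≤ w.re}) (fun w hw => hw)
    (by linarith) (by linarith)
  have e1 := eventually_logMap_eq hn hM (by linarith) (by linarith)
    (S := {w : ℂ | 0 ≤ w.re}) (fun w hw => hw) fun h => by linarith
  rw [hnhds] at ht e1 e2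
  obtain ⟨a, ha⟩ := even_sectorEnd (n := n) (M := M) j
  have hb : annulusLog n M w₀ = ⟨0, (2 * a + sectorMult n M j : ℕ)⟩ := by
    rw [annulusLog_slit hn hM hq (by rw [hx0]; norm_num) hx0.le hy, hx0, ha]
    push_cast
    congr 1
    ring
  rw [hb] at ht
  have e3 : ∀ᶠ w in 𝓝 w₀, |(extLog n M w).im - (2 * a + sectorMult n M j : ℕ)| < 1 :=
    ht (mem_nhds_im_sub_lt _)
  have e4 : ∀ᶠ w : ℂ in 𝓝 w₀, 0 < w.re ∧ 2 * j < w.im ∧ w.im < 2 * j + 2 := by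
    have b1 := eventually_lt_im (S := Set.univ) (w₀ := w₀) (a := 2 * j) (by linarith)
    have b2 := eventually_im_lt (S := Set.univ) (w₀ := w₀) (a := 2 * j + 2) (by linarith)
    have b3 := eventually_lt_re (S := Set.univ) hpos
    rw [nhdsWithin_univ] at b1 b2 b3
    filter_upwards [b1, b2, b3] with w c1 c2 c3 using ⟨c3, c1, c2⟩
  refine ⟨_, inter_mem e1 (inter_mem e2 (inter_mem e3 e4)), ?_⟩
  have hval : ∀ w ∈ {w : ℂ | 0 ≤ w.re ∧ -1 < w.im ∧ w.im < 2 * n},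
      |(extLog n M w).im - (2 * a + sectorMult n M j : ℕ)| < 1 →
      slitSigma n M (extLog n M w) = sigma (Complex.exp (Real.pi * extLog n M w)) := by
    intro w hw h
    refine slitSigma_eq_sigma (extLog_re_nonneg hn hM hw.1 hw.2.1 hw.2.2) ⟨j, hj, ?_, ?_⟩
    · rw [abs_lt] at h
      rw [ha]
      push_cast at h ⊢
      linarith
    · rw [abs_lt] at h
      rw [sectorEnd_succ, ha]
      push_cast at h ⊢
      linarith
  -- A point of the slit carries the value of the lower side, whose height is at most that of the
  -- end of the slit.
  have hslit : ∀ w : ℂ, 0 < w.re → 2 * (j : ℝ) < w.im → w.im < 2 * j + 2 → (extLog n M w).re = 0 →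
      (extLog n M w).im ≤ (2 * a + sectorMult n M j : ℕ) := by
    intro w c1 c2 c3 hre
    rw [extLog, if_pos (by linarith)] at hre ⊢
    rcases annulusLog_re_eq_zero hn hM c1.le c2.le c3 hre with h | ⟨h, h', -⟩
    · linarith
    · rw [annulusLog_slit hn hM hq c1.le h' h, ha]
      push_cast
      nlinarith
  rintro w ⟨hw1, hw2, hw3, c1, c2, c3⟩ w' ⟨hw1', hw2', hw3', c1', c2', c3'⟩ hww
  replace hw3 : |(extLog n M w).im - (2 * a + sectorMult n M j : ℕ)| < 1 := hw3
  replace hw3' : |(extLog n M w').im - (2 * a + sectorMult n M j : ℕ)| < 1 := hw3'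
  have hr := extLog_re_nonneg hn hM hw2.1 hw2.2.1 hw2.2.2
  have hr' := extLog_re_nonneg hn hM hw2'.1 hw2'.2.1 hw2'.2.2
  rw [show logMap n M w = _ from hw1, show logMap n M w' = _ from hw1', hval w hw2 hw3,
    hval w' hw2' hw3'] at hww
  refine extLog_injOn hn hM hw2 hw2' ?_
  rcases sigma_eq_sigma (one_le_norm_exp_pi hr) (one_le_norm_exp_pi hr') hww with h | ⟨h, h'⟩
  · exact exp_pi_injOn _ hw3 hw3' h
  · have hz := norm_exp_pi_eq_one h
    have hz' : (extLog n M w').re = 0 := by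
      apply norm_exp_pi_eq_one
      rw [h']
      simpa using h
    have hle := hslit w c1 c2 c3 hz
    have hle' := hslit w' c1' c2' c3' hz'
    -- If the values of exp (π L) are conjugate on the unit circle, the two points are reflections
    -- of each other in the height of the end of the slit; neither lies above it, so they have the
    -- same height.
    have key : extLog n M w' = (starRingEnd ℂ) (extLog n M w) +
        (2 * a + sectorMult n M j : ℕ) * 2 * Complex.I := by
      refine exp_pi_injOn _ hw3' ?_ ?_
      · show |((starRingEnd ℂ) (extLog n M w) +
          (2 * a + sectorMult n M j : ℕ) * 2 * Complex.I).im - (2 * a + sectorMult n M j : ℕ)| < 1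
        have : ((starRingEnd ℂ) (extLog n M w) +
          (2 * a + sectorMult n M j : ℕ) * 2 * Complex.I).im - (2 * a + sectorMult n M j : ℕ) =
          -((extLog n M w).im - (2 * a + sectorMult n M j : ℕ)) := by
          simp
          ring
        rw [this, abs_neg]
        exact hw3
      · beta_reduce
        rw [h', conj_exp_pi]
        have e : (Real.pi : ℂ) * ((starRingEnd ℂ) (extLog n M w) +
            (2 * a + sectorMult n M j : ℕ) * 2 * Complex.I) =
            Real.pi * (starRingEnd ℂ) (extLog n M w) +
              (2 * a + sectorMult n M j : ℕ) * (2 * Real.pi * Complex.I) := by ring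
        rw [e]
        exact (Complex.exp_periodic.nat_mul _ _).symm
    have him := congrArg Complex.im key
    have him' : (extLog n M w').im = -(extLog n M w).im + 2 * (2 * a + sectorMult n M j : ℕ) := by
      rw [him]
      simp
      ring
    apply Complex.ext
    · rw [hz, hz']
    · linarith

/-- At the interior points of the slit which are not listed. -/
theorem exists_injOn_slit (hn : 1 ≤ n) (hM : n < M) {w₀ : ℂ} {j : ℕ} (hj : j < n)
    (hx0 : 0 < w₀.re) (hx : w₀.re < 1 / 2) (hy : w₀.im = 2 * j + 1) (hq : 2 ≤ sectorMult n M j)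
    (hint : (Complex.exp (Real.pi * annulusLog n M w₀)).im ≠ 0) :
    ∃ N ∈ 𝓝 w₀, Set.InjOn (logMap n M) N := by
  have hj' : (j : ℝ) + 1 ≤ n := by exact_mod_cast hj
  have hj0 : (0 : ℝ) ≤ j := by positivity
  have hq' : (2 : ℝ) ≤ sectorMult n M j := by exact_mod_cast hq
  -- The sign of Im exp (π L) relative to s tells the two sides of the slit apart.
  set s := (Complex.exp (Real.pi * annulusLog n M w₀)).im with hs
  set b := (annulusLog n M w₀).im with hb
  have hlow0 : lowerRowLog n M j w₀ = annulusLog n M w₀ :=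
    (annulusLog_low hn hM hx0.le (by linarith) (by linarith) hy.le).symm
  have hbv : b = sectorEnd n M j + 1 + 2 * (sectorMult n M j - 1) * w₀.re := by
    rw [hb, annulusLog_slit hn hM hq hx0.le hx.le hy]
  have hupp0 : upperRowLog n M j w₀ =
      ⟨0, 2 * (sectorEnd n M j + sectorMult n M j) - b⟩ := by
    rw [upperRowLog, rowLog_slit hq (by rw [Complex.conj_im, hy]; ring) (by simpa using hx.le)
      (by simpa using hx0.le), Complex.conj_re, hbv]
    apply Complex.ext
    · simp
    · simp only [Complex.conj_im]
      ring
  obtain ⟨a, ha⟩ := even_sectorEnd (n := n) (M := M) j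
  have hconj : Complex.exp (Real.pi * upperRowLog n M j w₀) =
      (starRingEnd ℂ) (Complex.exp (Real.pi * annulusLog n M w₀)) := by
    have hal : annulusLog n M w₀ = ⟨0, b⟩ := by
      rw [hb, annulusLog_slit hn hM hq hx0.le hx.le hy]
    rw [hupp0, conj_exp_pi, hal]
    have e : (Real.pi : ℂ) * ⟨0, 2 * (sectorEnd n M j + sectorMult n M j) - b⟩ =
        Real.pi * (starRingEnd ℂ) ⟨0, b⟩ +
          (2 * a + sectorMult n M j : ℕ) * (2 * Real.pi * Complex.I) := by
      rw [ha]
      apply Complex.ext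
      · simp
      · simp
        ring
    rw [e]
    exact Complex.exp_periodic.nat_mul _ _
  have hb1 : (sectorEnd n M j : ℝ) + 1 < b := by
    rw [hbv]
    have := mul_pos (show (0 : ℝ) < 2 * (sectorMult n M j - 1) by linarith) hx0
    linarith
  have hb2 : b < sectorEnd n M j + sectorMult n M j := by
    rw [hbv]
    nlinarith
  have hss : 0 < s * s := mul_self_pos.2 hint
  -- the two sides of the slit
  have lower : ∀ᶠ w in 𝓝 w₀, |(lowerRowLog n M j w).im - b| < 1 ∧
      (sectorEnd n M j + 1 < (lowerRowLog n M j w).im ∧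
        (lowerRowLog n M j w).im < sectorEnd n M j + sectorMult n M j) ∧
      0 < (Complex.exp (Real.pi * lowerRowLog n M j w)).im * s := by
    have hc : Tendsto (lowerRowLog n M j) (𝓝 w₀) (𝓝 (annulusLog n M w₀)) := by
      rw [← hlow0]; exact (continuous_lowerRowLog j).tendsto _
    have hci := (Complex.continuous_im.tendsto _).comp hc
    have hce := ((Complex.continuous_im.comp continuous_exp_pi).mul_const s).tendsto _ |>.comp hc
    filter_upwards [hc (mem_nhds_im_sub_lt _), hci.eventually_const_lt hb1,
      hci.eventually_lt_const hb2, hce.eventually_const_lt hss] with w a1 a2 a3 a4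
    exact ⟨a1, ⟨a2, a3⟩, a4⟩
  have upper : ∀ᶠ w in 𝓝 w₀,
      |(upperRowLog n M j w).im - (2 * (sectorEnd n M j + sectorMult n M j) - b)| < 1 ∧
      (sectorEnd n M j + sectorMult n M j < (upperRowLog n M j w).im ∧
        (upperRowLog n M j w).im < sectorEnd n M j + 2 * sectorMult n M j - 1) ∧
      (Complex.exp (Real.pi * upperRowLog n M j w)).im * s < 0 := by
    have hc : Tendsto (upperRowLog n M j) (𝓝 w₀) (𝓝 (upperRowLog n M j w₀)) :=
      (continuous_upperRowLog j).tendsto _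
    have hci := (Complex.continuous_im.tendsto _).comp hc
    have hce := ((Complex.continuous_im.comp continuous_exp_pi).mul_const s).tendsto _ |>.comp hc
    have h1 : (sectorEnd n M j : ℝ) + sectorMult n M j < (upperRowLog n M j w₀).im := by
      rw [hupp0]; simp only; linarith
    have h2 : (upperRowLog n M j w₀).im < sectorEnd n M j + 2 * sectorMult n M j - 1 := by
      rw [hupp0]; simp only; linarith
    have h3 : (Complex.exp (Real.pi * upperRowLog n M j w₀)).im * s < 0 := by
      rw [hconj, Complex.conj_im]
      linarith
    have h4 := hc (mem_nhds_im_sub_lt _)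
    rw [hupp0] at h4
    filter_upwards [h4, hci.eventually_const_lt h1,
      hci.eventually_lt_const h2, hce.eventually_lt_const h3] with w a1 a2 a3 a4
    exact ⟨a1, ⟨a2, a3⟩, a4⟩
  have e4 : ∀ᶠ w : ℂ in 𝓝 w₀, (0 < w.re ∧ w.re < 1 / 2) ∧ 2 * (j : ℝ) < w.im ∧ w.im < 2 * j + 2 := by
    have b1 := eventually_lt_im (S := Set.univ) (w₀ := w₀) (a := 2 * j) (by linarith)
    have b2 := eventually_im_lt (S := Set.univ) (w₀ := w₀) (a := 2 * j + 2) (by linarith)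
    have b3 := eventually_lt_re (S := Set.univ) hx0
    have b4 := eventually_re_lt (S := Set.univ) hx
    rw [nhdsWithin_univ] at b1 b2 b3 b4
    filter_upwards [b1, b2, b3, b4] with w c1 c2 c3 c4 using ⟨⟨c3, c4⟩, c1, c2⟩
  refine ⟨_, inter_mem e4 (inter_mem lower upper), ?_⟩
  have hval : ∀ w : ℂ, 0 < w.re → 2 * (j : ℝ) < w.im → w.im < 2 * j + 2 →
      (sectorEnd n M j : ℝ) + 1 ≤ (annulusLog n M w).im →
      (annulusLog n M w).im ≤ sectorEnd n M j + 2 * sectorMult n M j - 1 →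
      logMap n M w = sigma (Complex.exp (Real.pi * annulusLog n M w)) := by
    intro w c1 c2 c3 c4 c5
    rw [logMap_eq_slitSigma hn hM c1.le (by linarith) (by linarith)]
    refine slitSigma_eq_sigma (annulusLog_re_nonneg hn hM c1.le (by linarith) (by linarith))
      ⟨j, hj, c4, ?_⟩
    rw [sectorEnd_succ]
    push_cast
    exact c5
  -- the value of `logMap`, and the side of the slit, at a nearby point
  have hside : ∀ w : ℂ, ((0 < w.re ∧ w.re < 1 / 2) ∧ 2 * (j : ℝ) < w.im ∧ w.im < 2 * j + 2) →
      (|(lowerRowLog n M j w).im - b| < 1 ∧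
      (sectorEnd n M j + 1 < (lowerRowLog n M j w).im ∧
        (lowerRowLog n M j w).im < sectorEnd n M j + sectorMult n M j) ∧
      0 < (Complex.exp (Real.pi * lowerRowLog n M j w)).im * s) →
      (|(upperRowLog n M j w).im - (2 * (sectorEnd n M j + sectorMult n M j) - b)| < 1 ∧
      (sectorEnd n M j + sectorMult n M j < (upperRowLog n M j w).im ∧
        (upperRowLog n M j w).im < sectorEnd n M j + 2 * sectorMult n M j - 1) ∧
      (Complex.exp (Real.pi * upperRowLog n M j w)).im * s < 0) →
      logMap n M w = sigma (Complex.exp (Real.pi * annulusLog n M w)) ∧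
      ((0 < (Complex.exp (Real.pi * annulusLog n M w)).im * s ∧
        |(annulusLog n M w).im - b| < 1) ∨
      ((Complex.exp (Real.pi * annulusLog n M w)).im * s < 0 ∧
        |(annulusLog n M w).im - (2 * (sectorEnd n M j + sectorMult n M j) - b)| < 1 ∧
        0 < (annulusLog n M w).re)) := by
    rintro w ⟨⟨c1, c2⟩, c3, c4⟩ ⟨l1, ⟨l2, l3⟩, l4⟩ ⟨u1, ⟨u2, u3⟩, u4⟩
    rcases le_or_gt w.im (2 * j + 1) with hw | hw
    · have h := annulusLog_low hn hM c1.le (by linarith) c3.le hw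
      rw [← lowerRowLog] at h
      refine ⟨hval w c1 c3 c4 (by rw [h]; exact l2.le) (by rw [h]; linarith), Or.inl ?_⟩
      rw [h]
      exact ⟨l4, l1⟩
    · have h := annulusLog_high hn hM c1.le (by linarith) hw c4
      rw [← upperRowLog] at h
      refine ⟨hval w c1 c3 c4 (by rw [h]; linarith) (by rw [h]; linarith), Or.inr ?_⟩
      have hre : 0 < (annulusLog n M w).re := by
        refine lt_of_le_of_ne (annulusLog_re_nonneg hn hM c1.le (by linarith) (by linarith)) ?_
        intro h0
        rcases annulusLog_re_eq_zero hn hM c1.le c3.le c4 h0.symm with h1 | ⟨h1, -⟩ <;> linarith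
      rw [h] at hre ⊢
      exact ⟨u4, u1, hre⟩
  rintro w ⟨hw1, hw2, hw3⟩ w' ⟨hw1', hw2', hw3'⟩ hww
  obtain ⟨v, hv⟩ := hside w hw1 hw2 hw3
  obtain ⟨v', hv'⟩ := hside w' hw1' hw2' hw3'
  obtain ⟨⟨c1, -⟩, c3, c4⟩ := hw1
  obtain ⟨⟨c1', -⟩, c3', c4'⟩ := hw1'
  have hr := annulusLog_re_nonneg hn hM c1.le (by linarith) (show w.im < 2 * n by linarith)
  have hr' := annulusLog_re_nonneg hn hM c1'.le (by linarith) (show w'.im < 2 * n by linarith)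
  rw [v, v'] at hww
  refine annulusLog_injOn hn hM ⟨c1.le, by linarith, by linarith⟩
    ⟨c1'.le, by linarith, by linarith⟩ ?_
  rcases sigma_eq_sigma (one_le_norm_exp_pi hr) (one_le_norm_exp_pi hr') hww with h | ⟨h, h'⟩
  · rcases hv with ⟨d1, d2⟩ | ⟨d1, d2, -⟩ <;> rcases hv' with ⟨d1', d2'⟩ | ⟨d1', d2', -⟩
    · exact exp_pi_injOn _ d2 d2' h
    · rw [h] at d1; linarith
    · rw [h] at d1; linarith
    · exact exp_pi_injOn _ d2 d2' h
  -- Conjugate points on the unit circle. The upper side, which does not contain the slit itself, is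
  -- excluded by Re L = 0; on the lower side conjugation would reverse the sign.
  · have hz := norm_exp_pi_eq_one h
    have hz' : (annulusLog n M w').re = 0 := by
      apply norm_exp_pi_eq_one
      rw [h']
      simpa using h
    rcases hv with ⟨d1, d2⟩ | ⟨d1, d2, d3⟩
    · rcases hv' with ⟨d1', d2'⟩ | ⟨d1', d2', d3'⟩
      · rw [h', Complex.conj_im] at d1'
        linarith
      · linarith
    · linarith

end

/-! ### Multiplicity 2 at the listed points. -/

theorem exp_pi_add_even (L : ℂ) (a : ℤ) :
    Complex.exp (Real.pi * (L + (2 * a : ℤ) * Complex.I)) = Complex.exp (Real.pi * L) := by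
  have e : (Real.pi : ℂ) * (L + (2 * a : ℤ) * Complex.I) =
      Real.pi * L + a * (2 * Real.pi * Complex.I) := by
    push_cast
    ring
  rw [e]
  exact Complex.exp_periodic.int_mul a _

theorem exp_pi_int (b : ℤ) : Complex.exp (Real.pi * (b * Complex.I)) = (-1) ^ b := by
  rw [show (Real.pi : ℂ) * (b * Complex.I) = b * (Real.pi * Complex.I) by ring,
    Complex.exp_int_mul, Complex.exp_pi_mul_I]

/-- The sign of `Im exp (π L)` near the line `Im L = 2 a + 1`. -/
theorem exp_pi_im_sign {L : ℂ} {a : ℤ} (h : |L.im - (2 * a + 1)| < 1) :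
    (0 ≤ (Complex.exp (Real.pi * L)).im ↔ L.im ≤ 2 * a + 1) ∧
      ((Complex.exp (Real.pi * L)).im ≤ 0 ↔ 2 * a + 1 ≤ L.im) := by
  rw [abs_lt] at h
  have hpi := Real.pi_pos
  have he := Real.exp_pos (Real.pi * L.re)
  have hs : Real.sin (Real.pi * L.im) = -Real.sin (Real.pi * (L.im - (2 * a + 1))) := by
    rw [show Real.pi * L.im =
      Real.pi * (L.im - (2 * a + 1)) + Real.pi + a * (2 * Real.pi) by ring,
      Real.sin_add_int_mul_two_pi, Real.sin_add_pi]
  rw [exp_pi_im, hs]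
  rcases lt_trichotomy L.im (2 * a + 1) with h1 | h1 | h1
  · have h2 : Real.sin (Real.pi * (L.im - (2 * a + 1))) < 0 :=
      Real.sin_neg_of_neg_of_neg_pi_lt (by nlinarith) (by nlinarith)
    constructor
    · exact iff_of_true (mul_nonneg he.le (by linarith)) h1.le
    · exact iff_of_false (not_le.2 (mul_pos he (by linarith))) (not_le.2 h1)
  · rw [h1]
    simp
  · have h2 : 0 < Real.sin (Real.pi * (L.im - (2 * a + 1))) :=
      Real.sin_pos_of_pos_of_lt_pi (by nlinarith) (by nlinarith)
    constructor
    · exact iff_of_false (not_le.2 (mul_neg_of_pos_of_neg he (by linarith))) (not_le.2 h1)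
    · exact iff_of_true (mul_nonpos_of_nonneg_of_nonpos he.le (by linarith)) h1.le

/-- At an integral base height the factor that normalizes the sheet is a sign. -/
theorem sheet_eq_of_int {ρ : ℝ} {q : ℕ} {e k x₀ : ℝ} {b : ℤ} (hb : e + 1 + 2 * (q - 1) * x₀ = b)
    (w : ℂ) : sheet ρ q e k x₀ w = -(-1) ^ b * Complex.exp (Real.pi * rowLog ρ q e k w) := by
  have e1 : (⟨0, (b : ℝ)⟩ : ℂ) = b * Complex.I := by
    apply Complex.ext <;> simp
  rw [sheet, hb, e1, mul_sub, Complex.exp_sub, exp_pi_int]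
  rcases Int.even_or_odd b with h | h
  · rw [h.neg_one_zpow]; simp
  · rw [h.neg_one_zpow]; ring

section
variable {n M : ℕ}

/-- `sheet` on the lower half of a sector. -/
theorem sheet_lower {j l : ℕ} {x₀ : ℝ} (hl : 2 * ((sectorMult n M j : ℝ) - 1) * x₀ = l) (w : ℂ) :
    sheet (M / n) (sectorMult n M j) (sectorEnd n M j) j x₀ w =
      (-1) ^ l * Complex.exp (Real.pi * lowerRowLog n M j w) := by
  obtain ⟨a, ha⟩ := even_sectorEnd (n := n) (M := M) j
  rw [sheet_eq_of_int (b := 2 * a + 1 + l) (by rw [hl, ha]; push_cast; ring), lowerRowLog]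
  congr 1
  rw [zpow_add₀ (by norm_num), zpow_add₀ (by norm_num), zpow_mul]
  simp

/-- The conjugate of `sheet` on the upper half of a sector. -/
theorem sheet_upper {j l : ℕ} {x₀ : ℝ} (hl : 2 * ((sectorMult n M j : ℝ) - 1) * x₀ = l) (w : ℂ) :
    (starRingEnd ℂ) (sheet (M / n) (sectorMult n M j) (-(sectorEnd n M j + 2 * sectorMult n M j))
      (-(j + 1)) x₀ ((starRingEnd ℂ) w)) =
      (-1) ^ l * Complex.exp (Real.pi * upperRowLog n M j w) := by
  obtain ⟨a, ha⟩ := even_sectorEnd (n := n) (M := M) j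
  rw [sheet_eq_of_int (b := 2 * (-(a + sectorMult n M j)) + 1 + l)
    (by rw [hl, ha]; push_cast; ring), map_mul, conj_exp_pi, upperRowLog]
  congr 1
  rw [zpow_add₀ (by norm_num), zpow_add₀ (by norm_num), zpow_mul]
  simp

theorem nearSlit_of_lt {j : ℕ} (hj : j < n) {b : ℝ} (h1 : (sectorEnd n M j : ℝ) + 1 ≤ b)
    (h2 : b ≤ sectorEnd n M j + 2 * sectorMult n M j - 1) : nearSlit n M b := by
  refine ⟨j, hj, h1, ?_⟩
  rw [sectorEnd_succ]
  push_cast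
  exact h2

theorem logMap_lower (hn : 1 ≤ n) (hM : n < M) {j : ℕ} (hj : j < n) {w : ℂ} (hx0 : 0 ≤ w.re)
    (hx : w.re ≤ 1) (h1 : 2 * j ≤ w.im) (h2 : w.im ≤ 2 * j + 1) :
    logMap n M w = slitSigma n M (lowerRowLog n M j w) ∧ 0 ≤ (lowerRowLog n M j w).re := by
  have hj' : (j : ℝ) + 1 ≤ n := by exact_mod_cast hj
  have hj0 : (0 : ℝ) ≤ j := by positivity
  rw [lowerRowLog, ← annulusLog_low hn hM hx0 hx h1 h2]
  exact ⟨logMap_eq_slitSigma hn hM hx0 (by linarith) (by linarith),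
    annulusLog_re_nonneg hn hM hx0 (by linarith) (by linarith)⟩

theorem logMap_upper (hn : 1 ≤ n) (hM : n < M) {j : ℕ} (hj : j < n) {w : ℂ} (hx0 : 0 ≤ w.re)
    (hx : w.re ≤ 1) (h1 : 2 * j + 1 < w.im) (h2 : w.im < 2 * j + 2) :
    logMap n M w = slitSigma n M (upperRowLog n M j w) ∧ 0 ≤ (upperRowLog n M j w).re := by
  have hj' : (j : ℝ) + 1 ≤ n := by exact_mod_cast hj
  have hj0 : (0 : ℝ) ≤ j := by positivity
  rw [upperRowLog, ← annulusLog_high hn hM hx0 hx h1 h2]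
  exact ⟨logMap_eq_slitSigma hn hM hx0 (by linarith) (by linarith),
    annulusLog_re_nonneg hn hM hx0 (by linarith) (by linarith)⟩

/-- The heights over the two sides of the slit add up to the even integer 2 (e + q), and the real
parts vanish. -/
theorem exp_lower_slit {j : ℕ} (hq : 2 ≤ sectorMult n M j) {w : ℂ} (hx0 : 0 ≤ w.re)
    (hx : w.re ≤ 1 / 2) (h : w.im = 2 * j + 1) :
    Complex.exp (Real.pi * upperRowLog n M j w) =
      (starRingEnd ℂ) (Complex.exp (Real.pi * lowerRowLog n M j w)) ∧
    ‖Complex.exp (Real.pi * lowerRowLog n M j w)‖ = 1 ∧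
    (lowerRowLog n M j w).im = sectorEnd n M j + 1 + 2 * (sectorMult n M j - 1) * w.re := by
  have h1 : lowerRowLog n M j w =
      ⟨0, sectorEnd n M j + 1 + 2 * (sectorMult n M j - 1) * w.re⟩ := rowLog_slit hq h hx hx0
  obtain ⟨a, ha⟩ := even_sectorEnd (n := n) (M := M) j
  refine ⟨?_, ?_, by rw [h1]⟩
  · have h2 : upperRowLog n M j w = (starRingEnd ℂ) (lowerRowLog n M j w) +
        (2 * (2 * a + sectorMult n M j) : ℤ) * Complex.I := by
      rw [upperRowLog, rowLog_slit hq (by rw [Complex.conj_im, h]; ring) (by simpa using hx)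
        (by simpa using hx0), Complex.conj_re, h1, ha]
      apply Complex.ext
      · simp
      · simp
        ring
    rw [h2, exp_pi_add_even, conj_exp_pi]
  · rw [norm_exp_pi_mul, h1]
    simp

theorem eventually_slit {w₀ : ℂ} {j : ℕ} (hx : w₀.re < 1 / 2) (hy : w₀.im = 2 * j + 1) :
    ∀ᶠ w : ℂ in 𝓝 w₀, 2 * (j : ℝ) < w.im ∧ w.im < 2 * j + 2 ∧ w.re < 1 / 2 := by
  have b1 := eventually_lt_im (S := Set.univ) (w₀ := w₀) (a := 2 * j) (by linarith)
  have b2 := eventually_im_lt (S := Set.univ) (w₀ := w₀) (a := 2 * j + 2) (by linarith)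
  have b4 := eventually_re_lt (S := Set.univ) hx
  rw [nhdsWithin_univ] at b1 b2 b4
  filter_upwards [b1, b2, b4] with w c1 c2 c3 using ⟨c1, c2, c3⟩

theorem eventually_rowLog_im {j : ℕ} (hq : 2 ≤ sectorMult n M j) {w₀ : ℂ} (hx0 : 0 ≤ w₀.re)
    (hx : w₀.re ≤ 1 / 2) (h : w₀.im = 2 * j + 1) :
    (∀ᶠ w in 𝓝 w₀, |(lowerRowLog n M j w).im -
      (sectorEnd n M j + 1 + 2 * (sectorMult n M j - 1) * w₀.re)| < 1) ∧
    ∀ᶠ w in 𝓝 w₀, |(upperRowLog n M j w).im -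
      (sectorEnd n M j + 2 * sectorMult n M j - 1 - 2 * (sectorMult n M j - 1) * w₀.re)| < 1 := by
  have h1 : lowerRowLog n M j w₀ =
      ⟨0, sectorEnd n M j + 1 + 2 * (sectorMult n M j - 1) * w₀.re⟩ := rowLog_slit hq h hx hx0
  have h2 : (upperRowLog n M j w₀).im =
      sectorEnd n M j + 2 * sectorMult n M j - 1 - 2 * (sectorMult n M j - 1) * w₀.re := by
    rw [upperRowLog, rowLog_slit hq (by rw [Complex.conj_im, h]; ring) (by simpa using hx)
        (by simpa using hx0), Complex.conj_re]
    simp only [Complex.conj_im]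
    ring
  constructor
  · have := (continuous_lowerRowLog (n := n) (M := M) j).tendsto w₀ (mem_nhds_im_sub_lt _)
    rw [h1] at this
    exact this
  · have := (continuous_upperRowLog (n := n) (M := M) j).tendsto w₀ (mem_nhds_im_sub_lt _)
    rw [h2] at this
    exact this

/-- The end of the slit on the inner circle is a simple branched point. -/
theorem hasLocalMultiplicity_logMap_corner (hn : 1 ≤ n) (hM : n < M) {j : ℕ} (hj : j < n)
    (hq : 2 ≤ sectorMult n M j) : HasLocalMultiplicity (logMap n M) ⟨0, 2 * j + 1⟩ 2 := by
  have hq' : (2 : ℝ) ≤ sectorMult n M j := by exact_mod_cast hq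
  have hj' : (j : ℝ) + 1 ≤ n := by exact_mod_cast hj
  have hj0 : (0 : ℝ) ≤ j := by positivity
  have hρ := ratio_pos hn hM
  obtain ⟨a, ha⟩ := even_sectorEnd (n := n) (M := M) j
  have hl : 2 * ((sectorMult n M j : ℝ) - 1) * 0 = (0 : ℕ) := by simp
  obtain ⟨e1, e2⟩ := eventually_rowLog_im (n := n) (M := M) (w₀ := ⟨0, 2 * j + 1⟩) hq le_rfl
    (by norm_num) rfl
  have e3 := eventually_slit (w₀ := ⟨0, 2 * j + 1⟩) (j := j) (by norm_num) rfl
  simp only [mul_zero, add_zero, sub_zero] at e1 e2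
  have hae : (sectorEnd n M j : ℝ) + 1 = 2 * (a : ℤ) + 1 := by rw [ha]; push_cast; ring
  have hae' : (sectorEnd n M j : ℝ) + 2 * sectorMult n M j - 1 =
      2 * (a + sectorMult n M j - 1 : ℤ) + 1 := by rw [ha]; push_cast; ring
  refine hasLocalMultiplicity_slit_corner (ρ := M / n) (e := sectorEnd n M j) hq (by linarith)
    ?_ ?_ ?_
  · filter_upwards [e1, e3] with w h1 ⟨h3, h4, h5⟩ hx hy
    obtain ⟨v1, v2⟩ := logMap_lower hn hM hj hx (by linarith) h3.le hy
    rw [hae] at h1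
    obtain ⟨s1, s2⟩ := exp_pi_im_sign h1
    rw [sheet_lower hl, pow_zero, one_mul, s1, s2, v1, ← hae]
    rw [← hae, abs_lt] at h1
    exact ⟨fun h => slitSigma_eq_exp v2 (by linarith) h,
      fun h => slitSigma_eq_sigma v2 (nearSlit_of_lt hj h (by linarith))⟩
  · filter_upwards [e1, e2, e3] with w h1 h2 ⟨h3, h4, h5⟩ hx hy
    have hs : ∀ z : ℂ, z.im = -((starRingEnd ℂ) z).im := fun z => by simp
    rw [hs, sheet_upper hl, pow_zero, one_mul, neg_nonneg, neg_nonpos]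
    -- On the slit itself the map is evaluated from below; σ does not distinguish this from the
    -- conjugate value above.
    rcases hy.eq_or_lt with hy | hy
    · obtain ⟨v1, v2⟩ := logMap_lower hn hM hj hx (by linarith) h3.le hy.ge
      obtain ⟨u1, u2, u3⟩ := exp_lower_slit hq hx h5.le hy.symm
      have hb : (sectorEnd n M j : ℝ) + 1 ≤ (lowerRowLog n M j w).im := by
        rw [u3]
        have := mul_nonneg (show (0 : ℝ) ≤ 2 * (sectorMult n M j - 1) by linarith) hx
        linarith
      have hsig : logMap n M w = sigma (Complex.exp (Real.pi * upperRowLog n M j w)) := by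
        rw [u1, sigma_conj_of_norm_eq_one u2, v1]
        rw [abs_lt] at h1
        exact slitSigma_eq_sigma v2 (nearSlit_of_lt hj hb (by linarith))
      -- On the slit the branch without σ occurs only at a real value, which σ fixes.
      refine ⟨fun h => ?_, fun _ => hsig⟩
      rw [hsig]
      rw [hae] at h1
      have h6 := (exp_pi_im_sign h1).2.2 (by rw [← hae]; exact hb)
      refine sigma_eq_self_of_im_eq_zero ?_ (le_antisymm h ?_)
      · rw [u1, Complex.norm_conj, u2]
      · rw [u1, Complex.conj_im]
        linarith
    · obtain ⟨v1, v2⟩ := logMap_upper hn hM hj hx (by linarith) hy h4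
      rw [hae'] at h2
      obtain ⟨s1, s2⟩ := exp_pi_im_sign h2
      rw [s1, s2, v1, ← hae']
      rw [← hae', abs_lt] at h2
      refine ⟨fun h => slitSigma_eq_exp (j := j + 1) v2 ?_ ?_,
        fun h => slitSigma_eq_sigma v2 (nearSlit_of_lt hj (by linarith) h)⟩
      · rw [sectorEnd_succ]; push_cast; linarith
      · rw [sectorEnd_succ]; push_cast; linarith
  · filter_upwards [e3] with w ⟨h3, h4, h5⟩ hx
    have e4 : -Complex.exp (Real.pi * (w - ⟨0, 2 * j + 1⟩)) = Complex.exp (Real.pi * w) := by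
      have e5 : (⟨0, 2 * (j : ℝ) + 1⟩ : ℂ) = ((2 * j + 1 : ℤ) : ℂ) * Complex.I := by
        apply Complex.ext <;> simp
      rw [e5, mul_sub, Complex.exp_sub, exp_pi_int, Odd.neg_one_zpow ⟨j, rfl⟩]
      ring
    rw [e4]
    rcases hx.lt_or_eq with hx | hx
    · exact logMap_of_re_neg hn hx
    · rw [logMap_eq_slitSigma hn hM hx.ge (by linarith) (by linarith)]
      rcases le_or_gt w.im (2 * j + 1) with hy | hy
      · rw [annulusLog_left_low hn hM hx h3.le hy, slitSigma_eq_exp (j := j) le_rfl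
          (by simp only; linarith) (by simp only; linarith), ← exp_pi_add_even w (a - j)]
        congr 2
        rw [ha]
        apply Complex.ext
        · simp [hx]
        · simp; ring
      · rw [annulusLog_left_high hn hM hx hy h4, slitSigma_eq_exp (j := j + 1) le_rfl
          (by simp only; linarith) (by simp only; linarith),
          ← exp_pi_add_even w (a + sectorMult n M j - j - 1)]
        congr 2
        rw [sectorEnd_succ, ha]
        apply Complex.ext
        · simp [hx]
        · simp; ring

theorem sigma_sign {P : ℂ} (hP : 1 ≤ ‖P‖) (l : ℕ) : sigma ((-1) ^ l * P) = (-1) ^ l * sigma P := by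
  rcases neg_one_pow_eq_or ℂ l with h | h
  · rw [h, one_mul, one_mul]
  · rw [h, neg_one_mul, neg_one_mul, sigma_neg hP]

/-- The interior points of the slit that are sent to `±1` are simple branched points. -/
theorem hasLocalMultiplicity_logMap_slit (hn : 1 ≤ n) (hM : n < M) {j l : ℕ} (hj : j < n)
    (hq : 2 ≤ sectorMult n M j) {x₀ : ℝ} (hx0 : 0 < x₀) (hx : x₀ < 1 / 2)
    (hl : 2 * ((sectorMult n M j : ℝ) - 1) * x₀ = l) :
    HasLocalMultiplicity (logMap n M) ⟨x₀, 2 * j + 1⟩ 2 := by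
  have hq' : (2 : ℝ) ≤ sectorMult n M j := by exact_mod_cast hq
  have hρ := ratio_pos hn hM
  obtain ⟨e1, e2⟩ := eventually_rowLog_im (n := n) (M := M) (w₀ := ⟨x₀, 2 * j + 1⟩) hq hx0.le
    hx.le rfl
  have e3 := eventually_slit (w₀ := ⟨x₀, 2 * j + 1⟩) (j := j) hx rfl
  have e4 : ∀ᶠ w in 𝓝 (⟨x₀, 2 * j + 1⟩ : ℂ), 0 < w.re :=
    continuousAt_const.eventually_lt Complex.continuous_re.continuousAt hx0
  simp only [hl] at e1 e2
  have hl1 : (1 : ℝ) ≤ l := by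
    have : (0 : ℝ) < l := by rw [← hl]; apply mul_pos _ hx0; linarith
    exact_mod_cast this
  have hl2 : (l : ℝ) + 2 ≤ sectorMult n M j := by
    have : (l : ℝ) < ((sectorMult n M j - 1 : ℤ) : ℝ) := by
      rw [← hl]; push_cast; nlinarith
    have : (l : ℤ) < sectorMult n M j - 1 := by exact_mod_cast this
    have : (l : ℤ) + 2 ≤ sectorMult n M j := by lia
    exact_mod_cast this
  -- The factor (-1) ^ l moves the value to -1, where the sheets are normalized; it passes through σ
  -- because σ is odd.
  have key : HasLocalMultiplicity (fun w => (-1) ^ l * logMap n M w) ⟨x₀, 2 * j + 1⟩ 2 := by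
    refine hasLocalMultiplicity_slit (ρ := M / n) (e := sectorEnd n M j) hq (by linarith) hx0 hx
      ?_ ?_
    · filter_upwards [e1, e3, e4] with w h1 ⟨h3, h4, h5⟩ h6 hy
      obtain ⟨v1, v2⟩ := logMap_lower hn hM hj h6.le (by linarith) h3.le hy
      rw [abs_lt] at h1
      rw [sheet_lower hl, sigma_sign (one_le_norm_exp_pi v2), v1,
        slitSigma_eq_sigma v2 (nearSlit_of_lt hj (by linarith) (by linarith))]
    · filter_upwards [e1, e2, e3, e4] with w h1 h2 ⟨h3, h4, h5⟩ h6 hy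
      rw [abs_lt] at h1 h2
      rw [sheet_upper hl]
      rcases hy.eq_or_lt with hy | hy
      · obtain ⟨v1, v2⟩ := logMap_lower hn hM hj h6.le (by linarith) h3.le hy.ge
        obtain ⟨u1, u2, -⟩ := exp_lower_slit hq h6.le h5.le hy.symm
        rw [u1, sigma_sign (by rw [Complex.norm_conj, u2]), sigma_conj_of_norm_eq_one u2, v1,
          slitSigma_eq_sigma v2 (nearSlit_of_lt hj (by linarith) (by linarith))]
      · obtain ⟨v1, v2⟩ := logMap_upper hn hM hj h6.le (by linarith) hy h4
        rw [sigma_sign (one_le_norm_exp_pi v2), v1,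
          slitSigma_eq_sigma v2 (nearSlit_of_lt hj (by linarith) (by linarith))]
  have hε : ((-1 : ℂ) ^ l) ≠ 0 := pow_ne_zero _ (by norm_num)
  have hεε : ((-1 : ℂ) ^ l) * (-1) ^ l = 1 := by rw [← mul_pow]; simp
  exact HasLocalMultiplicity.of_comp (h := id) hε (fun x => by
    rw [← mul_assoc, hεε, one_mul]; rfl) continuousAt_id IsOpenMap.id univ_mem
    (Set.injOn_id _) key

/-! ### Listed points, the local classification, and values on the slits. -/

/-- The points `(l + s) / (2 (q - 1)) + (2 j + 1) i` of the slits. -/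
def IsListed (n M : ℕ) (s : ℝ) (w : ℂ) : Prop :=
  ∃ j l : ℕ, j < n ∧ l + 2 ≤ sectorMult n M j ∧
    w = ⟨(l + s) / (2 * (sectorMult n M j - 1)), 2 * j + 1⟩

theorem hasLocalMultiplicity_logMap_of_isListed (hn : 1 ≤ n) (hM : n < M) {w : ℂ}
    (h : IsListed n M 0 w) : HasLocalMultiplicity (logMap n M) w 2 := by
  obtain ⟨j, l, hj, hl, rfl⟩ := h
  have hq : (l : ℝ) + 2 ≤ sectorMult n M j := by exact_mod_cast hl
  have hl0 : (0 : ℝ) ≤ l := by positivity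
  rcases Nat.eq_zero_or_pos l with rfl | hpos
  · simpa using hasLocalMultiplicity_logMap_corner hn hM hj (by lia)
  · have hd : (0 : ℝ) < 2 * (sectorMult n M j - 1) := by linarith
    have hpos' : (0 : ℝ) < l := by exact_mod_cast hpos
    rw [add_zero]
    refine hasLocalMultiplicity_logMap_slit hn hM (l := l) hj (by lia) (div_pos hpos' hd) ?_ ?_
    · rw [div_lt_iff₀ hd]; linarith
    · exact mul_div_cancel₀ _ hd.ne'

/-- On a slit with 0 ≤ Re w < 1/2, exp (π L) is real exactly at the listed points; the end Re w =
1/2 would have index l = q - 1 and is not listed. -/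
theorem exists_injOn_logMap (hn : 1 ≤ n) (hM : n < M) {w₀ : ℂ} (h0 : 0 ≤ w₀.im)
    (h1 : w₀.im < 2 * n) (h : ¬ IsListed n M 0 w₀) : ∃ N ∈ 𝓝 w₀, Set.InjOn (logMap n M) N := by
  rcases lt_or_ge w₀.re 0 with hx0 | hx0
  · exact exists_injOn_of_re_neg hn hx0
  rcases lt_or_ge 1 w₀.re with hx | hx
  · exact exists_injOn_of_one_lt_re hn hM hx
  obtain ⟨j, hj, j1, j2⟩ := exists_sector h0 h1
  by_cases hs : w₀.im = 2 * j + 1 ∧ 2 ≤ sectorMult n M j ∧ w₀.re ≤ 1 / 2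
  · obtain ⟨hy, hq, hx2⟩ := hs
    have hq' : (2 : ℝ) ≤ sectorMult n M j := by exact_mod_cast hq
    rcases hx2.eq_or_lt with hx3 | hx3
    · exact exists_injOn_tip hn hM hj hx3 hy hq
    have hd : (0 : ℝ) < 2 * (sectorMult n M j - 1) := by linarith
    have hlist : ∀ l : ℤ, 2 * ((sectorMult n M j : ℝ) - 1) * w₀.re = l → IsListed n M 0 w₀ := by
      intro l hl
      have hl0 : 0 ≤ l := by
        have : (0 : ℝ) ≤ l := by rw [← hl]; exact mul_nonneg hd.le hx0
        exact_mod_cast this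
      have hl1 : l < sectorMult n M j - 1 := by
        have : (l : ℝ) < ((sectorMult n M j - 1 : ℤ) : ℝ) := by
          rw [← hl]; push_cast; nlinarith
        exact_mod_cast this
      lift l to ℕ using hl0
      refine ⟨j, l, hj, by lia, Complex.ext ?_ hy⟩
      rw [add_zero, eq_div_iff hd.ne', mul_comm, hl]
      simp
    rcases hx0.eq_or_lt with hx4 | hx4
    · exact absurd (hlist 0 (by rw [← hx4]; simp)) h
    · refine exists_injOn_slit hn hM hj hx4 hx3 hy hq fun hz => h ?_
      rw [annulusLog_slit hn hM hq hx0 hx3.le hy, exp_pi_im] at hz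
      have hz2 := (mul_eq_zero.1 hz).resolve_left (Real.exp_pos _).ne'
      obtain ⟨k, hk⟩ := Real.sin_eq_zero_iff.1 hz2
      simp only at hk
      rw [mul_comm] at hk
      have hk2 := mul_left_cancel₀ Real.pi_pos.ne' hk
      exact hlist (k - sectorEnd n M j - 1) (by push_cast; linarith)
  · have hslit : w₀.im = 2 * j + 1 → 2 ≤ sectorMult n M j → 1 / 2 < w₀.re := fun a b =>
      not_le.1 fun c => hs ⟨a, b, c⟩
    rcases hx0.eq_or_lt with hx4 | hx4
    · refine exists_injOn_of_re_eq_zero hn hM hj hx4.symm j1 j2 fun a b => ?_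
      have := hslit a b
      linarith
    · refine exists_injOn_of_annulusLog_re_pos hn hM hj hx4 hx j1 j2
        (fun a b => (hslit a b).le) ?_
      refine lt_of_le_of_ne (annulusLog_re_nonneg hn hM hx0 h0 h1) fun h5 => ?_
      rcases annulusLog_re_eq_zero hn hM hx0 j1 j2 h5.symm with h6 | ⟨h6, h7, h8⟩
      · linarith
      · exact hs ⟨h6, h8, h7⟩

theorem isListed_im {s : ℝ} {w : ℂ} (h : IsListed n M s w) : 0 ≤ w.im ∧ w.im < 2 * n := by
  obtain ⟨j, l, hj, -, rfl⟩ := h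
  have hj' : (j : ℝ) + 1 ≤ n := by exact_mod_cast hj
  have hj0 : (0 : ℝ) ≤ j := by positivity
  constructor <;> simp only <;> linarith

/-- The values of `logMap` on the slits. -/
theorem logMap_slit (hn : 1 ≤ n) (hM : n < M) {w : ℂ} {j : ℕ} (hj : j < n)
    (hq : 2 ≤ sectorMult n M j) (hx0 : 0 ≤ w.re) (hx : w.re ≤ 1 / 2) (h : w.im = 2 * j + 1) :
    logMap n M w = sigma (-Complex.exp
      (Real.pi * ((2 * (sectorMult n M j - 1) * w.re : ℝ) * Complex.I))) := by
  have hq' : (2 : ℝ) ≤ sectorMult n M j := by exact_mod_cast hq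
  have hj' : (j : ℝ) + 1 ≤ n := by exact_mod_cast hj
  have hj0 : (0 : ℝ) ≤ j := by positivity
  obtain ⟨a, ha⟩ := even_sectorEnd (n := n) (M := M) j
  have h1 := mul_nonneg (show (0 : ℝ) ≤ 2 * (sectorMult n M j - 1) by linarith) hx0
  have h2 := mul_le_mul_of_nonneg_left hx (show (0 : ℝ) ≤ 2 * (sectorMult n M j - 1) by linarith)
  rw [logMap_eq_slitSigma hn hM hx0 (by linarith) (by linarith), annulusLog_slit hn hM hq hx0 hx h,
    slitSigma_eq_sigma le_rfl (nearSlit_of_lt hj (by simp only; linarith)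
      (by simp only; linarith))]
  congr 1
  have e : (⟨0, sectorEnd n M j + 1 + 2 * (sectorMult n M j - 1) * w.re⟩ : ℂ) =
      ((2 * (sectorMult n M j - 1) * w.re : ℝ) * Complex.I + ((1 : ℤ) : ℂ) * Complex.I) +
        (2 * a : ℤ) * Complex.I := by
    rw [ha]
    apply Complex.ext
    · simp
    · simp; ring
  rw [e, exp_pi_add_even, mul_add, Complex.exp_add, exp_pi_int]
  simp

theorem logMap_of_isListed (hn : 1 ≤ n) (hM : n < M) {j l : ℕ} (hj : j < n)
    (hl : l + 2 ≤ sectorMult n M j) :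
    logMap n M ⟨l / (2 * (sectorMult n M j - 1)), 2 * j + 1⟩ = (-1) ^ (l + 1) := by
  have hq : (l : ℝ) + 2 ≤ sectorMult n M j := by exact_mod_cast hl
  have hl0 : (0 : ℝ) ≤ l := by positivity
  have hd : (0 : ℝ) < 2 * (sectorMult n M j - 1) := by linarith
  rw [logMap_slit hn hM hj (by lia) (div_nonneg hl0 hd.le)
    (by simp only; rw [div_le_iff₀ hd]; linarith) rfl]
  simp only
  rw [mul_div_cancel₀ _ hd.ne']
  have := exp_pi_int l
  push_cast at this
  rw [Complex.ofReal_natCast, this, zpow_natCast, pow_succ, mul_neg_one]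
  apply sigma_eq_self_of_im_eq_zero
  · simp
  · rcases neg_one_pow_eq_or ℂ l with h | h <;> simp [h]

end

/-! ### Zeros, and the return from the logarithmic coordinate. -/

section
variable {n M : ℕ}

/-- The exponential does not vanish, so a zero comes from σ, which vanishes on |P| ≥ 1 only at P =
±i. On the arcs that come from |z| = 1 the map is the exponential; hence the point is on a slit and
2 (q - 1) Re w is half-integral. -/
theorem logMap_eq_zero_iff (hn : 1 ≤ n) (hM : n < M) {w : ℂ} (h0 : 0 ≤ w.im) (h1 : w.im < 2 * n) :
    logMap n M w = 0 ↔ IsListed n M (1 / 2) w := by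
  constructor
  · intro h
    rcases lt_or_ge w.re 0 with hx0 | hx0
    · rw [logMap_of_re_neg hn hx0] at h
      exact absurd h (Complex.exp_ne_zero _)
    obtain ⟨j, hj, j1, j2⟩ := exists_sector h0 h1
    have hs := logMap_eq_slitSigma hn hM hx0 h0 h1
    rw [h] at hs
    have hL := annulusLog_re_nonneg hn hM hx0 h0 h1
    have hre : (annulusLog n M w).re = 0 := by
      unfold slitSigma at hs
      split_ifs at hs
      · apply norm_exp_pi_eq_one
        rcases sigma_eq_zero (one_le_norm_exp_pi hL) hs.symm with h2 | h2 <;> simp [h2]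
      · exact absurd hs.symm (Complex.exp_ne_zero _)
    rcases annulusLog_re_eq_zero hn hM hx0 j1 j2 hre with hx | ⟨hy, hx, hq⟩
    · rcases le_or_gt w.im (2 * j + 1) with hy | hy
      · rw [annulusLog_left_low hn hM hx j1 hy, slitSigma_eq_exp (j := j) le_rfl
          (by simp only; linarith) (by simp only; linarith)] at hs
        exact absurd hs.symm (Complex.exp_ne_zero _)
      · rw [annulusLog_left_high hn hM hx hy j2, slitSigma_eq_exp (j := j + 1) le_rfl
          (by simp only; linarith) (by simp only; linarith)] at hs
        exact absurd hs.symm (Complex.exp_ne_zero _)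
    · have hq' : (2 : ℝ) ≤ sectorMult n M j := by exact_mod_cast hq
      have hd : (0 : ℝ) < 2 * (sectorMult n M j - 1) := by linarith
      rw [logMap_slit hn hM hj hq hx0 hx hy] at h
      set t : ℝ := 2 * (sectorMult n M j - 1) * w.re with ht
      have ht0 : 0 ≤ t := mul_nonneg hd.le hx0
      have ht1 : t ≤ sectorMult n M j - 1 := by rw [ht]; nlinarith
      have hexp : Complex.exp (Real.pi * ((t : ℂ) * Complex.I)) =
          Complex.exp (((Real.pi * t : ℝ) : ℂ) * Complex.I) := by
        push_cast
        ring_nf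
      have hcos : Real.cos (Real.pi * t) = 0 := by
        rw [← Complex.exp_ofReal_mul_I_re, ← hexp]
        have hnorm : 1 ≤ ‖-Complex.exp (Real.pi * ((t : ℂ) * Complex.I))‖ := by
          rw [hexp, norm_neg, Complex.norm_exp_ofReal_mul_I]
        rcases sigma_eq_zero hnorm h with h2 | h2
        · rw [neg_eq_iff_eq_neg.1 h2]; simp
        · rw [neg_inj.1 h2]; simp
      obtain ⟨k, hk⟩ := Real.cos_eq_zero_iff.1 hcos
      have hk2 : t = k + 1 / 2 := by
        apply mul_left_cancel₀ Real.pi_pos.ne'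
        rw [hk]
        ring
      have hk0 : 0 ≤ k := by
        have : ((-1 : ℤ) : ℝ) < k := by push_cast; linarith
        have : -1 < k := by exact_mod_cast this
        lia
      have hk1 : k < sectorMult n M j - 1 := by
        have : (k : ℝ) < ((sectorMult n M j - 1 : ℤ) : ℝ) := by push_cast; linarith
        exact_mod_cast this
      lift k to ℕ using hk0
      refine ⟨j, k, hj, by lia, Complex.ext ?_ hy⟩
      rw [eq_div_iff hd.ne', mul_comm, ← ht, hk2]
      simp
  · rintro ⟨j, l, hj, hl, rfl⟩
    have hq : (l : ℝ) + 2 ≤ sectorMult n M j := by exact_mod_cast hl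
    have hl0 : (0 : ℝ) ≤ l := by positivity
    have hd : (0 : ℝ) < 2 * (sectorMult n M j - 1) := by linarith
    rw [logMap_slit hn hM hj (by lia) (div_nonneg (by linarith) hd.le)
      (by simp only; rw [div_le_iff₀ hd]; linarith) rfl]
    simp only
    rw [mul_div_cancel₀ _ hd.ne']
    have h1 := exp_pi_int l
    push_cast at h1
    have e : -Complex.exp (Real.pi * (((l + 1 / 2 : ℝ) : ℂ) * Complex.I)) =
        (-1) ^ (l + 1) * Complex.I := by
      push_cast
      rw [add_mul, mul_add, Complex.exp_add, h1, zpow_natCast,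
        show (Real.pi : ℂ) * (1 / 2 * Complex.I) = Real.pi / 2 * Complex.I by ring,
        Complex.exp_pi_div_two_mul_I]
      ring
    rw [e, sigma_sign (by simp), sigma_I, mul_zero]

/-- The largest multiplier is that of the last sector, the ceiling of M/n, so the condition is t + 1
< M/n. -/
theorem exists_add_two_le_sectorMult (hn : 1 ≤ n) (t : ℕ) :
    (∃ j < n, t + 2 ≤ sectorMult n M j) ↔ n * (t + 1) < M := by
  have h1 := lowCount_add (M := M) hn
  have h2 := lowCount_pos (M := M) hn
  have h3 := lowCount_le (M := M) hn
  unfold sectorMult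
  constructor
  · rintro ⟨j, hj, h⟩
    split_ifs at h with hlow
    · have := Nat.mul_le_mul_left n (show t + 1 + 1 ≤ M / n by lia)
      rw [Nat.mul_add] at this
      lia
    · have := Nat.mul_le_mul_left n (show t + 1 ≤ M / n by lia)
      lia
  · intro h
    refine ⟨n - 1, by lia, ?_⟩
    split_ifs with hlow
    · have := Nat.lt_of_mul_lt_mul_left (show n * (t + 1) < n * (M / n) by lia)
      lia
    · have := Nat.lt_of_mul_lt_mul_left (show n * (t + 1) < n * (M / n + 1) by
        rw [Nat.mul_add n (M / n)]; lia)
      lia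

/-- The exponential that carries the logarithmic coordinate back to the plane. -/
noncomputable def expChart (n : ℕ) (r : ℝ) (w : ℂ) : ℂ :=
  r * Complex.exp ((Real.pi / n : ℝ) * w)

theorem interpolatingMap_mul {r : ℝ} (hr : 0 < r) (hM : n < M) (c z : ℂ) :
    interpolatingMap n M r c (r * z) = c * r ^ n * interpolatingMap n M 1 1 z := by
  have hr0 : (r : ℂ) ≠ 0 := by exact_mod_cast hr.ne'
  have hnorm : ‖(r : ℂ) * z‖ = r * ‖z‖ := by
    rw [norm_mul, Complex.norm_real, Real.norm_of_nonneg hr.le]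
  have h1 : r * ‖z‖ < r ↔ ‖z‖ < 1 := by
    rw [mul_lt_iff_lt_one_right hr]
  have h2 : r * ‖z‖ ≤ r * Real.exp (Real.pi / n) ↔ ‖z‖ ≤ 1 * Real.exp (Real.pi / n) := by
    rw [one_mul, mul_le_mul_iff_right₀ hr]
  unfold interpolatingMap
  simp only [hnorm, h1, h2]
  split_ifs
  · ring
  · rw [mul_div_cancel_left₀ _ hr0]
    simp
  · obtain ⟨d, rfl⟩ := Nat.exists_eq_add_of_lt hM
    rw [show n + d + 1 - n = d + 1 by lia]
    simp only [Complex.ofReal_one, one_pow, div_one, one_mul]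
    rw [div_eq_iff (pow_ne_zero _ hr0)]
    ring

theorem interpolatingMap_expChart {r : ℝ} (hr : 0 < r) (hM : n < M) (c w : ℂ) :
    interpolatingMap n M r c (expChart n r w) = c * r ^ n * logMap n M w :=
  interpolatingMap_mul hr hM c _

theorem continuous_expChart (n : ℕ) (r : ℝ) : Continuous (expChart n r) := by
  unfold expChart
  fun_prop

theorem isOpenMap_expChart (hn : 1 ≤ n) {r : ℝ} (hr : 0 < r) : IsOpenMap (expChart n r) := by
  have hr0 : (r : ℂ) ≠ 0 := by exact_mod_cast hr.ne'
  have hn0 : (0 : ℝ) < n := by positivity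
  have hk : ((Real.pi / n : ℝ) : ℂ) ≠ 0 := by exact_mod_cast (div_pos Real.pi_pos hn0).ne'
  refine isOpenMap_of_hasStrictDerivAt (f' := fun w => r * (Complex.exp ((Real.pi / n : ℝ) * w) *
    (Real.pi / n : ℝ))) (fun w => ?_)
    fun w => mul_ne_zero hr0 (mul_ne_zero (Complex.exp_ne_zero _) hk)
  have h1 : HasStrictDerivAt (fun w : ℂ => ((Real.pi / n : ℝ) : ℂ) * w) (Real.pi / n : ℝ) w := by
    simpa using (hasStrictDerivAt_id w).const_mul ((Real.pi / n : ℝ) : ℂ)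
  exact h1.cexp.const_mul _

theorem expChart_injOn (hn : 1 ≤ n) {r : ℝ} (hr : 0 < r) (b : ℝ) :
    Set.InjOn (expChart n r) {w | |w.im - b| < 1} := by
  have hr0 : (r : ℂ) ≠ 0 := by exact_mod_cast hr.ne'
  have hn1 : (1 : ℝ) ≤ n := by exact_mod_cast hn
  have hn0 : (n : ℂ) ≠ 0 := by
    have : n ≠ 0 := by lia
    exact_mod_cast this
  have key : ∀ w ∈ {w : ℂ | |w.im - b| < 1}, w / n ∈ {L : ℂ | |L.im - b / n| < 1} := by
    intro w hw
    have e : (w / n).im - b / n = (w.im - b) / n := by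
      rw [Complex.div_natCast_im, sub_div]
    have hw' : |w.im - b| < 1 := hw
    show |(w / n).im - b / n| < 1
    rw [e, abs_div, abs_of_pos (by linarith : (0 : ℝ) < n), div_lt_one (by linarith)]
    linarith
  intro w hw w' hw' h
  have h2 := mul_left_cancel₀ hr0 h
  have e : ∀ w : ℂ, ((Real.pi / n : ℝ) : ℂ) * w = Real.pi * (w / n) := by
    intro w
    push_cast
    ring
  rw [e, e] at h2
  have h3 := exp_pi_injOn _ (key w hw) (key w' hw') h2
  exact (div_left_inj' hn0).1 h3

theorem exists_expChart_eq (hn : 1 ≤ n) {r : ℝ} (hr : 0 < r) {z : ℂ} (hz : z ≠ 0) :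
    ∃ w : ℂ, 0 ≤ w.im ∧ w.im < 2 * n ∧ expChart n r w = z := by
  have hr0 : (r : ℂ) ≠ 0 := by exact_mod_cast hr.ne'
  have hn1 : (1 : ℝ) ≤ n := by exact_mod_cast hn
  have hn0 : (n : ℂ) ≠ 0 := by
    have : n ≠ 0 := by lia
    exact_mod_cast this
  have hpi : (Real.pi : ℂ) ≠ 0 := by exact_mod_cast Real.pi_pos.ne'
  have hz0 : z / r ≠ 0 := div_ne_zero hz hr0
  have hw : expChart n r ((n / Real.pi : ℝ) * Complex.log (z / r)) = z := by
    rw [expChart, ← mul_assoc]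
    have e : ((Real.pi / n : ℝ) : ℂ) * ((n / Real.pi : ℝ) : ℂ) = 1 := by
      push_cast
      field_simp
    rw [e, one_mul, Complex.exp_log hz0, mul_div_cancel₀ _ hr0]
  have him : ((n / Real.pi : ℝ) * Complex.log (z / r) : ℂ).im = n * ((z / r).arg / Real.pi) := by
    rw [Complex.im_ofReal_mul, Complex.log_im]
    ring
  have h1 : (z / r).arg / Real.pi ≤ 1 := (div_le_one Real.pi_pos).2 (Complex.arg_le_pi _)
  have h2 : -1 < (z / r).arg / Real.pi := by
    rw [lt_div_iff₀ Real.pi_pos]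
    linarith [Complex.neg_pi_lt_arg (z / r)]
  rcases le_or_gt 0 ((z / r).arg / Real.pi) with h | h
  · refine ⟨_, ?_, ?_, hw⟩
    · rw [him]; exact mul_nonneg (by linarith) h
    · rw [him]; nlinarith
  · refine ⟨(n / Real.pi : ℝ) * Complex.log (z / r) + 2 * n * Complex.I, ?_, ?_, ?_⟩
    · rw [add_period_im, him]; nlinarith
    · rw [add_period_im, him]; nlinarith
    · refine Eq.trans ?_ hw
      rw [expChart, expChart]
      congr 1
      have e : ((Real.pi / n : ℝ) : ℂ) * ((n / Real.pi : ℝ) * Complex.log (z / r) +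
          2 * n * Complex.I) = (Real.pi / n : ℝ) * ((n / Real.pi : ℝ) * Complex.log (z / r)) +
          2 * Real.pi * Complex.I := by
        push_cast
        field_simp
      rw [e, Complex.exp_periodic]

theorem HasLocalMultiplicity.expChart (hn : 1 ≤ n) (hM : n < M) {r : ℝ} (hr : 0 < r) {c : ℂ}
    (hc : c ≠ 0) {w : ℂ} {k : ℕ} (h : HasLocalMultiplicity (logMap n M) w k) :
    HasLocalMultiplicity (interpolatingMap n M r c) (expChart n r w) k := by
  have hr0 : (r : ℂ) ≠ 0 := by exact_mod_cast hr.ne'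
  exact HasLocalMultiplicity.of_comp (mul_ne_zero hc (pow_ne_zero n hr0))
    (interpolatingMap_expChart hr hM c) (continuous_expChart n r).continuousAt
    (isOpenMap_expChart hn hr) (mem_nhds_im_sub_lt w) (expChart_injOn hn hr w.im) h

theorem expChart_mk (r x y : ℝ) : expChart n r ⟨x, y⟩ =
    r * Complex.exp (((Real.pi / n * x : ℝ) : ℂ) + ((Real.pi * y / n : ℝ) : ℂ) * Complex.I) := by
  rw [expChart, Complex.mk_eq_add_mul_I]
  congr 2
  push_cast
  ring

/-- With k = j + 1, both lists are one list with denominator 2 (q - 1), where q is m in the first p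
sectors and m + 1 in the others. -/
theorem mem_listedPoints_iff {r s : ℝ} {z : ℂ} :
    z ∈ listedPoints n M r s ↔ ∃ w, IsListed n M s w ∧ expChart n r w = z := by
  constructor
  · rintro (⟨l, k, hl, hk, hk', rfl⟩ | ⟨l, k, hl, hk, hk', rfl⟩)
    · obtain ⟨j, rfl⟩ : ∃ j, k = j + 1 := ⟨k - 1, by lia⟩
      have hj : j < lowCount n M := by lia
      have hq : sectorMult n M j = M / n := if_pos hj
      have hjn : j < n := by
        rcases Nat.eq_zero_or_pos n with rfl | hn
        · simp at hl
        · exact hj.trans_le (lowCount_le hn)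
      refine ⟨_, ⟨j, l, hjn, by lia, rfl⟩, ?_⟩
      rw [expChart_mk, hq]
      congr 5
      · ring
      · push_cast; ring
    · obtain ⟨j, rfl⟩ : ∃ j, k = j + 1 := ⟨k - 1, by lia⟩
      have hj : ¬ j < lowCount n M := by lia
      have hq : sectorMult n M j = M / n + 1 := if_neg hj
      refine ⟨_, ⟨j, l, by lia, by lia, rfl⟩, ?_⟩
      rw [expChart_mk, hq]
      congr 5
      · push_cast; ring
      · push_cast; ring
  · rintro ⟨w, ⟨j, l, hj, hl, rfl⟩, rfl⟩
    by_cases hlow : j < lowCount n M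
    · have hq : sectorMult n M j = M / n := if_pos hlow
      refine Or.inl ⟨l, j + 1, by lia, by lia, by lia, ?_⟩
      rw [expChart_mk, hq]
      congr 5
      · ring
      · push_cast; ring
    · have hq : sectorMult n M j = M / n + 1 := if_neg hlow
      refine Or.inr ⟨l, j + 1, by lia, by lia, by lia, ?_⟩
      rw [expChart_mk, hq]
      congr 5
      · push_cast; ring
      · push_cast; ring

end

/-! ### Assembly of the statements for the original map. -/

theorem mainTheorem6 (n M : ℕ) (hn : 1 ≤ n) (hM : n < M) (r : ℝ) (hr : 0 < r)
    (c : ℂ) (hc : c ≠ 0) :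
    -- the non-zero branched points, all of them simple; `g` is locally one-to-one elsewhere
    (∀ z : ℂ, z ≠ 0 →
      (IsBranchedPoint (interpolatingMap n M r c) z ↔ z ∈ listedPoints n M r 0)) ∧
    (∀ z : ℂ, z ≠ 0 → IsBranchedPoint (interpolatingMap n M r c) z →
      IsSimpleBranchedPoint (interpolatingMap n M r c) z) ∧
    (∀ z : ℂ, z ≠ 0 → z ∉ listedPoints n M r 0 →
      HasLocalMultiplicity (interpolatingMap n M r c) z 1) ∧
    -- the non-zero branched values
    (∀ w : ℂ, w ≠ 0 → IsBranchedValue (interpolatingMap n M r c) w →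
      w = c * r ^ n ∨ w = -(c * r ^ n)) ∧
    IsBranchedValue (interpolatingMap n M r c) (-(c * r ^ n)) ∧
    (IsBranchedValue (interpolatingMap n M r c) (c * r ^ n) ↔ 2 * n < M) ∧
    -- the zeros and their multiplicities
    (∀ z : ℂ, interpolatingMap n M r c z = 0 ↔ z = 0 ∨ z ∈ listedPoints n M r (1 / 2)) ∧
    HasLocalMultiplicity (interpolatingMap n M r c) 0 n ∧
    (∀ z ∈ listedPoints n M r (1 / 2), HasLocalMultiplicity (interpolatingMap n M r c) z 1) := by
  have hr0 : (r : ℂ) ≠ 0 := by exact_mod_cast hr.ne'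
  have hC : c * (r : ℂ) ^ n ≠ 0 := mul_ne_zero hc (pow_ne_zero n hr0)
  have hchart : ∀ w, expChart n r w ≠ 0 := fun w => mul_ne_zero hr0 (Complex.exp_ne_zero _)
  have htwo : ∀ z ∈ listedPoints n M r 0, HasLocalMultiplicity (interpolatingMap n M r c) z 2 := by
    intro z hz
    obtain ⟨w, hw, rfl⟩ := mem_listedPoints_iff.1 hz
    exact (hasLocalMultiplicity_logMap_of_isListed hn hM hw).expChart hn hM hr hc
  have hone : ∀ z : ℂ, z ≠ 0 → z ∉ listedPoints n M r 0 →
      HasLocalMultiplicity (interpolatingMap n M r c) z 1 := by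
    intro z hz hl
    obtain ⟨w, h0, h1, rfl⟩ := exists_expChart_eq hn hr hz
    obtain ⟨N, hN, hinj⟩ := exists_injOn_logMap hn hM h0 h1
      fun h => hl (mem_listedPoints_iff.2 ⟨w, h, rfl⟩)
    exact (hasLocalMultiplicity_one_of_injOn hN hinj).expChart hn hM hr hc
  have hbranch : ∀ z : ℂ, z ≠ 0 →
      (IsBranchedPoint (interpolatingMap n M r c) z ↔ z ∈ listedPoints n M r 0) := by
    intro z hz
    refine ⟨fun h => ?_, fun h => ⟨2, one_lt_two, htwo z h⟩⟩
    by_contra hl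
    exact (hone z hz hl).not_isBranchedPoint h
  have hzero : ∀ᶠ z in 𝓝 (0 : ℂ), interpolatingMap n M r c z = c * z ^ n := by
    filter_upwards [Metric.ball_mem_nhds (0 : ℂ) hr] with z hz
    exact if_pos (by simpa using hz)
  have hzero0 : interpolatingMap n M r c 0 = 0 := by
    rw [hzero.self_of_nhds, zero_pow (by lia), mul_zero]
  have hvalue : ∀ j l : ℕ, j < n → l + 2 ≤ sectorMult n M j →
      IsListed n M 0 ⟨l / (2 * (sectorMult n M j - 1)), 2 * j + 1⟩ ∧
      interpolatingMap n M r c (expChart n r ⟨l / (2 * (sectorMult n M j - 1)), 2 * j + 1⟩) =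
        c * r ^ n * (-1) ^ (l + 1) := by
    intro j l hj hl
    refine ⟨⟨j, l, hj, hl, by rw [add_zero]⟩, ?_⟩
    rw [interpolatingMap_expChart hr hM, logMap_of_isListed hn hM hj hl]
  have hbv : ∀ w : ℂ, w ≠ 0 → (IsBranchedValue (interpolatingMap n M r c) w ↔
      ∃ j l : ℕ, j < n ∧ l + 2 ≤ sectorMult n M j ∧ w = c * r ^ n * (-1) ^ (l + 1)) := by
    intro w hw
    constructor
    · rintro ⟨z, hz, rfl⟩
      -- The point 0 may itself be branched, but its value is 0.
      have hz0 : z ≠ 0 := fun h => hw (h ▸ hzero0)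
      obtain ⟨_, ⟨j, l, hj, hl, rfl⟩, rfl⟩ := mem_listedPoints_iff.1 ((hbranch z hz0).1 hz)
      refine ⟨j, l, hj, hl, ?_⟩
      rw [add_zero]
      exact (hvalue j l hj hl).2
    · rintro ⟨j, l, hj, hl, rfl⟩
      obtain ⟨h1, h2⟩ := hvalue j l hj hl
      exact ⟨_, (hbranch _ (hchart _)).2 (mem_listedPoints_iff.2 ⟨_, h1, rfl⟩), h2⟩
  have hzeros : ∀ z : ℂ, z ≠ 0 →
      (interpolatingMap n M r c z = 0 ↔ z ∈ listedPoints n M r (1 / 2)) := by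
    intro z hz
    rw [mem_listedPoints_iff]
    constructor
    · intro h
      obtain ⟨w, h0, h1, rfl⟩ := exists_expChart_eq hn hr hz
      rw [interpolatingMap_expChart hr hM] at h
      exact ⟨w, (logMap_eq_zero_iff hn hM h0 h1).1 ((mul_eq_zero.1 h).resolve_left hC), rfl⟩
    · rintro ⟨w, hw, rfl⟩
      obtain ⟨h0, h1⟩ := isListed_im hw
      rw [interpolatingMap_expChart hr hM, (logMap_eq_zero_iff hn hM h0 h1).2 hw, mul_zero]
  have hne : ∀ s, ∀ z ∈ listedPoints n M r s, z ≠ 0 := by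
    rintro s z hz rfl
    obtain ⟨w, -, hw⟩ := mem_listedPoints_iff.1 hz
    exact hchart w hw
  refine ⟨hbranch, fun z hz h => htwo z ((hbranch z hz).1 h), hone, ?_, ?_, ?_, ?_,
    hasLocalMultiplicity_pow hn hc hzero, ?_⟩
  · intro w hw h
    obtain ⟨j, l, -, -, rfl⟩ := (hbv w hw).1 h
    rcases neg_one_pow_eq_or ℂ (l + 1) with h | h <;> simp [h]
  -- As n < M, some sector has a slit; its end on the inner circle, l = 0, gives the value.
  · obtain ⟨j, hj, h⟩ := (exists_add_two_le_sectorMult (M := M) hn 0).2 (by lia)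
    exact (hbv _ (neg_ne_zero.2 hC)).2 ⟨j, 0, hj, h, by simp⟩
  · rw [hbv _ hC]
    constructor
    · rintro ⟨j, l, hj, hl, h⟩
      -- The index l = 0 gives the opposite sign, so l ≥ 1 and the multiplier is at least 3.
      have hl0 : l ≠ 0 := by
        rintro rfl
        rw [zero_add, pow_one, mul_neg_one, eq_neg_iff_add_eq_zero, ← two_mul] at h
        exact (mul_ne_zero two_ne_zero hC) h
      have := (exists_add_two_le_sectorMult (M := M) hn 1).1 ⟨j, hj, by lia⟩
      lia
    · intro h
      obtain ⟨j, hj, h⟩ := (exists_add_two_le_sectorMult (M := M) hn 1).2 (by lia)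
      exact ⟨j, 1, hj, h, by simp⟩
  · intro z
    by_cases hz : z = 0
    · simp [hz, hzero0]
    · simp [hz, hzeros z hz]
  · intro z hz
    -- A zero is not a listed branched point, because the values there are ±c r ^ n.
    refine hone z (hne _ z hz) fun h => ?_
    have h0 := (hzeros z (hne _ z hz)).2 hz
    obtain ⟨_, ⟨j, l, hj, hl, rfl⟩, rfl⟩ := mem_listedPoints_iff.1 h
    rw [add_zero, (hvalue j l hj hl).2] at h0
    exact mul_ne_zero hC (pow_ne_zero _ (by norm_num)) h0
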